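/- **Setting.** Consider a Markov decision process with state space $\mathcal S$, action space $\mathcal A$, transition probabilities $\mathcal P$, initial distribution $\mathcal P_0$, reward $\mathcal R(s,a)$ and discount factor $\gamma\in[0,1)$, and policies $\pi_\theta(a\mid s)>0$, $\theta\in\mathbb R^q$, given by probability densities in $a$ with respect to a fixed $\sigma$-finite measure on $\mathcal A$. A trajectory of length $H\ge 1$ is $\tau=(s_0,a_0,\dots,s_{H-1},a_{H-1})$, $p_\theta$ is its law under $\pi_\theta$ (and also its density), $\mathcal R(\tau)=\sum_{t=0}^{H-1}\gamma^t\mathcal R(s_t,a_t)$, $J(\theta)=\mathbb E_{\tau\sim p_\theta}[\mathcal R(\tau)]$ and $F=J-Q$, where $Q:\mathbb R^q\to\mathbb R\cup\{+\infty\}$. Put $$g(\tau|\theta)=\sum_{t=0}^{H-1}\nabla_\theta\log\pi_\theta(a_t|s_t)\,\big(\mathcal R(\tau)-b_t(s_t)\big),\qquad \omega(\tau|\theta_1,\theta_2)=\frac{p_{\theta_2}(\tau)}{p_{\theta_1}(\tau)},$$ with baselines satisfying $|b_t(s)|\le\bar b$, and $\mathcal G_\eta(\theta)=\eta^{-1}\big[\mathrm{prox}_{\eta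 Q}(\theta+\eta\nabla J(\theta))-\theta\big]$, where $\mathrm{prox}_{\eta Q}(x)=\arg\min_z\{\eta Q(z)+\tfrac12\|z-x\|^2\}$. **Assumptions.** (1) $Q$ is proper, closed and convex, and $F^*=\sup_\theta F(\theta)<+\infty$. (2) $|\mathcal R(s,a)|\le R$ for all $s,a$, where $R>0$. (3) $\log\pi_\theta(a|s)$ is twice differentiable in $\theta$ with $\|\nabla_\theta\log\pi_\theta(a|s)\|\le G$ and $\|\nabla^2_\theta\log\pi_\theta(a|s)\|\le M$ for all $\theta,s,a$, where $G,M>0$. (4) $\mathrm{Var}_{\tau\sim p_{\theta_1}}[\omega(\tau|\theta_1,\theta_2)]\le W$ for all $\theta_1,\theta_2$ in the domain $\mathrm{dom}\,Q=\{Q<+\infty\}$, where $W>0$. **Constants.** Let $$C_g=\frac{HG(R+\bar b)}{1-\gamma},\quad L_g=\frac{HM(R+\bar b)}{1-\gamma},\quad C_\omega=H(2HG^2+M)(W+1),\quad \overline C=C_g^2C_\omega+L_g^2,$$ and let $L$ and $\sigma$ be any constants with $L\ge\dfrac{HR(M+HG^2)}{1-\gamma}$ and $\sigma\ge C_g$.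 **Algorithm (ProxHSPGA).** Given $\theta_0\in\mathrm{dom}\,Q$, draw $N$ independent trajectories from $p_{\theta_0}$ and let $v_0$ be the average of $g(\cdot|\theta_0)$ over them. For $t=0,\dots,m$ put $\theta_{t+1}=(1-\alpha)\theta_t+\alpha\,\mathrm{prox}_{\eta Q}(\theta_t+\eta v_t)$, where for $t\ge1$, given the past, two independent batches $\mathcal B_t,\widehat{\mathcal B}_t$ of $B$ independent trajectories each are drawn from $p_{\theta_t}$ and $$v_t=\beta v_{t-1}+\frac{\beta}{B}\sum_{\tau\in\mathcal B_t}\big[g(\tau|\theta_t)-\omega(\tau|\theta_t,\theta_{t-1})g(\tau|\theta_{t-1})\big]+\frac{1-\beta}{B}\sum_{\hat\tau\in\widehat{\mathcal B}_t}g(\hat\tau|\theta_t).$$ **Theorem 1.** Let $1\le B\le N(m+1)$, let $0<\hat c\le 1$, and let $$\beta=1-\frac{\sqrt B}{\sqrt{N(m+1)}},\qquad \alpha=\frac{\hat c\sqrt2\,B^{3/4}}{\sqrt{3\overline C}\,N^{1/4}(m+1)^{1/4}},\qquad \eta=\frac{2}{4+L\alpha},$$ where $\hat c$ is such that $\alpha\le1$.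 If $\tilde\theta_T$ is chosen uniformly at random from $\{\theta_t\}_{t=0}^m$, independently of the batches, then $\|\mathcal G_\eta(\tilde\theta_T)\|^2$ is integrable and $$\mathbb E\big\|\mathcal G_\eta(\tilde\theta_T)\big\|^2\le\frac{3(4+L)^2\sigma^2}{4\,[BN(m+1)]^{1/2}}+\frac{(4+L)^2\sqrt{3\overline C}\,N^{1/4}}{4\,\hat c\sqrt2\,[B(m+1)]^{3/4}}\,\big[F^*-F(\theta_0)\big].$$ -/

import Mathlib

open MeasureTheory ProbabilityTheory
open scoped ENNReal

noncomputable section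

namespace HSPG

/-- A Markov decision process with measurable state space `S` and action space `A`. -/
structure MDP (S A : Type*) [MeasurableSpace S] [MeasurableSpace A] where
  /-- transition probabilities `P(ds' | s, a)` -/
  transition : Kernel (S × A) S
  isMarkov : IsMarkovKernel transition
  /-- initial state distribution -/
  init : Measure S
  isProb : IsProbabilityMeasure init
  /-- immediate reward -/
  reward : S → A → ℝ
  measurable_reward : Measurable (fun x : S × A => reward x.1 x.2)
  /-- discount factor -/
  discount : ℝ
  discount_nonneg : 0 ≤ discount
  discount_lt_one : discount < 1

/-- A family of policies `π_θ(a | s)`, `θ ∈ ℝ^q`, given by positive probability densities in `a` with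
respect to a reference measure `lam` on the action space (e.g. counting or Lebesgue measure). -/
structure Policy (q : ℕ) (S : Type*) {A : Type*} [MeasurableSpace S] [MeasurableSpace A]
    (lam : Measure A) where
  dens : EuclideanSpace ℝ (Fin q) → S → A → ℝ
  dens_pos : ∀ θ s a, 0 < dens θ s a
  measurable_dens : ∀ θ, Measurable (fun x : S × A => dens θ x.1 x.2)
  lintegral_dens : ∀ θ s, ∫⁻ a, ENNReal.ofReal (dens θ s a) ∂lam = 1

/-- Trajectories `(s_0, a_0, …, s_{H-1}, a_{H-1})`. -/
abbrev Traj (S A : Type*) (H : ℕ) : Type _ := Fin H → S × A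

section Trajectories

variable {S A : Type*} [MeasurableSpace S] [MeasurableSpace A]

/-- The reference measure `lam(da_0) P(ds_1|s_0,a_0) lam(da_1) ⋯ P(ds_{n-1}|s_{n-2},a_{n-2}) lam(da_{n-1})`
on trajectories of length `n` that start at a given state `s_0`. -/
def trajRef (P : Kernel (S × A) S) (lam : Measure A) : (n : ℕ) → Kernel S (Traj S A n)
  | 0 => Kernel.const S (Measure.dirac (fun i => i.elim0))
  | n + 1 =>
      (Kernel.id ×ₖ ((Kernel.const S lam) ⊗ₖ ((trajRef P lam n) ∘ₖ P))).map
        (fun x : S × (A × Traj S A n) => (Fin.cons (x.1, x.2.1) x.2.2 : Traj S A (n + 1)))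

variable {q : ℕ} {lam : Measure A}

/-- The density `p_θ(τ)` of the law of a trajectory with respect to the reference measure
`P_0(ds_0) lam(da_0) P(ds_1|s_0,a_0) lam(da_1) ⋯`; it is `∏_t π_θ(a_t | s_t)`. -/
def trajDens (π : Policy q S lam) {H : ℕ} (θ : EuclideanSpace ℝ (Fin q)) (τ : Traj S A H) : ℝ :=
  ∏ t, π.dens θ (τ t).1 (τ t).2

/-- The law on trajectories of length `H` induced by the policy `π_θ`. -/
def trajLaw (𝓜 : MDP S A) (π : Policy q S lam) (H : ℕ) (θ : EuclideanSpace ℝ (Fin q)) :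
    Measure (Traj S A H) :=
  ((trajRef 𝓜.transition lam H) ∘ₘ 𝓜.init).withDensity
    (fun τ => ENNReal.ofReal (trajDens π θ τ))

/-- The total discounted reward of a trajectory. -/
def totalReward (𝓜 : MDP S A) {H : ℕ} (τ : Traj S A H) : ℝ :=
  ∑ t : Fin H, 𝓜.discount ^ (t : ℕ) * 𝓜.reward (τ t).1 (τ t).2

/-- The expected discounted reward `J(θ)`. -/
def expReward (𝓜 : MDP S A) (π : Policy q S lam) (H : ℕ) (θ : EuclideanSpace ℝ (Fin q)) : ℝ :=
  ∫ τ, totalReward 𝓜 τ ∂(trajLaw 𝓜 π H θ)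

/-- The score `∇_θ log π_θ(a | s)`. -/
def score (π : Policy q S lam) (s : S) (a : A) (θ : EuclideanSpace ℝ (Fin q)) :
    EuclideanSpace ℝ (Fin q) :=
  gradient (fun θ' => Real.log (π.dens θ' s a)) θ

/-- The REINFORCE estimator with baseline,
`g(τ|θ) = ∑_t ∇ log π_θ(a_t|s_t) (R(τ) - b_t(s_t))`. -/
def gradEst (𝓜 : MDP S A) (π : Policy q S lam) {H : ℕ} (b : Fin H → S → ℝ)
    (θ : EuclideanSpace ℝ (Fin q)) (τ : Traj S A H) : EuclideanSpace ℝ (Fin q) :=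
  ∑ t, (totalReward 𝓜 τ - b t (τ t).1) • score π (τ t).1 (τ t).2 θ

/-- The importance weight `ω(τ | θ₁, θ₂) = p_{θ₂}(τ) / p_{θ₁}(τ)`. -/
def impWeight (π : Policy q S lam) {H : ℕ} (θ₁ θ₂ : EuclideanSpace ℝ (Fin q))
    (τ : Traj S A H) : ℝ :=
  trajDens π θ₂ τ / trajDens π θ₁ τ

end Trajectories

section Composite

variable {q : ℕ}

/-- `Q : ℝ^q → ℝ ∪ {+∞}` is proper, closed and convex. -/
structure ProperClosedConvex (Q : EuclideanSpace ℝ (Fin q) → EReal) : Prop where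
  ne_bot : ∀ θ, Q θ ≠ ⊥
  exists_ne_top : ∃ θ, Q θ ≠ ⊤
  lsc : LowerSemicontinuous Q
  convex_epigraph : Convex ℝ {x : EuclideanSpace ℝ (Fin q) × ℝ | Q x.1 ≤ (x.2 : EReal)}

/-- `z` minimizes `η Q(z) + ‖z - x‖² / 2`. -/
def IsProx (η : ℝ) (Q : EuclideanSpace ℝ (Fin q) → EReal) (x z : EuclideanSpace ℝ (Fin q)) :
    Prop :=
  ∀ y, (η : EReal) * Q z + ((‖z - x‖ ^ 2 / 2 : ℝ) : EReal) ≤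
    (η : EReal) * Q y + ((‖y - x‖ ^ 2 / 2 : ℝ) : EReal)

/-- The proximal operator `prox_{ηQ}` (for `η > 0` and `Q` proper, closed, convex the minimizer
exists and is unique). -/
def prox (η : ℝ) (Q : EuclideanSpace ℝ (Fin q) → EReal) (x : EuclideanSpace ℝ (Fin q)) :
    EuclideanSpace ℝ (Fin q) :=
  Classical.epsilon (IsProx η Q x)

/-- The composite objective `F = J - Q`. -/
def objective (J : EuclideanSpace ℝ (Fin q) → ℝ) (Q : EuclideanSpace ℝ (Fin q) → EReal)
    (θ : EuclideanSpace ℝ (Fin q)) : EReal :=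
  (J θ : EReal) - Q θ

/-- The proximal gradient mapping `G_η(θ) = η⁻¹ (prox_{ηQ}(θ + η ∇J(θ)) - θ)`. -/
def gradMap (J : EuclideanSpace ℝ (Fin q) → ℝ) (Q : EuclideanSpace ℝ (Fin q) → EReal) (η : ℝ)
    (θ : EuclideanSpace ℝ (Fin q)) : EuclideanSpace ℝ (Fin q) :=
  η⁻¹ • (prox η Q (θ + η • gradient J θ) - θ)

end Composite

section Algorithm

variable {S A : Type*} [MeasurableSpace S] [MeasurableSpace A] {q : ℕ} {lam : Measure A}

/-- The iterates of ProxHSPGA as a function of the sampled batches: the `t`-th term is the pair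
`(θ_t, v_t)`. Here `D₀` is the initial batch and `D t`, `D' t` (`t ≥ 1`) are the two batches of
iteration `t`. -/
def iter (𝓜 : MDP S A) (π : Policy q S lam) {H : ℕ} (b : Fin H → S → ℝ)
    (Q : EuclideanSpace ℝ (Fin q) → EReal) (α β η : ℝ) (θ₀ : EuclideanSpace ℝ (Fin q))
    {N B : ℕ} (D₀ : Fin N → Traj S A H) (D D' : ℕ → Fin B → Traj S A H) :
    ℕ → EuclideanSpace ℝ (Fin q) × EuclideanSpace ℝ (Fin q)
  | 0 => (θ₀, (1 / (N : ℝ)) • ∑ i, gradEst 𝓜 π b θ₀ (D₀ i))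
  | t + 1 =>
      let θ := (iter 𝓜 π b Q α β η θ₀ D₀ D D' t).1
      let v := (iter 𝓜 π b Q α β η θ₀ D₀ D D' t).2
      let θ' := (1 - α) • θ + α • prox η Q (θ + η • v)
      (θ',
        β • v
          + (β / (B : ℝ)) • ∑ i, (gradEst 𝓜 π b θ' (D (t + 1) i)
              - impWeight π θ' θ (D (t + 1) i) • gradEst 𝓜 π b θ (D (t + 1) i))
          + ((1 - β) / (B : ℝ)) • ∑ i, gradEst 𝓜 π b θ' (D' (t + 1) i))

/-- The `σ`-field generated by the initial batch and by the batches of the iterations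
`1, …, t - 1`. -/
abbrev history {Ω : Type*} {H N B : ℕ} (D₀ : Ω → Fin N → Traj S A H)
    (D D' : ℕ → Ω → Fin B → Traj S A H) (t : ℕ) : MeasurableSpace Ω :=
  MeasurableSpace.comap D₀ inferInstance ⊔
    ⨆ s ∈ Set.Ico 1 t,
      (MeasurableSpace.comap (D s) inferInstance ⊔ MeasurableSpace.comap (D' s) inferInstance)

/-- The random data of a run of ProxHSPGA with `m` iterations, initial batch size `N` and batch
sizes `B`, on a probability space `(Ω, μ)`: the initial batch consists of `N` independent
trajectories with law `p_{θ_0}`; given the past, the two batches of iteration `t` consist of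
`B + B` independent trajectories with law `p_{θ_t}`; the index `T` of the returned iterate is
uniform on `{0, …, m}` and independent of all batches. -/
structure IsRun (𝓜 : MDP S A) (π : Policy q S lam) {H : ℕ} (b : Fin H → S → ℝ)
    (Q : EuclideanSpace ℝ (Fin q) → EReal) (α β η : ℝ) (θ₀ : EuclideanSpace ℝ (Fin q))
    (m N B : ℕ) {Ω : Type*} [MeasurableSpace Ω] (μ : Measure Ω)
    (D₀ : Ω → Fin N → Traj S A H) (D D' : ℕ → Ω → Fin B → Traj S A H)
    (T : Ω → Fin (m + 1)) : Prop where
  measurable_init : Measurable D₀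
  measurable_batch : ∀ t ∈ Set.Icc 1 m, Measurable (D t) ∧ Measurable (D' t)
  measurable_index : Measurable T
  law_init : μ.map D₀ = Measure.pi (fun _ => trajLaw 𝓜 π H θ₀)
  cond_law_batch : ∀ t ∈ Set.Icc 1 m, ∀ C : Set Ω, MeasurableSet[history D₀ D D' t] C →
    ∀ E : Set ((Fin B → Traj S A H) × (Fin B → Traj S A H)), MeasurableSet E →
      μ (C ∩ {ω | (D t ω, D' t ω) ∈ E}) =
        ∫⁻ ω in C,
          ((Measure.pi (fun _ : Fin B => trajLaw 𝓜 π H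
              (iter 𝓜 π b Q α β η θ₀ (D₀ ω) (fun s => D s ω) (fun s => D' s ω) t).1)).prod
           (Measure.pi (fun _ : Fin B => trajLaw 𝓜 π H
              (iter 𝓜 π b Q α β η θ₀ (D₀ ω) (fun s => D s ω) (fun s => D' s ω) t).1))) E ∂μ
  uniform_index : ∀ k : Fin (m + 1), μ {ω | T ω = k} = ((m : ℝ≥0∞) + 1)⁻¹
  indep_index : Indep (MeasurableSpace.comap T inferInstance) (history D₀ D D' (m + 1)) μ

end Algorithm

section Constants

/-- Bound `C_g` for the norm of the estimator `g`. -/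
def constCg (R G bbar γ : ℝ) (H : ℕ) : ℝ := H * G * (R + bbar) / (1 - γ)

/-- Lipschitz constant `L_g` of `θ ↦ g(τ|θ)`. -/
def constLg (R M bbar γ : ℝ) (H : ℕ) : ℝ := H * M * (R + bbar) / (1 - γ)

/-- The constant `C_ω`. -/
def constCω (G M W : ℝ) (H : ℕ) : ℝ := H * (2 * H * G ^ 2 + M) * (W + 1)

/-- The constant `C̄ = C_g² C_ω + L_g²`. -/
def constCbar (R G M W bbar γ : ℝ) (H : ℕ) : ℝ :=
  constCg R G bbar γ H ^ 2 * constCω G M W H + constLg R M bbar γ H ^ 2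

/-- Lipschitz constant of `∇J`. -/
def constL (R G M γ : ℝ) (H : ℕ) : ℝ := H * R * (M + H * G ^ 2) / (1 - γ)

end Constants

end HSPG

end

noncomputable section

namespace HSPG

open scoped RealInnerProductSpace

/-! ### Proximal operators and the deterministic one-step inequalities -/

section ProximalOperator

variable {q : ℕ} {Q : EuclideanSpace ℝ (Fin q) → EReal}

/-! Let `e` be the error `v - ∇J(θ)` of the search direction (`searchError`), `d` the inexact
proximal displacement (`proxStep`) and `x` the exact one (`exactStep`), so that `‖G_η(θ)‖ = η⁻¹
‖x‖`. The proof couples a pathwise ascent inequality with a recursion for the mean square of `e`.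

Ascent. Smoothness of `J`, convexity of `Q` and the optimality of the prox give `F(θ_{t+1}) ≥ F(θ_t)
+ α (2‖d‖² - ⟪e, d⟫)` (`averaged_prox_step_ascent`). Firm nonexpansiveness of the prox gives `‖x‖² ≤
2‖d‖² - ⟪e, d⟫ + ‖e‖²/2 - ‖d‖²/3` (`norm_exact_step_sq_le`). Adding and telescoping bounds `α ∑
‖x_t‖²` by the optimality gap plus `α (∑ ‖e_t‖²/2 - ∑ ‖d_t‖²/3)` (`sum_exactStep_le`). The negative
term is what pays for the variance.

Error recursion. Given the past, `e_{t+1}` is `β e_t` plus independent centred noise. The unbiased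
batch contributes at most `(1-β)² σ²/B`. The importance-weighted correction has second moment at
most `2 C̄ ‖θ_{t+1} - θ_t‖² = 2 C̄ α² ‖d_t‖²` (`lintegral_gradCorrection_le`). The main point there
is `E(ω-1)² ≤ (HG)² (W+1) ‖θ_{t+1} - θ_t‖²` (`lintegral_ratio_sub_one_sq_le`): along a segment the
weight moves in `L²` with speed at most `HG` times its own `L²` norm, which is at most `√(W+1)`.

Balance. With `δ = 1 - β`, the choice of `α` makes `2 C̄ α²/B ≤ 4δ/3`; summing the recursion then
gives `∑ E‖e_t‖² ≤ 2 s0 + (2/3) ∑ E‖d_t‖²`, and the displacements cancel against the ascent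
inequality (`rate_of_error_recursion`). The uniform independent index turns the average over `t`
into the expectation at the returned iterate.

The smoothness of `J`, the policy gradient theorem and the weight estimate are all proved for
general families of densities with bounded Lipschitz scores (`LogSmoothFamily`), of which trajectory
densities are an instance. -/

lemma ProperClosedConvex.coe_toReal (hQ : ProperClosedConvex Q) {x : EuclideanSpace ℝ (Fin q)}
    (hx : Q x ≠ ⊤) : ((Q x).toReal : EReal) = Q x :=
  EReal.coe_toReal hx (hQ.ne_bot x)

lemma ProperClosedConvex.convex_combination (hQ : ProperClosedConvex Q)
    {x y : EuclideanSpace ℝ (Fin q)} (hx : Q x ≠ ⊤) (hy : Q y ≠ ⊤) {a b : ℝ} (ha : 0 ≤ a)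
    (hb : 0 ≤ b) (hab : a + b = 1) :
    Q (a • x + b • y) ≠ ⊤ ∧
      (Q (a • x + b • y)).toReal ≤ a * (Q x).toReal + b * (Q y).toReal := by
  have h := hQ.convex_epigraph (x := (x, (Q x).toReal)) (y := (y, (Q y).toReal))
    (by simp [hQ.coe_toReal hx]) (by simp [hQ.coe_toReal hy]) ha hb hab
  simp only [Prod.smul_mk, Prod.mk_add_mk, Set.mem_ofPred_eq, smul_eq_mul] at h
  have hne : Q (a • x + b • y) ≠ ⊤ := ne_top_of_le_ne_top (EReal.coe_ne_top _) h
  refine ⟨hne, ?_⟩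
  rw [← hQ.coe_toReal hne] at h
  exact_mod_cast h

/-- A lower semicontinuous function is bounded below on the compact unit ball around `z₀`. Convexity
along the segment from `z₀` to a far point `z`, evaluated where it crosses the unit sphere,
propagates this bound with linear loss. It replaces an affine minorant in the coercivity argument
for the prox. -/
lemma ProperClosedConvex.exists_linear_minorant (hQ : ProperClosedConvex Q)
    {z₀ : EuclideanSpace ℝ (Fin q)} (hz₀ : Q z₀ ≠ ⊤) :
    ∃ K : ℝ, 0 ≤ K ∧ ∀ z, Q z ≠ ⊤ → 1 ≤ ‖z - z₀‖ →
      (Q z₀).toReal - ‖z - z₀‖ * K ≤ (Q z).toReal := by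
  obtain ⟨w, hw, hmin⟩ := LowerSemicontinuousOn.exists_isMinOn (f := Q)
    (s := Metric.closedBall z₀ 1) ⟨z₀, by simp⟩ (isCompact_closedBall _ _)
    (hQ.lsc.lowerSemicontinuousOn _)
  have hle : Q w ≤ Q z₀ := hmin (by simp)
  have hwt : Q w ≠ ⊤ := ne_top_of_le_ne_top hz₀ hle
  refine ⟨(Q z₀).toReal - (Q w).toReal,
    sub_nonneg.2 (EReal.toReal_le_toReal hle (hQ.ne_bot w) hz₀), fun z hz hr => ?_⟩
  set r := ‖z - z₀‖
  have hr0 : 0 < r := by linarith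
  have hinv : 1 / r ≤ 1 := by rw [div_le_one hr0]; exact hr
  obtain ⟨hne, hcc⟩ := hQ.convex_combination hz₀ hz (a := 1 - 1 / r) (b := 1 / r)
    (by linarith) (by positivity) (by ring)
  have hmem : (1 - 1 / r) • z₀ + (1 / r) • z ∈ Metric.closedBall z₀ 1 := by
    have : (1 - 1 / r) • z₀ + (1 / r) • z - z₀ = (1 / r) • (z - z₀) := by module
    rw [Metric.mem_closedBall, dist_eq_norm, this, norm_smul, Real.norm_of_nonneg (by positivity)]
    exact (one_div_mul_cancel hr0.ne').le
  have h1 : (Q w).toReal ≤ (Q ((1 - 1 / r) • z₀ + (1 / r) • z)).toReal :=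
    EReal.toReal_le_toReal (hmin hmem) (hQ.ne_bot w) hne
  have h2 : r * (Q w).toReal ≤ r * ((1 - 1 / r) * (Q z₀).toReal + 1 / r * (Q z).toReal) :=
    mul_le_mul_of_nonneg_left (h1.trans hcc) hr0.le
  have h3 : r * ((1 - 1 / r) * (Q z₀).toReal + 1 / r * (Q z).toReal) =
      (r - 1) * (Q z₀).toReal + (Q z).toReal := by
    field_simp
  rw [h3] at h2
  linarith

lemma isProx_of_real (hQ : ProperClosedConvex Q) {η : ℝ} (hη : 0 < η)
    {x z : EuclideanSpace ℝ (Fin q)} (hz : Q z ≠ ⊤)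
    (h : ∀ y, Q y ≠ ⊤ → η * (Q z).toReal + ‖z - x‖ ^ 2 / 2 ≤ η * (Q y).toReal + ‖y - x‖ ^ 2 / 2) :
    IsProx η Q x z := by
  intro y
  by_cases hy : Q y = ⊤
  · rw [hy, EReal.coe_mul_top_of_pos hη, EReal.top_add_coe]
    exact le_top
  · rw [← hQ.coe_toReal hy, ← hQ.coe_toReal hz]
    exact_mod_cast h y hy

lemma IsProx.real (hQ : ProperClosedConvex Q) {η : ℝ} (hη : 0 < η)
    {x z : EuclideanSpace ℝ (Fin q)} (h : IsProx η Q x z) :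
    Q z ≠ ⊤ ∧ ∀ y, Q y ≠ ⊤ →
      η * (Q z).toReal + ‖z - x‖ ^ 2 / 2 ≤ η * (Q y).toReal + ‖y - x‖ ^ 2 / 2 := by
  obtain ⟨z₀, hz₀⟩ := hQ.exists_ne_top
  have hz : Q z ≠ ⊤ := by
    intro hz
    have := h z₀
    rw [hz, EReal.coe_mul_top_of_pos hη, EReal.top_add_coe, ← hQ.coe_toReal hz₀, top_le_iff] at this
    exact absurd this (by exact_mod_cast EReal.coe_ne_top _)
  refine ⟨hz, fun y hy => ?_⟩
  have := h y
  rw [← hQ.coe_toReal hy, ← hQ.coe_toReal hz] at this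
  exact_mod_cast this

/-- The quadratic term beats the at most linear decrease of `Q`, so outside a large ball the
objective is at least its value at `z₀`; inside, compactness and lower semicontinuity give a
minimizer. -/
lemma exists_isProx (hQ : ProperClosedConvex Q) {η : ℝ} (hη : 0 < η)
    (x : EuclideanSpace ℝ (Fin q)) : ∃ z, IsProx η Q x z := by
  obtain ⟨z₀, hz₀⟩ := hQ.exists_ne_top
  obtain ⟨K, hK, hlin⟩ := hQ.exists_linear_minorant hz₀
  set ρ := ‖z₀ - x‖
  -- For `r ≥ 2ρ + 2ηK` one has `(r - ρ)² - ρ² = r (r - 2ρ) ≥ 2ηK r`, which is exactly the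
  -- comparison needed outside the ball. The `1` makes the linear minorant applicable.
  set r₀ := max 1 (2 * ρ + 2 * η * K)
  have hr₀ : 1 ≤ r₀ := le_max_left _ _
  -- The objective is divided by `η`, so that in `EReal` only `Q` plus a continuous real function
  -- has to be handled.
  have hlsc : LowerSemicontinuous
      (fun z => Q z + ((‖z - x‖ ^ 2 / (2 * η) : ℝ) : EReal)) := by
    refine LowerSemicontinuous.add' hQ.lsc ?_ fun z => ?_
    · refine Continuous.lowerSemicontinuous (continuous_coe_real_ereal.comp ?_)
      fun_prop
    · exact EReal.continuousAt_add (Or.inr (EReal.coe_ne_bot _)) (Or.inr (EReal.coe_ne_top _))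
  obtain ⟨w, hw, hmin⟩ := LowerSemicontinuousOn.exists_isMinOn
    (s := Metric.closedBall z₀ r₀) ⟨z₀, by simp; linarith⟩ (isCompact_closedBall _ _)
    (hlsc.lowerSemicontinuousOn _)
  have key : ∀ y, Q y ≠ ⊤ → y ∈ Metric.closedBall z₀ r₀ → Q w ≠ ⊤ ∧
      (Q w).toReal + ‖w - x‖ ^ 2 / (2 * η) ≤ (Q y).toReal + ‖y - x‖ ^ 2 / (2 * η) := by
    intro y hy hyr
    have h := hmin hyr
    simp only [Set.mem_ofPred_eq] at h
    rw [← hQ.coe_toReal hy] at h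
    have hw : Q w ≠ ⊤ := by
      intro hw
      rw [hw, EReal.top_add_coe, top_le_iff] at h
      exact absurd h (by exact_mod_cast EReal.coe_ne_top _)
    rw [← hQ.coe_toReal hw] at h
    exact ⟨hw, by exact_mod_cast h⟩
  obtain ⟨hwt, hwz₀⟩ := key z₀ hz₀ (by simp; linarith)
  refine ⟨w, isProx_of_real hQ hη hwt fun y hy => ?_⟩
  have hmain : (Q w).toReal + ‖w - x‖ ^ 2 / (2 * η) ≤ (Q y).toReal + ‖y - x‖ ^ 2 / (2 * η) := by
    by_cases hyr : y ∈ Metric.closedBall z₀ r₀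
    · exact (key y hy hyr).2
    refine hwz₀.trans ?_
    rw [Metric.mem_closedBall, not_le, dist_eq_norm] at hyr
    set r := ‖y - z₀‖
    have h1 := hlin y hy (hr₀.trans hyr.le)
    have h2 : 2 * ρ + 2 * η * K ≤ r := (le_max_right _ _).trans hyr.le
    have h3 : r - ρ ≤ ‖y - x‖ := by
      have h4 : ‖y - z₀‖ ≤ ‖y - x‖ + ‖z₀ - x‖ := by
        have h5 := norm_sub_le (y - x) (z₀ - x)
        rwa [sub_sub_sub_cancel_right] at h5
      simp only [r, ρ]; linarith
    have hρ : 0 ≤ ρ := norm_nonneg _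
    have h4 : 0 ≤ r - ρ := by nlinarith [mul_nonneg hη.le hK]
    have h5 : (r - ρ) ^ 2 ≤ ‖y - x‖ ^ 2 := by gcongr
    have h6 : r * K ≤ (‖y - x‖ ^ 2 - ρ ^ 2) / (2 * η) := by
      rw [le_div_iff₀ (by positivity)]
      nlinarith [mul_nonneg (hr₀.trans hyr.le |>.trans' zero_le_one) (sub_nonneg.2 h2)]
    have h7 : (‖y - x‖ ^ 2 - ρ ^ 2) / (2 * η) =
      ‖y - x‖ ^ 2 / (2 * η) - ρ ^ 2 / (2 * η) := by ring
    linarith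
  have h8 := mul_le_mul_of_nonneg_left hmain hη.le
  have h9 : ∀ s c : ℝ, η * (c + s / (2 * η)) = η * c + s / 2 := by intro s c; field_simp
  rwa [h9, h9] at h8

lemma prox_spec (hQ : ProperClosedConvex Q) {η : ℝ} (hη : 0 < η)
    (x : EuclideanSpace ℝ (Fin q)) : IsProx η Q x (prox η Q x) :=
  Classical.epsilon_spec (exists_isProx hQ hη x)

lemma prox_ne_top (hQ : ProperClosedConvex Q) {η : ℝ} (hη : 0 < η)
    (x : EuclideanSpace ℝ (Fin q)) : Q (prox η Q x) ≠ ⊤ :=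
  ((prox_spec hQ hη x).real hQ hη).1

/-- Optimality condition: `x - prox x` is a subgradient of `ηQ` at `prox x`. Compare the minimum
with the point `(1 - t) z + t y`, divide by `t` and let `t` tend to `0`. -/
lemma prox_subgradient (hQ : ProperClosedConvex Q) {η : ℝ} (hη : 0 < η)
    (x : EuclideanSpace ℝ (Fin q)) {y : EuclideanSpace ℝ (Fin q)} (hy : Q y ≠ ⊤) :
    η * (Q (prox η Q x)).toReal + ⟪x - prox η Q x, y - prox η Q x⟫ ≤ η * (Q y).toReal := by
  obtain ⟨hz, hmin⟩ := (prox_spec hQ hη x).real hQ hη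
  set z := prox η Q x
  have key : ∀ t : ℝ, 0 < t → t ≤ 1 →
      η * (Q z).toReal + ⟪x - z, y - z⟫ ≤ η * (Q y).toReal + t * (‖y - z‖ ^ 2 / 2) := by
    intro t ht ht1
    obtain ⟨hne, hcc⟩ := hQ.convex_combination hz hy (a := 1 - t) (b := t) (by linarith) ht.le
      (by ring)
    have h1 := hmin _ hne
    have h2 : (1 - t) • z + t • y - x = t • (y - z) - (x - z) := by module
    have h3 : ‖z - x‖ = ‖x - z‖ := norm_sub_rev _ _
    rw [h2, h3, norm_sub_sq_real (t • (y - z)), norm_smul, inner_smul_left, Real.norm_of_nonneg ht.le,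
      real_inner_comm] at h1
    simp only [conj_trivial] at h1
    have h4 := mul_le_mul_of_nonneg_left hcc hη.le
    have h5 : t * (η * (Q z).toReal + ⟪x - z, y - z⟫) ≤
        t * (η * (Q y).toReal + t * (‖y - z‖ ^ 2 / 2)) := by nlinarith
    exact le_of_mul_le_mul_left h5 ht
  have hlim : Filter.Tendsto (fun t : ℝ => η * (Q y).toReal + t * (‖y - z‖ ^ 2 / 2))
      (nhdsWithin 0 (Set.Ioi 0)) (nhds (η * (Q y).toReal + 0 * (‖y - z‖ ^ 2 / 2))) :=
    (Continuous.tendsto (by fun_prop) 0).mono_left nhdsWithin_le_nhds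
  rw [zero_mul, add_zero] at hlim
  refine ge_of_tendsto hlim ?_
  filter_upwards [Ioc_mem_nhdsGT (zero_lt_one' ℝ)] with t ht using key t ht.1 ht.2

/-- Sum of the two subgradient inequalities, each tested at the other proximal point; the values of
`Q` cancel. -/
lemma prox_firmly_nonexpansive (hQ : ProperClosedConvex Q) {η : ℝ} (hη : 0 < η)
    (x y : EuclideanSpace ℝ (Fin q)) :
    ‖prox η Q x - prox η Q y‖ ^ 2 ≤ ⟪x - y, prox η Q x - prox η Q y⟫ := by
  have h1 := prox_subgradient hQ hη x (prox_ne_top hQ hη y)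
  have h2 := prox_subgradient hQ hη y (prox_ne_top hQ hη x)
  set p := prox η Q x
  set r := prox η Q y
  have h3 : ⟪x - p, r - p⟫ + ⟪y - r, p - r⟫ = ‖p - r‖ ^ 2 - ⟪x - y, p - r⟫ := by
    rw [← real_inner_self_eq_norm_sq]
    simp only [inner_sub_left, inner_sub_right]
    ring
  linarith

lemma norm_prox_sub_le (hQ : ProperClosedConvex Q) {η : ℝ} (hη : 0 < η)
    (x y : EuclideanSpace ℝ (Fin q)) : ‖prox η Q x - prox η Q y‖ ≤ ‖x - y‖ := by
  have h1 := prox_firmly_nonexpansive hQ hη x y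
  have h2 := real_inner_le_norm (x - y) (prox η Q x - prox η Q y)
  by_contra! h
  nlinarith [norm_nonneg (x - y), norm_nonneg (prox η Q x - prox η Q y)]

lemma continuous_prox (hQ : ProperClosedConvex Q) {η : ℝ} (hη : 0 < η) :
    Continuous (prox η Q) :=
  (LipschitzWith.of_dist_le_mul (K := 1) fun x y => by
    simpa [dist_eq_norm] using norm_prox_sub_le hQ hη x y).continuous

/-- One averaged proximal step increases `J - Q` up to the error of the search direction. -/
lemma averaged_prox_step_ascent (hQ : ProperClosedConvex Q)
    {J : EuclideanSpace ℝ (Fin q) → ℝ} {L : ℝ}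
    (hJ : ∀ x y, J x + ⟪gradient J x, y - x⟫ - L / 2 * ‖y - x‖ ^ 2 ≤ J y)
    {α η : ℝ} (hα : 0 < α) (hα1 : α ≤ 1) (hη : 0 < η) (hηα : η⁻¹ = 2 + L * α / 2)
    (θ v : EuclideanSpace ℝ (Fin q)) (hθ : Q θ ≠ ⊤) :
    Q ((1 - α) • θ + α • prox η Q (θ + η • v)) ≠ ⊤ ∧
    J θ - (Q θ).toReal + α * (2 * ‖prox η Q (θ + η • v) - θ‖ ^ 2
        - ⟪v - gradient J θ, prox η Q (θ + η • v) - θ⟫) ≤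
      J ((1 - α) • θ + α • prox η Q (θ + η • v))
        - (Q ((1 - α) • θ + α • prox η Q (θ + η • v))).toReal := by
  have hp := prox_ne_top hQ hη (θ + η • v)
  have hs := prox_subgradient hQ hη (θ + η • v) hθ
  set p := prox η Q (θ + η • v)
  obtain ⟨hne, hcc⟩ := hQ.convex_combination hθ hp (a := 1 - α) (b := α) (by linarith) hα.le
    (by ring)
  refine ⟨hne, ?_⟩
  have h1 := hJ θ ((1 - α) • θ + α • p)
  have h2 : (1 - α) • θ + α • p - θ = α • (p - θ) := by module
  rw [h2, inner_smul_right, norm_smul, Real.norm_of_nonneg hα.le, mul_pow] at h1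
  have h3 : ⟪θ + η • v - p, θ - p⟫ = ‖p - θ‖ ^ 2 - η * ⟪v, p - θ⟫ := by
    have h4 : θ + η • v - p = η • v - (p - θ) := by abel
    have h5 : θ - p = -(p - θ) := by abel
    rw [h4, h5, inner_neg_right, inner_sub_left, inner_smul_left, real_inner_self_eq_norm_sq]
    simp
  rw [h3] at hs
  have h6 := mul_le_mul_of_nonneg_left hs (inv_nonneg.2 hη.le)
  have h7 : η⁻¹ * (η * (Q p).toReal + (‖p - θ‖ ^ 2 - η * ⟪v, p - θ⟫)) =
      (Q p).toReal + η⁻¹ * ‖p - θ‖ ^ 2 - ⟪v, p - θ⟫ := by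
    field_simp; ring
  -- The part `Lα/2` of `η⁻¹` absorbs the curvature loss `(L/2) α² ‖p - θ‖²`; the part `2` is the
  -- gain that remains.
  rw [h7, inv_mul_cancel_left₀ hη.ne', hηα] at h6
  have h8 := mul_le_mul_of_nonneg_left h6 hα.le
  rw [inner_sub_left]
  nlinarith

/-- The exact proximal gradient step is controlled by the inexact one. -/
lemma norm_exact_step_sq_le (hQ : ProperClosedConvex Q) {η : ℝ} (hη : 0 < η) (hη2 : η ≤ 1 / 2)
    (θ v w : EuclideanSpace ℝ (Fin q)) :
    ‖prox η Q (θ + η • w) - θ‖ ^ 2 ≤ 2 * ‖prox η Q (θ + η • v) - θ‖ ^ 2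
      - ⟪v - w, prox η Q (θ + η • v) - θ⟫ + ‖v - w‖ ^ 2 / 2
      - ‖prox η Q (θ + η • v) - θ‖ ^ 2 / 3 := by
  have hf := prox_firmly_nonexpansive hQ hη (θ + η • v) (θ + η • w)
  set d := prox η Q (θ + η • v) - θ with hd
  set u := prox η Q (θ + η • v) - prox η Q (θ + η • w) with hu
  set e := v - w with he
  have h1 : θ + η • v - (θ + η • w) = η • e := by rw [he]; module
  rw [h1, inner_smul_left, conj_trivial] at hf
  have h2 : prox η Q (θ + η • w) - θ = d - u := by rw [hd, hu]; abel
  rw [h2, norm_sub_sq_real]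
  have hue : ‖u‖ ^ 2 ≤ ⟪e, u⟫ / 2 := by
    have : 0 ≤ ⟪e, u⟫ := by
      by_contra! hneg
      nlinarith [sq_nonneg ‖u‖, mul_neg_of_pos_of_neg hη hneg]
    nlinarith
  -- Here `x = d - u`. The claim is `3/2` times this square, plus `3/2` of `⟪e, u⟫ ≥ 2‖u‖²`, plus
  -- leftover nonnegative multiples of `‖e‖²` and `‖u‖²`.
  have h3 : 0 ≤ ‖(2 / 3 : ℝ) • d + (u - (1 / 2 : ℝ) • e)‖ ^ 2 := sq_nonneg _
  rw [norm_add_sq_real, norm_smul, norm_sub_sq_real, norm_smul] at h3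
  simp only [inner_smul_left, inner_smul_right, inner_sub_right, conj_trivial, mul_pow,
    Real.norm_eq_abs, sq_abs] at h3
  rw [real_inner_comm u e] at hue
  rw [real_inner_comm d e]
  nlinarith [sq_nonneg ‖e‖, sq_nonneg ‖u‖]

end ProximalOperator

/-! ### Scalar recursions and the choice of parameters -/

section Deterministic

/-- A distance along `[0, 1]` that is at most `C |t - s| exp (c |t - s|)` is at most `C` between
the end points. -/
lemma dist_le_of_local_bound {d : ℝ → ℝ → ℝ≥0∞} {C c : ℝ} (hC : 0 ≤ C)
    (hd : d 0 0 = 0)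
    (htri : ∀ r ∈ Set.Icc (0 : ℝ) 1, ∀ s ∈ Set.Icc (0 : ℝ) 1, ∀ t ∈ Set.Icc (0 : ℝ) 1,
      d r t ≤ d r s + d s t)
    (h : ∀ s ∈ Set.Icc (0 : ℝ) 1, ∀ t ∈ Set.Icc (0 : ℝ) 1,
      d s t ≤ ENNReal.ofReal (C * |t - s| * Real.exp (c * |t - s|))) :
    d 0 1 ≤ ENNReal.ofReal C := by
  -- Cutting `[0, 1]` into `n` equal pieces replaces the factor `exp c` by `exp (c / n)`, which
  -- tends to `1`.
  have step : ∀ n : ℕ, 0 < n → d 0 1 ≤ ENNReal.ofReal (C * Real.exp (c * (1 / n))) := by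
    intro n hn
    have hn' : (0 : ℝ) < n := by exact_mod_cast hn
    have hmem : ∀ k : ℕ, k ≤ n → (k / n : ℝ) ∈ Set.Icc (0 : ℝ) 1 := fun k hk =>
      ⟨by positivity, by rw [div_le_one hn']; exact_mod_cast hk⟩
    have hind : ∀ k : ℕ, k ≤ n →
        d 0 (k / n) ≤ ENNReal.ofReal (k * (C * (1 / n) * Real.exp (c * (1 / n)))) := by
      intro k
      induction k with
      | zero => intro _; simp [hd]
      | succ k ih =>
        intro hk
        have hk' := hmem k (by omega)
        have hdiff : |((k + 1 : ℕ) / n : ℝ) - k / n| = 1 / n := by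
          rw [← sub_div]; push_cast; rw [add_sub_cancel_left, abs_of_pos (by positivity)]
        have h2 := h _ hk' _ (hmem (k + 1) hk)
        rw [hdiff] at h2
        calc d 0 ((k + 1 : ℕ) / n) ≤ d 0 (k / n) + d (k / n) ((k + 1 : ℕ) / n) :=
              htri 0 (by simp) _ hk' _ (hmem (k + 1) hk)
          _ ≤ ENNReal.ofReal (k * (C * (1 / n) * Real.exp (c * (1 / n))))
              + ENNReal.ofReal (C * (1 / n) * Real.exp (c * (1 / n))) :=
              add_le_add (ih (by omega)) h2
          _ = _ := by
              rw [← ENNReal.ofReal_add (by positivity) (by positivity)]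
              push_cast; ring_nf
    have h1 := hind n le_rfl
    rw [div_self hn'.ne'] at h1
    convert h1 using 2
    field_simp
  have hlim : Filter.Tendsto (fun n : ℕ => ENNReal.ofReal (C * Real.exp (c * (1 / n))))
      Filter.atTop (nhds (ENNReal.ofReal (C * Real.exp (c * 0)))) :=
    ENNReal.tendsto_ofReal
      ((Real.continuous_exp.tendsto _ |>.comp
        (tendsto_one_div_atTop_nhds_zero_nat.const_mul c)).const_mul C)
  simp only [mul_zero, Real.exp_zero, mul_one] at hlim
  refine ge_of_tendsto hlim ?_
  filter_upwards [Filter.eventually_gt_atTop 0] with n hn using step n hn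

/-- Sum the recursion over `t < m` and enlarge the sums on the right to `t ≤ m` by nonnegativity;
the `a`-sum is then absorbed on the left. -/
lemma sum_le_of_contraction {a D : ℕ → ℝ} {ρ κ ν A : ℝ} {m : ℕ} (ha : ∀ t, 0 ≤ a t)
    (hD : ∀ t, 0 ≤ D t) (hρ : 0 ≤ ρ) (hκ : 0 ≤ κ) (h0 : a 0 ≤ A)
    (hrec : ∀ t < m, a (t + 1) ≤ ρ * a t + κ * D t + ν) :
    (1 - ρ) * ∑ t ∈ Finset.range (m + 1), a t ≤
      A + κ * ∑ t ∈ Finset.range (m + 1), D t + m * ν := by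
  have h1 : ∑ t ∈ Finset.range m, a (t + 1) ≤
      ∑ t ∈ Finset.range m, (ρ * a t + κ * D t + ν) :=
    Finset.sum_le_sum fun t ht => hrec t (Finset.mem_range.1 ht)
  rw [Finset.sum_add_distrib, Finset.sum_add_distrib, ← Finset.mul_sum, ← Finset.mul_sum,
    Finset.sum_const, Finset.card_range, nsmul_eq_mul] at h1
  have h2 := Finset.sum_range_succ' a m
  have h3 := mul_le_mul_of_nonneg_left
    (by rw [Finset.sum_range_succ]; linarith [ha m] :
      ∑ t ∈ Finset.range m, a t ≤ ∑ t ∈ Finset.range (m + 1), a t) hρ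
  have h4 := mul_le_mul_of_nonneg_left
    (by rw [Finset.sum_range_succ]; linarith [hD m] :
      ∑ t ∈ Finset.range m, D t ≤ ∑ t ∈ Finset.range (m + 1), D t) hκ
  linarith

/-- The rate obtained by balancing the error recursion against the sufficient ascent. -/
lemma rate_of_error_recursion {m N B : ℕ} (hB : 1 ≤ B) (hBN : B ≤ N * (m + 1))
    {c α β η L σ Cbar Δ : ℝ} (hC : 0 < Cbar) (hL : 0 ≤ L) (hc_pos : 0 < c) (hc : c ≤ 1)
    (hβ : β = 1 - √(B : ℝ) / √((N : ℝ) * (m + 1)))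
    (hα : α = c * √2 * (B : ℝ) ^ (3 / 4 : ℝ) /
      (√(3 * Cbar) * (N : ℝ) ^ (1 / 4 : ℝ) * ((m : ℝ) + 1) ^ (1 / 4 : ℝ)))
    (hα_le : α ≤ 1) (hη : η = 2 / (4 + L * α)) (hΔ : 0 ≤ Δ)
    {a D X : ℕ → ℝ} (ha : ∀ t, 0 ≤ a t) (hD : ∀ t, 0 ≤ D t)
    (h0 : a 0 ≤ σ ^ 2 / N)
    (hrec : ∀ t < m, a (t + 1) ≤
      β ^ 2 * a t + 2 * β ^ 2 * Cbar / B * (α ^ 2 * D t) + (1 - β) ^ 2 * σ ^ 2 / B)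
    (hX : α * ∑ t ∈ Finset.range (m + 1), X t ≤
      Δ + α * ((∑ t ∈ Finset.range (m + 1), a t) / 2 - (∑ t ∈ Finset.range (m + 1), D t) / 3)) :
    ((m : ℝ) + 1)⁻¹ * ((η⁻¹) ^ 2 * ∑ t ∈ Finset.range (m + 1), X t) ≤
      3 * (4 + L) ^ 2 * σ ^ 2 / (4 * √((B : ℝ) * N * (m + 1)))
      + (4 + L) ^ 2 * √(3 * Cbar) * (N : ℝ) ^ (1 / 4 : ℝ)
          / (4 * c * √2 * ((B : ℝ) * (m + 1)) ^ (3 / 4 : ℝ)) * Δ := by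
  have hB0 : (0 : ℝ) < B := by exact_mod_cast hB
  have hN0 : (0 : ℝ) < N := by
    rcases Nat.eq_zero_or_pos N with h | h
    · subst h; omega
    · exact_mod_cast h
  set n : ℝ := (m : ℝ) + 1 with hn
  have hn0 : 0 < n := by positivity
  have hBN' : (B : ℝ) ≤ N * n := by rw [hn]; exact_mod_cast hBN
  set δ := √(B : ℝ) / √((N : ℝ) * n) with hδ
  have hδ0 : 0 < δ := by positivity
  have hδ1 : δ ≤ 1 := by
    rw [hδ, div_le_one (by positivity)]; exact Real.sqrt_le_sqrt hBN'
  have hβ0 : 0 ≤ β := by rw [hβ]; linarith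
  have hβ1 : β ≤ 1 := by rw [hβ]; linarith
  have hδβ : 1 - β = δ := by rw [hβ]; ring
  have hα0 : 0 < α := by rw [hα]; positivity
  set bb := √(B : ℝ)
  set sN := √(N : ℝ)
  set sn := √n
  have hbb : bb ^ 2 = B := Real.sq_sqrt hB0.le
  have hsN : sN ^ 2 = N := Real.sq_sqrt hN0.le
  have hsn : sn ^ 2 = n := Real.sq_sqrt hn0.le
  have hbb0 : 0 < bb := Real.sqrt_pos.2 hB0
  have hsN0 : 0 < sN := Real.sqrt_pos.2 hN0
  have hsn0 : 0 < sn := Real.sqrt_pos.2 hn0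
  have hδ' : δ = bb / (sN * sn) := by rw [hδ, Real.sqrt_mul hN0.le]
  have hquarter : ∀ x : ℝ, 0 < x → (x ^ (1 / 4 : ℝ)) ^ 2 = √x := by
    intro x hx
    rw [← Real.rpow_natCast, ← Real.rpow_mul hx.le, Real.sqrt_eq_rpow]; norm_num
  have h34 : ((B : ℝ) ^ (3 / 4 : ℝ)) ^ 2 = bb ^ 3 := by
    change _ = √(B : ℝ) ^ 3
    rw [← Real.rpow_natCast, ← Real.rpow_mul hB0.le, Real.sqrt_eq_rpow, ← Real.rpow_natCast,
      ← Real.rpow_mul hB0.le]; norm_num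
  have hα2 : α ^ 2 = c ^ 2 * 2 * bb ^ 3 / (3 * Cbar * sN * sn) := by
    rw [hα, div_pow, mul_pow, mul_pow, mul_pow, mul_pow, hquarter _ hN0, hquarter _ hn0, h34,
      Real.sq_sqrt (by positivity), Real.sq_sqrt (by positivity)]
  -- This is where the formula for `α` comes from: at `c = 1` it gives equality.
  have hκ : 2 * Cbar / B * α ^ 2 ≤ 4 / 3 * δ := by
    have : 2 * Cbar / B * α ^ 2 = 4 / 3 * δ * c ^ 2 := by
      rw [hα2, hδ', ← hbb]; field_simp; ring
    rw [this]
    have hc2 : c ^ 2 ≤ 1 := pow_le_one₀ hc_pos.le hc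
    exact mul_le_of_le_one_right (by positivity) hc2
  -- The choice of `β` makes the initial error `σ²/N` equal to the noise `n δ² σ²/B` accumulated
  -- over `n = m + 1` steps; both are `δ * s0`.
  set s0 := σ ^ 2 * sn / (sN * bb) with hs0
  have hs0n : 0 ≤ s0 := by positivity
  have hA : σ ^ 2 / N = δ * s0 := by
    rw [hs0, hδ', ← hsN]; field_simp
  have hν : n * ((1 - β) ^ 2 * σ ^ 2 / B) = δ * s0 := by
    rw [hδβ, hs0, hδ', ← hbb, ← hsn]; field_simp
  have hsum := sum_le_of_contraction (κ := β ^ 2 * (4 / 3 * δ))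
    (ν := (1 - β) ^ 2 * σ ^ 2 / B) ha hD (sq_nonneg β)
    (by positivity) h0 (fun t ht => (hrec t ht).trans (by
      have h1 : 2 * β ^ 2 * Cbar / B * (α ^ 2 * D t) =
        β ^ 2 * (2 * Cbar / B * α ^ 2) * D t := by ring
      rw [h1]
      have h2 : β ^ 2 * (2 * Cbar / B * α ^ 2) * D t ≤ β ^ 2 * (4 / 3 * δ) * D t :=
        mul_le_mul_of_nonneg_right (mul_le_mul_of_nonneg_left hκ (sq_nonneg β)) (hD t)
      linarith))
  set SA := ∑ t ∈ Finset.range (m + 1), a t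
  set SD := ∑ t ∈ Finset.range (m + 1), D t
  set SX := ∑ t ∈ Finset.range (m + 1), X t
  have hSA : 0 ≤ SA := Finset.sum_nonneg fun t _ => ha t
  have hSD : 0 ≤ SD := Finset.sum_nonneg fun t _ => hD t
  have hmν : (m : ℝ) * ((1 - β) ^ 2 * σ ^ 2 / B) ≤ δ * s0 := by
    rw [← hν]; gcongr; linarith
  -- Since `1 - β² = δ (1 + β)`, the factor `δ` cancels. The coefficient of `SD` is handled by `2β²
  -- ≤ 1 + β`, that is `(1 - β)(1 + 2β) ≥ 0`.
  have hSA2 : SA ≤ 2 * s0 + 2 / 3 * SD := by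
    have h1 : δ * ((1 + β) * SA) ≤ δ * (2 * s0 + β ^ 2 * (4 / 3) * SD) := by
      have h2 : (1 - β ^ 2) * SA = δ * ((1 + β) * SA) := by rw [← hδβ]; ring
      rw [← h2]; rw [hA] at hsum; linarith
    have h3 := le_of_mul_le_mul_left h1 hδ0
    have h4 : (1 + β) * SA ≤ (1 + β) * (2 * s0 + 2 / 3 * SD) := by
      have h5 : β ^ 2 * (4 / 3) ≤ (1 + β) * (2 / 3) := by
        have := mul_nonneg (sub_nonneg.2 hβ1) (by linarith : 0 ≤ 1 + 2 * β)
        linarith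
      have h6 := mul_le_mul_of_nonneg_right h5 hSD
      have h7 := mul_nonneg hβ0 hs0n
      linarith
    exact le_of_mul_le_mul_left h4 (by linarith)
  -- The terms in `SD` cancel exactly. The argument gives `s0`; the factor `3` is slack matching the
  -- stated constant.
  have hSX : SX ≤ Δ / α + 3 * s0 := by
    have h1 : α * SX ≤ α * (Δ / α + 3 * s0) := by
      rw [mul_add, mul_div_cancel₀ _ hα0.ne']
      have : α * (SA / 2 - SD / 3) ≤ α * (3 * s0) := by gcongr; linarith
      linarith
    exact le_of_mul_le_mul_left h1 hα0
  have hη2 : (η⁻¹) ^ 2 ≤ (4 + L) ^ 2 / 4 := by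
    have h1 : η⁻¹ = (4 + L * α) / 2 := by rw [hη, inv_div]
    rw [h1, div_pow]
    have h2 : L * α ≤ L := mul_le_of_le_one_right hL hα_le
    have h3 : 0 ≤ L * α := by positivity
    gcongr ?_ / ?_
    · gcongr
    · norm_num
  have hs0' : n⁻¹ * s0 = σ ^ 2 / √((B : ℝ) * N * n) := by
    rw [Real.sqrt_mul (by positivity), Real.sqrt_mul hB0.le, hs0]
    change n⁻¹ * _ = σ ^ 2 / (bb * sN * sn)
    rw [← hsn]; field_simp
  have hinvα : n⁻¹ * (1 / α) = √(3 * Cbar) * (N : ℝ) ^ (1 / 4 : ℝ) /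
      (c * √2 * ((B : ℝ) * n) ^ (3 / 4 : ℝ)) := by
    have h1 : n ^ (1 / 4 : ℝ) * n ^ (3 / 4 : ℝ) = n := by
      rw [← Real.rpow_add hn0]; norm_num
    have hp : 0 < n ^ (3 / 4 : ℝ) := by positivity
    rw [Real.mul_rpow hB0.le hn0.le, hα]
    nth_rewrite 1 [← h1]
    field_simp
  calc n⁻¹ * ((η⁻¹) ^ 2 * SX) ≤ n⁻¹ * ((4 + L) ^ 2 / 4 * (Δ / α + 3 * s0)) := by
        have h1 : 0 ≤ Δ / α + 3 * s0 := by positivity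
        have h2 : (η⁻¹) ^ 2 * SX ≤ (4 + L) ^ 2 / 4 * (Δ / α + 3 * s0) :=
          (mul_le_mul_of_nonneg_left hSX (sq_nonneg _)).trans
            (mul_le_mul_of_nonneg_right hη2 h1)
        gcongr
    _ = 3 * ((4 + L) ^ 2 / 4) * (n⁻¹ * s0) + (4 + L) ^ 2 / 4 * (n⁻¹ * (1 / α)) * Δ := by
        field_simp; ring
    _ = _ := by
        rw [hs0', hinvα]; field_simp

end Deterministic

/-! ### Families of densities with bounded, Lipschitz scores -/

section LogSmoothFamilies

/-- A gradient with respect to a parameter is measurable in the variable. -/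
lemma measurable_of_hasGradientAt {q : ℕ} {X : Type*} [MeasurableSpace X]
    {f : EuclideanSpace ℝ (Fin q) → X → ℝ} {g : X → EuclideanSpace ℝ (Fin q)}
    {θ : EuclideanSpace ℝ (Fin q)} (hf : ∀ θ', Measurable (f θ'))
    (hg : ∀ x, HasGradientAt (fun θ' => f θ' x) (g x) θ) : Measurable g := by
  have hinner : ∀ v : EuclideanSpace ℝ (Fin q), Measurable fun x => ⟪v, g x⟫ := by
    intro v
    -- Each directional derivative is a pointwise limit of the difference quotients with step `1/n`;
    -- the gradient is then recovered in an orthonormal basis.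
    refine measurable_of_tendsto_metrizable
      (f := fun (n : ℕ) x => (n : ℝ) • (f (θ + (n : ℝ)⁻¹ • v) x - f θ x)) (fun n => ?_) ?_
    · simp only [smul_eq_mul]
      exact ((hf _).sub (hf _)).const_mul _
    · rw [tendsto_pi_nhds]
      intro x
      have h1 := (hg x).hasFDerivAt.lim v
        (c := fun n : ℕ => (n : ℝ)) (l := Filter.atTop)
        (by simpa using tendsto_natCast_atTop_atTop)
      rw [InnerProductSpace.toDual_apply_apply, real_inner_comm] at h1
      exact h1
  have hsum : g = fun x => ∑ i, ⟪EuclideanSpace.basisFun (Fin q) ℝ i, g x⟫ •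
      EuclideanSpace.basisFun (Fin q) ℝ i := by
    ext1 x
    exact ((EuclideanSpace.basisFun (Fin q) ℝ).sum_repr' (g x)).symm
  rw [hsum]
  exact Finset.measurable_sum _ fun i _ => (hinner _).smul_const _

/-- A family of positive probability densities whose scores are bounded by `C` and `K`-Lipschitz. -/
structure LogSmoothFamily {q : ℕ} {X : Type*} [MeasurableSpace X] (ν : Measure X)
    (p : EuclideanSpace ℝ (Fin q) → X → ℝ)
    (s : EuclideanSpace ℝ (Fin q) → X → EuclideanSpace ℝ (Fin q)) (C K : ℝ) : Prop where
  pos : ∀ θ x, 0 < p θ x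
  measurable : ∀ θ, Measurable (p θ)
  lintegral_eq_one : ∀ θ, ∫⁻ x, ENNReal.ofReal (p θ x) ∂ν = 1
  hasGradientAt_log : ∀ θ x, HasGradientAt (fun θ' => Real.log (p θ' x)) (s θ x) θ
  norm_score_le : ∀ θ x, ‖s θ x‖ ≤ C
  norm_score_sub_le : ∀ θ θ' x, ‖s θ x - s θ' x‖ ≤ K * ‖θ - θ'‖
  C_nonneg : 0 ≤ C
  K_nonneg : 0 ≤ K

/-- The probability measure of a density of the family. -/
abbrev densityLaw {q : ℕ} {X : Type*} [MeasurableSpace X] (ν : Measure X)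
    (p : EuclideanSpace ℝ (Fin q) → X → ℝ) (θ : EuclideanSpace ℝ (Fin q)) : Measure X :=
  ν.withDensity fun x => ENNReal.ofReal (p θ x)

namespace LogSmoothFamily

variable {q : ℕ} {X : Type*} [MeasurableSpace X] {ν : Measure X}
  {p : EuclideanSpace ℝ (Fin q) → X → ℝ}
  {s : EuclideanSpace ℝ (Fin q) → X → EuclideanSpace ℝ (Fin q)} {C K : ℝ}

lemma isProbabilityMeasure (h : LogSmoothFamily ν p s C K) (θ : EuclideanSpace ℝ (Fin q)) :
    IsProbabilityMeasure (densityLaw ν p θ) :=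
  ⟨by rw [withDensity_apply _ MeasurableSet.univ, Measure.restrict_univ, h.lintegral_eq_one]⟩

lemma integrable (h : LogSmoothFamily ν p s C K) (θ : EuclideanSpace ℝ (Fin q)) :
    Integrable (p θ) ν := by
  refine ⟨(h.measurable θ).aestronglyMeasurable, ?_⟩
  rw [hasFiniteIntegral_iff_ofReal (Filter.Eventually.of_forall fun x => (h.pos θ x).le),
    h.lintegral_eq_one]
  exact ENNReal.one_lt_top

lemma integral_eq_one (h : LogSmoothFamily ν p s C K) (θ : EuclideanSpace ℝ (Fin q)) :
    ∫ x, p θ x ∂ν = 1 := by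
  rw [integral_eq_lintegral_of_nonneg_ae (Filter.Eventually.of_forall fun x => (h.pos θ x).le)
    (h.measurable θ).aestronglyMeasurable, h.lintegral_eq_one, ENNReal.toReal_one]

lemma integral_law (h : LogSmoothFamily ν p s C K) {V : Type*} [NormedAddCommGroup V]
    [NormedSpace ℝ V] (θ : EuclideanSpace ℝ (Fin q)) (f : X → V) :
    ∫ x, f x ∂(densityLaw ν p θ) = ∫ x, p θ x • f x ∂ν := by
  rw [integral_withDensity_eq_integral_toReal_smul (h.measurable θ).ennreal_ofReal
    (Filter.Eventually.of_forall fun x => ENNReal.ofReal_lt_top)]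
  simp_rw [ENNReal.toReal_ofReal (h.pos θ _).le]

lemma measurable_score (h : LogSmoothFamily ν p s C K) (θ : EuclideanSpace ℝ (Fin q)) :
    Measurable (s θ) :=
  measurable_of_hasGradientAt (f := fun θ x => Real.log (p θ x))
    (fun θ' => (h.measurable θ').log) (h.hasGradientAt_log θ)

lemma hasGradientAt (h : LogSmoothFamily ν p s C K) (θ : EuclideanSpace ℝ (Fin q)) (x : X) :
    HasGradientAt (fun θ' => p θ' x) (p θ x • s θ x) θ := by
  have h1 := (h.hasGradientAt_log θ x).hasFDerivAt.exp
  have h2 : (fun θ' => Real.exp (Real.log (p θ' x))) = fun θ' => p θ' x := by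
    ext θ'; exact Real.exp_log (h.pos θ' x)
  rw [h2, Real.exp_log (h.pos θ x)] at h1
  rw [hasGradientAt_iff_hasFDerivAt, map_smul]
  exact h1

lemma continuous_density (h : LogSmoothFamily ν p s C K) (x : X) : Continuous fun θ => p θ x :=
  continuous_iff_continuousAt.2 fun θ => (h.hasGradientAt θ x).continuousAt

lemma abs_log_sub_le (h : LogSmoothFamily ν p s C K) (θ θ' : EuclideanSpace ℝ (Fin q)) (x : X) :
    |Real.log (p θ' x) - Real.log (p θ x)| ≤ C * ‖θ' - θ‖ :=
  Convex.norm_image_sub_le_of_norm_hasFDerivWithin_le (s := Set.univ)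
    (fun y _ => (h.hasGradientAt_log y x).hasFDerivAt.hasFDerivWithinAt)
    (fun y _ => by simpa using h.norm_score_le y x) convex_univ trivial trivial

lemma density_le (h : LogSmoothFamily ν p s C K) (θ θ' : EuclideanSpace ℝ (Fin q)) (x : X) :
    p θ' x ≤ p θ x * Real.exp (C * ‖θ' - θ‖) := by
  have h1 := (abs_le.1 (h.abs_log_sub_le θ θ' x)).2
  rw [← Real.exp_log (h.pos θ' x), ← Real.exp_log (h.pos θ x), ← Real.exp_add]
  exact Real.exp_le_exp.2 (by linarith)

/-- The log-density is `C`-Lipschitz, so the ratio of the densities lies between `exp (-r)` and `exp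
r`. Keeping the bound relative to `p θ x` lets it integrate to a constant, whatever the reference
measure. -/
lemma abs_density_sub_le (h : LogSmoothFamily ν p s C K) (θ θ' : EuclideanSpace ℝ (Fin q))
    (x : X) : |p θ' x - p θ x| ≤ p θ x * (C * ‖θ' - θ‖ * Real.exp (C * ‖θ' - θ‖)) := by
  have h1 := h.density_le θ θ' x
  have h2 := h.density_le θ' θ x
  rw [norm_sub_rev] at h2
  set r := C * ‖θ' - θ‖
  have hr : 0 ≤ r := mul_nonneg h.C_nonneg (norm_nonneg _)
  have hp := h.pos θ x
  have h3 : 1 - r ≤ Real.exp (-r) := by linarith [Real.add_one_le_exp (-r)]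
  have h4 : Real.exp r * Real.exp (-r) = 1 := by rw [← Real.exp_add]; simp
  have h5 : Real.exp r - 1 ≤ r * Real.exp r := by nlinarith [Real.exp_pos r]
  have h6 : p θ x * Real.exp (-r) ≤ p θ' x := by
    have := mul_le_mul_of_nonneg_right h2 (Real.exp_pos (-r)).le
    rwa [mul_assoc, h4, mul_one] at this
  have h7 : r ≤ r * Real.exp r := by nlinarith [Real.add_one_le_exp r]
  rw [abs_le]
  constructor <;> nlinarith

/-- The gradient of a density is `p s`. Varying the score costs `K`; varying the density costs `C`,
multiplied by the size `C` of the score. -/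
lemma norm_gradient_sub_le (h : LogSmoothFamily ν p s C K) (θ θ' : EuclideanSpace ℝ (Fin q))
    (x : X) : ‖p θ' x • s θ' x - p θ x • s θ x‖ ≤
      p θ x * ((K + C ^ 2) * ‖θ' - θ‖ * Real.exp (C * ‖θ' - θ‖)) := by
  have h1 : p θ' x • s θ' x - p θ x • s θ x =
      p θ' x • (s θ' x - s θ x) + (p θ' x - p θ x) • s θ x := by module
  rw [h1]
  calc ‖p θ' x • (s θ' x - s θ x) + (p θ' x - p θ x) • s θ x‖
      ≤ p θ' x * ‖s θ' x - s θ x‖ + |p θ' x - p θ x| * ‖s θ x‖ := by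
        refine (norm_add_le _ _).trans_eq ?_
        rw [norm_smul, norm_smul, Real.norm_of_nonneg (h.pos θ' x).le, Real.norm_eq_abs]
    _ ≤ (p θ x * Real.exp (C * ‖θ' - θ‖)) * (K * ‖θ' - θ‖)
        + (p θ x * (C * ‖θ' - θ‖ * Real.exp (C * ‖θ' - θ‖))) * C := by
        have := h.pos θ x
        have := h.C_nonneg
        gcongr
        · exact h.density_le θ θ' x
        · exact h.norm_score_sub_le θ' θ x
        · exact h.abs_density_sub_le θ θ' x
        · exact h.norm_score_le θ x
    _ = _ := by ring

/-- Differentiation under the integral: on the unit ball around `θ` all densities are dominated by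
`exp C` times the one at `θ`. -/
lemma hasGradientAt_integral (h : LogSmoothFamily ν p s C K) {f : X → ℝ} (hf : Measurable f)
    {R : ℝ} (hR : ∀ x, |f x| ≤ R) (θ : EuclideanSpace ℝ (Fin q)) :
    HasGradientAt (fun θ' => ∫ x, f x ∂(densityLaw ν p θ'))
      (∫ x, f x • s θ x ∂(densityLaw ν p θ)) θ := by
  have hint : ∀ θ', Integrable (fun x => p θ' x * f x) ν := fun θ' =>
    (h.integrable θ').mul_bdd (c := R) hf.aestronglyMeasurable
      (Filter.Eventually.of_forall fun x => hR x)
  have hmeas : AEStronglyMeasurable (fun x => p θ x • f x • s θ x) ν :=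
    ((h.measurable θ).smul (hf.smul (h.measurable_score θ))).aestronglyMeasurable
  have key := hasFDerivAt_integral_of_dominated_of_fderiv_le (μ := ν) (𝕜 := ℝ)
    (F := fun θ' x => p θ' x * f x)
    (F' := fun θ' x => InnerProductSpace.toDual ℝ (EuclideanSpace ℝ (Fin q))
      (p θ' x • f x • s θ' x))
    (x₀ := θ) (s := Metric.ball θ 1) (bound := fun x => p θ x * (Real.exp C * (R * C)))
    (Metric.ball_mem_nhds θ one_pos)
    (Filter.Eventually.of_forall fun θ' => (hint θ').aestronglyMeasurable) (hint θ)
    ((InnerProductSpace.toDual ℝ (EuclideanSpace ℝ (Fin q))).continuous.comp_aestronglyMeasurable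
      hmeas)
    (Filter.Eventually.of_forall fun x θ' hθ' => ?_)
    ((h.integrable θ).mul_const _)
    (Filter.Eventually.of_forall fun x θ' _ => ?_)
  · rw [hasGradientAt_iff_hasFDerivAt]
    simp_rw [h.integral_law, smul_eq_mul]
    have hcomm := (InnerProductSpace.toDual ℝ
      (EuclideanSpace ℝ (Fin q))).toContinuousLinearEquiv.integral_comp_comm
      (μ := ν) (fun x => p θ x • f x • s θ x)
    have hcomm' : ∫ x, InnerProductSpace.toDual ℝ (EuclideanSpace ℝ (Fin q))
        (p θ x • f x • s θ x) ∂ν = InnerProductSpace.toDual ℝ (EuclideanSpace ℝ (Fin q))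
        (∫ x, p θ x • f x • s θ x ∂ν) := hcomm
    rw [← hcomm']
    exact key
  · rw [LinearIsometryEquiv.norm_map, norm_smul, norm_smul, Real.norm_of_nonneg (h.pos θ' x).le]
    have h1 : p θ' x ≤ p θ x * Real.exp C := by
      refine (h.density_le θ θ' x).trans ?_
      have h2 : ‖θ' - θ‖ ≤ 1 := by rw [← dist_eq_norm]; exact (Metric.mem_ball.1 hθ').le
      have := h.pos θ x
      gcongr
      exact mul_le_of_le_one_right h.C_nonneg h2
    have hR0 : 0 ≤ R := (abs_nonneg _).trans (hR x)
    have := h.pos θ x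
    rw [← mul_assoc (p θ x)]
    exact mul_le_mul h1 (mul_le_mul (hR x) (h.norm_score_le θ' x) (norm_nonneg _) hR0)
      (by positivity) (by positivity)
  · have h1 := (h.hasGradientAt θ' x).hasFDerivAt.mul_const (f x)
    rw [← map_smul, smul_comm] at h1
    exact h1

lemma gradient_integral (h : LogSmoothFamily ν p s C K) {f : X → ℝ} (hf : Measurable f)
    {R : ℝ} (hR : ∀ x, |f x| ≤ R) (θ : EuclideanSpace ℝ (Fin q)) :
    gradient (fun θ' => ∫ x, f x ∂(densityLaw ν p θ')) θ =
      ∫ x, f x • s θ x ∂(densityLaw ν p θ) :=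
  (h.hasGradientAt_integral hf hR θ).gradient

/-- The derivative of the constant total mass `1`. -/
lemma integral_score_eq_zero (h : LogSmoothFamily ν p s C K) (θ : EuclideanSpace ℝ (Fin q)) :
    ∫ x, s θ x ∂(densityLaw ν p θ) = 0 := by
  have h1 := h.gradient_integral (f := fun _ => 1) measurable_const (R := 1) (by simp) θ
  have h2 : (fun θ' => ∫ _, (1 : ℝ) ∂(densityLaw ν p θ')) = fun _ => 1 := by
    ext θ'
    have := h.isProbabilityMeasure θ'
    simp
  rw [h2] at h1
  simpa using h1.symm

lemma norm_gradient_integral_le (h : LogSmoothFamily ν p s C K) {f : X → ℝ} (hf : Measurable f)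
    {R : ℝ} (hR : ∀ x, |f x| ≤ R) (θ : EuclideanSpace ℝ (Fin q)) :
    ‖gradient (fun θ' => ∫ x, f x ∂(densityLaw ν p θ')) θ‖ ≤ R * C := by
  have := h.isProbabilityMeasure θ
  rw [h.gradient_integral hf hR]
  refine (norm_integral_le_of_norm_le_const (C := R * C)
    (Filter.Eventually.of_forall fun x => ?_)).trans_eq (by simp)
  rw [norm_smul]
  exact mul_le_mul (hR x) (h.norm_score_le θ x) (norm_nonneg _) ((abs_nonneg _).trans (hR x))

/-- Integrating `norm_gradient_sub_le` leaves an exponential factor; subdividing the segment by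
`dist_le_of_local_bound` removes it, so no second derivative of the integral is needed. -/
lemma norm_gradient_integral_sub_le (h : LogSmoothFamily ν p s C K) {f : X → ℝ}
    (hf : Measurable f) {R : ℝ} (hR0 : 0 ≤ R) (hR : ∀ x, |f x| ≤ R)
    (θ θ' : EuclideanSpace ℝ (Fin q)) :
    ‖gradient (fun θ' => ∫ x, f x ∂(densityLaw ν p θ')) θ' -
      gradient (fun θ' => ∫ x, f x ∂(densityLaw ν p θ')) θ‖ ≤ R * (K + C ^ 2) * ‖θ' - θ‖ := by
  set J := fun θ' => ∫ x, f x ∂(densityLaw ν p θ')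
  have hloc : ∀ x y, ‖gradient J y - gradient J x‖ ≤
      R * (K + C ^ 2) * ‖y - x‖ * Real.exp (C * ‖y - x‖) := by
    intro x y
    have hi : ∀ z, Integrable (fun w => p z w • f w • s z w) ν := fun z =>
      (h.integrable z).smul_bdd (R * C) (hf.smul (h.measurable_score z)).aestronglyMeasurable
        (Filter.Eventually.of_forall fun w => by
          rw [norm_smul]
          exact mul_le_mul (hR w) (h.norm_score_le z w) (norm_nonneg _) hR0)
    rw [h.gradient_integral hf hR, h.gradient_integral hf hR, h.integral_law, h.integral_law,
      ← integral_sub (hi y) (hi x)]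
    have hb : ∀ w, ‖p y w • f w • s y w - p x w • f w • s x w‖ ≤
        p x w * (R * ((K + C ^ 2) * ‖y - x‖ * Real.exp (C * ‖y - x‖))) := by
      intro w
      have h1 : p y w • f w • s y w - p x w • f w • s x w =
        f w • (p y w • s y w - p x w • s x w) := by module
      rw [h1, norm_smul, Real.norm_eq_abs]
      calc |f w| * ‖p y w • s y w - p x w • s x w‖ ≤
          R * (p x w * ((K + C ^ 2) * ‖y - x‖ * Real.exp (C * ‖y - x‖))) :=
            mul_le_mul (hR w) (h.norm_gradient_sub_le x y w) (norm_nonneg _) hR0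
        _ = _ := by ring
    refine (norm_integral_le_of_norm_le ((h.integrable x).mul_const _)
      (Filter.Eventually.of_forall hb)).trans_eq ?_
    rw [integral_mul_const, h.integral_eq_one]
    ring
  have hKC : 0 ≤ K + C ^ 2 := add_nonneg h.K_nonneg (sq_nonneg C)
  have key := dist_le_of_local_bound
    (d := fun a b => ‖gradient J (AffineMap.lineMap θ θ' b) -
      gradient J (AffineMap.lineMap θ θ' a)‖ₑ)
    (C := R * (K + C ^ 2) * ‖θ' - θ‖) (c := C * ‖θ' - θ‖) (by positivity) (by simp)
    (fun r _ u _ t _ => by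
      rw [add_comm, ← sub_add_sub_cancel _ (gradient J (AffineMap.lineMap θ θ' u))]
      exact enorm_add_le _ _)
    (fun a _ b _ => by
      rw [← ofReal_norm]
      refine ENNReal.ofReal_le_ofReal ((hloc _ _).trans_eq ?_)
      have h2 : (AffineMap.lineMap θ θ' b - AffineMap.lineMap θ θ' a : EuclideanSpace ℝ (Fin q))
          = (b - a) • (θ' - θ) := by
        simp only [AffineMap.lineMap_apply_module]; module
      rw [h2, norm_smul, Real.norm_eq_abs]
      ring_nf)
  simp only [AffineMap.lineMap_apply_one, AffineMap.lineMap_apply_zero] at key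
  rw [← ofReal_norm] at key
  exact (ENNReal.ofReal_le_ofReal_iff (by positivity)).1 key

/-- The quadratic lower bound given by the smoothness of an expected bounded reward. -/
lemma quadratic_lower_bound (h : LogSmoothFamily ν p s C K) {f : X → ℝ}
    (hf : Measurable f) {R : ℝ} (hR0 : 0 ≤ R) (hR : ∀ x, |f x| ≤ R)
    (θ θ' : EuclideanSpace ℝ (Fin q)) :
    ∫ x, f x ∂(densityLaw ν p θ) +
      ⟪gradient (fun θ' => ∫ x, f x ∂(densityLaw ν p θ')) θ, θ' - θ⟫ -
      R * (K + C ^ 2) / 2 * ‖θ' - θ‖ ^ 2 ≤ ∫ x, f x ∂(densityLaw ν p θ') := by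
  have hlip := h.norm_gradient_integral_sub_le hf hR0 hR
  have hgrad : ∀ y, HasGradientAt (fun θ' => ∫ x, f x ∂(densityLaw ν p θ')) _ y :=
    fun y => (h.hasGradientAt_integral hf hR y).differentiableAt.hasGradientAt
  set J := fun θ' => ∫ x, f x ∂(densityLaw ν p θ')
  set l := R * (K + C ^ 2)
  -- The Lipschitz bound on the gradient makes `φ' ≥ 0` on `(0, 1)`; the claim is `φ 0 ≤ φ 1`.
  set φ : ℝ → ℝ := fun u => J (θ + u • (θ' - θ)) - u * ⟪gradient J θ, θ' - θ⟫
    + l / 2 * ‖θ' - θ‖ ^ 2 * u ^ 2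
  have hφ : ∀ u, HasDerivAt φ (⟪gradient J (θ + u • (θ' - θ)), θ' - θ⟫
      - ⟪gradient J θ, θ' - θ⟫ + l / 2 * ‖θ' - θ‖ ^ 2 * (2 * u)) u := by
    intro u
    have h1 : HasDerivAt (fun u : ℝ => θ + u • (θ' - θ)) (θ' - θ) u := by
      simpa using ((hasDerivAt_id u).smul_const (θ' - θ)).const_add θ
    have h2 := (hgrad (θ + u • (θ' - θ))).hasFDerivAt.comp_hasDerivAt u h1
    have h3 := (hasDerivAt_id u).mul_const ⟪gradient J θ, θ' - θ⟫
    have h4 := (hasDerivAt_pow 2 u).const_mul (l / 2 * ‖θ' - θ‖ ^ 2)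
    rw [InnerProductSpace.toDual_apply_apply] at h2
    refine ((h2.sub h3).add h4).congr_deriv ?_
    simp
  have hmono : MonotoneOn φ (Set.Icc 0 1) := by
    refine monotoneOn_of_deriv_nonneg (convex_Icc 0 1)
      (fun u _ => (hφ u).continuousAt.continuousWithinAt)
      (fun u _ => (hφ u).differentiableAt.differentiableWithinAt) fun u hu => ?_
    rw [interior_Icc] at hu
    rw [(hφ u).deriv, ← inner_sub_left]
    have h1 := hlip θ (θ + u • (θ' - θ))
    rw [add_sub_cancel_left, norm_smul, Real.norm_of_nonneg hu.1.le] at h1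
    have h2 := (abs_le.1 (abs_real_inner_le_norm
      (gradient J (θ + u • (θ' - θ)) - gradient J θ) (θ' - θ))).1
    nlinarith [norm_nonneg (θ' - θ), mul_le_mul_of_nonneg_right h1 (norm_nonneg (θ' - θ))]
  have h01 := hmono (by simp) (by simp) zero_le_one
  simp only [φ, zero_smul, add_zero, one_smul, add_sub_cancel] at h01
  simp only [J] at h01 ⊢
  linarith

/-- Needed to view the sampling law as a kernel in `θ`. The density is continuous in the parameter
and measurable in the sample, hence jointly measurable. -/
lemma measurable_law [SFinite ν] (h : LogSmoothFamily ν p s C K) :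
    Measurable (densityLaw ν p) := by
  refine Measure.measurable_of_measurable_coe _ fun E hE => ?_
  simp_rw [withDensity_apply _ hE]
  have h1 : Measurable (Function.uncurry p) :=
    measurable_uncurry_of_continuous_of_measurable h.continuous_density h.measurable
  exact Measurable.lintegral_prod_right' (ν := ν.restrict E)
    (f := fun z => ENNReal.ofReal (Function.uncurry p z)) h1.ennreal_ofReal

lemma integral_ratio_smul (h : LogSmoothFamily ν p s C K) (θ₁ θ₂ : EuclideanSpace ℝ (Fin q)) {V : Type*}
    [NormedAddCommGroup V] [NormedSpace ℝ V] (f : X → V) :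
    ∫ x, (p θ₂ x / p θ₁ x) • f x ∂(densityLaw ν p θ₁) = ∫ x, f x ∂(densityLaw ν p θ₂) := by
  rw [h.integral_law, h.integral_law]
  refine integral_congr_ae (Filter.Eventually.of_forall fun x => ?_)
  simp only [smul_smul]
  rw [mul_div_cancel₀ _ (h.pos θ₁ x).ne']

/-- An importance weight has mean `1`, so its second moment is its variance plus `1`. -/
lemma eLpNorm_ratio_le (h : LogSmoothFamily ν p s C K) {θ₁ θ₂ : EuclideanSpace ℝ (Fin q)}
    {W : ℝ} (hW0 : 0 ≤ W)
    (hW : evariance (fun x => p θ₂ x / p θ₁ x) (densityLaw ν p θ₁) ≤ ENNReal.ofReal W) :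
    eLpNorm (fun x => p θ₂ x / p θ₁ x) 2 (densityLaw ν p θ₁) ≤ ENNReal.ofReal √(W + 1) := by
  have := h.isProbabilityMeasure θ₁
  set μ := densityLaw ν p θ₁
  have hm : Measurable fun x => p θ₂ x / p θ₁ x := (h.measurable θ₂).div (h.measurable θ₁)
  have hL : MemLp (fun x => p θ₂ x / p θ₁ x) 2 μ :=
    (evariance_lt_top_iff_memLp hm.aestronglyMeasurable).1 (hW.trans_lt ENNReal.ofReal_lt_top)
  have hmean : ∫ x, p θ₂ x / p θ₁ x ∂μ = 1 := by
    have := h.isProbabilityMeasure θ₂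
    have := h.integral_ratio_smul θ₁ θ₂ (fun _ => (1 : ℝ))
    simpa using this
  have hvar : Var[fun x => p θ₂ x / p θ₁ x; μ] ≤ W := by
    rw [variance]
    exact ENNReal.toReal_le_of_le_ofReal hW0 hW
  rw [variance_eq_sub hL, hmean] at hvar
  rw [eLpNorm_eq_lintegral_rpow_enorm_toReal (by norm_num) (by norm_num)]
  have h2 : ∫ x, (p θ₂ x / p θ₁ x) ^ 2 ∂μ ≤ W + 1 := by
    have h3 : ∫ x, (p θ₂ x / p θ₁ x) ^ 2 ∂μ - 1 ^ 2 ≤ W := hvar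
    linarith
  have h4 : ∫⁻ x, ‖p θ₂ x / p θ₁ x‖ₑ ^ (2 : ℝ≥0∞).toReal ∂μ =
      ENNReal.ofReal (∫ x, (p θ₂ x / p θ₁ x) ^ 2 ∂μ) := by
    rw [ofReal_integral_eq_lintegral_ofReal hL.integrable_sq
      (Filter.Eventually.of_forall fun x => sq_nonneg _)]
    refine lintegral_congr fun x => ?_
    rw [← ofReal_norm, ENNReal.toReal_ofNat, ENNReal.rpow_ofNat,
      ← ENNReal.ofReal_pow (norm_nonneg _), Real.norm_eq_abs, sq_abs]
  rw [h4, ENNReal.ofReal_rpow_of_nonneg (integral_nonneg fun x => sq_nonneg _) (by norm_num),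
    Real.sqrt_eq_rpow]
  refine ENNReal.ofReal_le_ofReal ?_
  rw [ENNReal.toReal_ofNat]
  exact Real.rpow_le_rpow (integral_nonneg fun x => sq_nonneg _) h2 (by norm_num)

/-- The second moment of an importance weight is quadratic in the distance of the parameters. -/
lemma lintegral_ratio_sub_one_sq_le (h : LogSmoothFamily ν p s C K)
    {θ₁ θ₂ : EuclideanSpace ℝ (Fin q)} {W : ℝ} (hW0 : 0 ≤ W)
    (hW : ∀ u ∈ Set.Icc (0 : ℝ) 1,
      evariance (fun x => p (AffineMap.lineMap θ₁ θ₂ u) x / p θ₁ x) (densityLaw ν p θ₁)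
        ≤ ENNReal.ofReal W) :
    ∫⁻ x, ENNReal.ofReal ((p θ₂ x / p θ₁ x - 1) ^ 2) ∂(densityLaw ν p θ₁) ≤
      ENNReal.ofReal (C ^ 2 * (W + 1) * ‖θ₂ - θ₁‖ ^ 2) := by
  set μ := densityLaw ν p θ₁
  set γ : ℝ → EuclideanSpace ℝ (Fin q) := fun u => AffineMap.lineMap θ₁ θ₂ u
  have hm : ∀ u, Measurable fun x => p (γ u) x / p θ₁ x :=
    fun u => (h.measurable _).div (h.measurable θ₁)
  have hC := h.C_nonneg
  -- The curve `u ↦ p (γ u) / p θ₁` is followed in `L²` of the law of `θ₁`. Its local increments are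
  -- relative to its own `L²` norm, which the variance bound controls along the whole segment.
  have key := dist_le_of_local_bound
    (d := fun a b => eLpNorm ((fun x => p (γ b) x / p θ₁ x) - fun x => p (γ a) x / p θ₁ x) 2 μ)
    (C := C * ‖θ₂ - θ₁‖ * √(W + 1)) (c := C * ‖θ₂ - θ₁‖) (by positivity) (by simp)
    (fun r _ u _ t _ => by
      rw [add_comm, ← sub_add_sub_cancel _ (fun x => p (γ u) x / p θ₁ x)]
      exact eLpNorm_add_le ((hm _).sub (hm _)).aestronglyMeasurable
        ((hm _).sub (hm _)).aestronglyMeasurable (by norm_num))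
    (fun a ha b hb => by
      have h2 : γ b - γ a = (b - a) • (θ₂ - θ₁) := by
        simp only [γ, AffineMap.lineMap_apply_module]; module
      have h3 : ‖γ b - γ a‖ = |b - a| * ‖θ₂ - θ₁‖ := by rw [h2, norm_smul, Real.norm_eq_abs]
      have h4 : ∀ x, ‖((fun x => p (γ b) x / p θ₁ x) - fun x => p (γ a) x / p θ₁ x) x‖ ≤
          (C * ‖γ b - γ a‖ * Real.exp (C * ‖γ b - γ a‖)) * ‖p (γ a) x / p θ₁ x‖ := by
        intro x
        have h5 := h.abs_density_sub_le (γ a) (γ b) x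
        have h6 := h.pos θ₁ x
        rw [Pi.sub_apply, ← sub_div, Real.norm_eq_abs, Real.norm_eq_abs, abs_div,
          abs_of_pos h6, abs_of_pos (div_pos (h.pos _ x) h6), ← mul_div_assoc]
        gcongr
        linarith
      refine (eLpNorm_le_mul_eLpNorm_of_ae_le_mul (Filter.Eventually.of_forall h4) 2).trans ?_
      refine (mul_le_mul_right (h.eLpNorm_ratio_le hW0 (hW a ha)) _).trans ?_
      rw [← ENNReal.ofReal_mul (by positivity), h3]
      refine ENNReal.ofReal_le_ofReal (le_of_eq ?_)
      ring_nf)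
  have h1 : γ 1 = θ₂ := AffineMap.lineMap_apply_one _ _
  have h0 : γ 0 = θ₁ := AffineMap.lineMap_apply_zero _ _
  rw [h1, h0] at key
  have hone : (fun x => p θ₁ x / p θ₁ x) = fun _ => 1 := by
    ext x; exact div_self (h.pos θ₁ x).ne'
  rw [hone] at key
  have hsq := pow_le_pow_left₀ zero_le key 2
  rw [← ENNReal.ofReal_pow (by positivity)] at hsq
  have h5 : C ^ 2 * (W + 1) * ‖θ₂ - θ₁‖ ^ 2 = (C * ‖θ₂ - θ₁‖ * √(W + 1)) ^ 2 := by
    rw [mul_pow, mul_pow, Real.sq_sqrt (by linarith)]; ring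
  rw [h5]
  refine le_trans (le_of_eq ?_) hsq
  rw [eLpNorm_eq_lintegral_rpow_enorm_toReal (by norm_num) (by norm_num), ENNReal.toReal_ofNat,
    ← ENNReal.rpow_natCast, ← ENNReal.rpow_mul]
  norm_num
  refine lintegral_congr fun x => ?_
  rw [← ofReal_norm, ← ENNReal.ofReal_pow (norm_nonneg _), Real.norm_eq_abs, sq_abs]

end LogSmoothFamily

end LogSmoothFamilies

/-! ### Laws of trajectories -/

section TrajectoryLaw

variable {S A : Type*} [MeasurableSpace S] [MeasurableSpace A]

instance isSFiniteKernel_trajRef (P : Kernel (S × A) S) [IsMarkovKernel P] (lam : Measure A)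
    [SigmaFinite lam] (n : ℕ) : IsSFiniteKernel (trajRef P lam n) := by
  induction n with
  | zero => rw [trajRef]; infer_instance
  | succ n ih => rw [trajRef]; infer_instance

lemma measurable_cons (n : ℕ) :
    Measurable fun x : S × (A × Traj S A n) =>
      (Fin.cons (x.1, x.2.1) x.2.2 : Traj S A (n + 1)) := by
  refine measurable_pi_iff.2 fun i => ?_
  refine Fin.cases ?_ (fun j => ?_) i
  · simp only [Fin.cons_zero]; fun_prop
  · simp only [Fin.cons_succ]; fun_prop

lemma lintegral_trajRef_succ (P : Kernel (S × A) S) [IsMarkovKernel P] (lam : Measure A)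
    [SigmaFinite lam] (n : ℕ) (s : S) {f : Traj S A (n + 1) → ℝ≥0∞} (hf : Measurable f) :
    ∫⁻ τ, f τ ∂(trajRef P lam (n + 1) s) =
      ∫⁻ a, ∫⁻ s', ∫⁻ τ, f (Fin.cons (s, a) τ) ∂(trajRef P lam n s') ∂(P (s, a)) ∂lam := by
  have hfc := hf.comp (measurable_cons (S := S) (A := A) n)
  rw [trajRef, Kernel.lintegral_map _ (measurable_cons n) _ hf,
    Kernel.lintegral_id_prod (f := fun x : S × (A × Traj S A n) =>
      f (Fin.cons (x.1, x.2.1) x.2.2 : Traj S A (n + 1))) hfc,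
    Kernel.lintegral_compProd _ _ _
      (f := fun x : A × Traj S A n => f (Fin.cons (s, x.1) x.2 : Traj S A (n + 1)))
      (hfc.comp (by fun_prop : Measurable fun x : A × Traj S A n => (s, x)))]
  simp only [Kernel.const_apply]
  refine lintegral_congr fun a => ?_
  rw [Kernel.lintegral_comp]
  exact hfc.comp (by fun_prop : Measurable fun x : Traj S A n => (s, (a, x)))

lemma measurable_prod_apply {n : ℕ} {h : Fin n → S × A → ℝ≥0∞} (hm : ∀ i, Measurable (h i)) :
    Measurable fun τ : Traj S A n => ∏ i, h i (τ i) :=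
  Finset.measurable_prod _ fun i _ => (hm i).comp (measurable_pi_apply i)

lemma lintegral_trajRef_prod_succ (P : Kernel (S × A) S) [IsMarkovKernel P] (lam : Measure A)
    [SigmaFinite lam] {n : ℕ} (s : S) {h : Fin (n + 1) → S × A → ℝ≥0∞}
    (hm : ∀ i, Measurable (h i)) :
    ∫⁻ τ, ∏ i, h i (τ i) ∂(trajRef P lam (n + 1) s) =
      ∫⁻ a, h 0 (s, a) * ∫⁻ s', ∫⁻ τ, ∏ i : Fin n, h i.succ (τ i) ∂(trajRef P lam n s')
        ∂(P (s, a)) ∂lam := by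
  rw [lintegral_trajRef_succ _ _ _ _ (measurable_prod_apply hm)]
  refine lintegral_congr fun a => ?_
  have hm' := measurable_prod_apply fun i : Fin n => hm i.succ
  rw [← lintegral_const_mul _ (hm'.lintegral_kernel)]
  refine lintegral_congr fun s' => ?_
  rw [← lintegral_const_mul _ hm']
  refine lintegral_congr fun τ => ?_
  rw [Fin.prod_univ_succ]
  simp

/-- After the first step is split off, the tail has total mass `1` from every state and the
transition is Markov, so only the first action integral remains. -/
lemma lintegral_trajRef_prod_eq_one (P : Kernel (S × A) S) [IsMarkovKernel P] (lam : Measure A)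
    [SigmaFinite lam] {n : ℕ} {h : Fin n → S × A → ℝ≥0∞} (hm : ∀ i, Measurable (h i))
    (h1 : ∀ i s, ∫⁻ a, h i (s, a) ∂lam = 1) (s : S) :
    ∫⁻ τ, ∏ i, h i (τ i) ∂(trajRef P lam n s) = 1 := by
  induction n generalizing s with
  | zero => simp [trajRef]
  | succ n ih =>
    rw [lintegral_trajRef_prod_succ P lam s hm]
    simp [ih (fun i => hm i.succ) (fun i => h1 i.succ), h1]

/-- Replacing one factor of a product of functions of the single steps by another one with the same
action integrals does not change the integral, if the later factors are conditional densities. -/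
lemma lintegral_trajRef_prod_congr (P : Kernel (S × A) S) [IsMarkovKernel P] (lam : Measure A)
    [SigmaFinite lam] {n : ℕ} {h h' : Fin n → S × A → ℝ≥0∞} (hm : ∀ i, Measurable (h i))
    (hm' : ∀ i, Measurable (h' i)) (t : Fin n) (hne : ∀ i, i ≠ t → h i = h' i)
    (hgt : ∀ i, t < i → ∀ s, ∫⁻ a, h i (s, a) ∂lam = 1)
    (ht : ∀ s, ∫⁻ a, h t (s, a) ∂lam = ∫⁻ a, h' t (s, a) ∂lam) (s : S) :
    ∫⁻ τ, ∏ i, h i (τ i) ∂(trajRef P lam n s) = ∫⁻ τ, ∏ i, h' i (τ i) ∂(trajRef P lam n s) := by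
  induction n generalizing s with
  | zero => exact t.elim0
  | succ n ih =>
    rw [lintegral_trajRef_prod_succ P lam s hm, lintegral_trajRef_prod_succ P lam s hm']
    rcases Fin.eq_zero_or_eq_succ t with rfl | ⟨j, rfl⟩
    -- If the replaced factor comes first, the tail integrates to `1` from every next state, so only
    -- its action integral matters. Otherwise the common first factor is peeled off.
    · have h1 : ∀ s', ∫⁻ τ, ∏ i : Fin n, h i.succ (τ i) ∂(trajRef P lam n s') = 1 :=
        lintegral_trajRef_prod_eq_one P lam (fun i => hm i.succ)
          fun i => hgt i.succ (Fin.succ_pos i)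
      have h2 : ∀ s', ∫⁻ τ, ∏ i : Fin n, h' i.succ (τ i) ∂(trajRef P lam n s') = 1 := by
        intro s'
        rw [← h1 s']
        simp_rw [hne _ (Fin.succ_ne_zero _)]
      simp [h1, h2, ht]
    · rw [hne 0 (Fin.succ_ne_zero j).symm]
      refine lintegral_congr fun a => ?_
      congr 1
      refine lintegral_congr fun s' => ?_
      exact ih (fun i => hm i.succ) (fun i => hm' i.succ) j
        (fun i hi => hne i.succ fun hij => hi (Fin.succ_injective _ hij))
        (fun i hi => hgt i.succ (Fin.succ_lt_succ_iff.2 hi)) ht s'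

variable {q : ℕ} {lam : Measure A}

/-- Policies whose log-densities have bounded first and second derivatives. -/
structure SmoothPolicy (π : Policy q S lam) (G M : ℝ) : Prop where
  G_nonneg : 0 ≤ G
  M_nonneg : 0 ≤ M
  differentiable_log : ∀ s a, Differentiable ℝ (fun θ => Real.log (π.dens θ s a))
  differentiable_score : ∀ s a, Differentiable ℝ (score π s a)
  norm_score_le : ∀ s a θ, ‖score π s a θ‖ ≤ G
  norm_fderiv_score_le : ∀ s a θ, ‖fderiv ℝ (score π s a) θ‖ ≤ M

/-- The score of a trajectory. -/
def trajScore (π : Policy q S lam) {H : ℕ} (θ : EuclideanSpace ℝ (Fin q)) (τ : Traj S A H) :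
    EuclideanSpace ℝ (Fin q) :=
  ∑ t, score π (τ t).1 (τ t).2 θ

/-- The reference measure of the trajectories of a Markov decision process. -/
abbrev MDP.refMeasure (𝓜 : MDP S A) (lam : Measure A) (H : ℕ) : Measure (Traj S A H) :=
  (trajRef 𝓜.transition lam H) ∘ₘ 𝓜.init

variable {π : Policy q S lam} {G M : ℝ}

lemma SmoothPolicy.norm_score_sub_le (h : SmoothPolicy π G M) (s : S) (a : A)
    (θ θ' : EuclideanSpace ℝ (Fin q)) : ‖score π s a θ - score π s a θ'‖ ≤ M * ‖θ - θ'‖ :=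
  Convex.norm_image_sub_le_of_norm_fderiv_le (s := Set.univ)
    (fun y _ => h.differentiable_score s a y) (fun y _ => h.norm_fderiv_score_le s a y)
    convex_univ trivial trivial

lemma SmoothPolicy.actionFamily (h : SmoothPolicy π G M) (s : S) :
    LogSmoothFamily lam (fun θ a => π.dens θ s a) (fun θ a => score π s a θ) G M where
  pos θ a := π.dens_pos θ s a
  measurable θ := (π.measurable_dens θ).comp measurable_prodMk_left
  lintegral_eq_one θ := π.lintegral_dens θ s
  hasGradientAt_log θ a := (h.differentiable_log s a θ).hasGradientAt
  norm_score_le θ a := h.norm_score_le s a θ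
  norm_score_sub_le θ θ' a := h.norm_score_sub_le s a θ θ'
  C_nonneg := h.G_nonneg
  K_nonneg := h.M_nonneg

lemma measurable_trajDens (π : Policy q S lam) {H : ℕ} (θ : EuclideanSpace ℝ (Fin q)) :
    Measurable (trajDens π (H := H) θ) :=
  Finset.measurable_prod _ fun t _ => (π.measurable_dens θ).comp (measurable_pi_apply t)

lemma trajDens_pos (π : Policy q S lam) {H : ℕ} (θ : EuclideanSpace ℝ (Fin q)) (τ : Traj S A H) :
    0 < trajDens π θ τ :=
  Finset.prod_pos fun _ _ => π.dens_pos _ _ _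

lemma ofReal_trajDens (π : Policy q S lam) {H : ℕ} (θ : EuclideanSpace ℝ (Fin q))
    (τ : Traj S A H) :
    ENNReal.ofReal (trajDens π θ τ) = ∏ t, ENNReal.ofReal (π.dens θ (τ t).1 (τ t).2) :=
  ENNReal.ofReal_prod_of_nonneg fun _ _ => (π.dens_pos _ _ _).le

lemma lintegral_refMeasure (𝓜 : MDP S A) (lam : Measure A) [SigmaFinite lam] (H : ℕ)
    {f : Traj S A H → ℝ≥0∞} (hf : Measurable f) :
    ∫⁻ τ, f τ ∂(𝓜.refMeasure lam H) = ∫⁻ s, ∫⁻ τ, f τ ∂(trajRef 𝓜.transition lam H s) ∂𝓜.init :=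
  Measure.lintegral_bind (Kernel.aemeasurable _) hf.aemeasurable

instance sFinite_refMeasure (𝓜 : MDP S A) (lam : Measure A) [SigmaFinite lam] (H : ℕ) :
    SFinite (𝓜.refMeasure lam H) := by
  have := 𝓜.isMarkov
  have := 𝓜.isProb
  infer_instance

lemma SmoothPolicy.trajFamily [SigmaFinite lam] (h : SmoothPolicy π G M) (𝓜 : MDP S A) (H : ℕ) :
    LogSmoothFamily (𝓜.refMeasure lam H) (trajDens π) (trajScore π) (H * G) (H * M) where
  pos θ τ := trajDens_pos π θ τ
  measurable θ := measurable_trajDens π θ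
  lintegral_eq_one θ := by
    have := 𝓜.isMarkov
    have := 𝓜.isProb
    rw [lintegral_refMeasure 𝓜 lam H (measurable_trajDens π θ).ennreal_ofReal]
    simp_rw [ofReal_trajDens]
    simp_rw [lintegral_trajRef_prod_eq_one 𝓜.transition lam
      (h := fun _ x => ENNReal.ofReal (π.dens θ x.1 x.2))
      (fun _ => (π.measurable_dens θ).ennreal_ofReal) (fun _ s => π.lintegral_dens θ s)]
    simp
  hasGradientAt_log θ τ := by
    have h1 : (fun θ' => Real.log (trajDens π θ' τ)) =
        fun θ' => ∑ t, Real.log (π.dens θ' (τ t).1 (τ t).2) := by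
      ext θ'
      exact Real.log_prod fun t _ => (π.dens_pos _ _ _).ne'
    rw [h1, hasGradientAt_iff_hasFDerivAt, trajScore, map_sum]
    exact HasFDerivAt.fun_sum fun t _ =>
      (h.differentiable_log (τ t).1 (τ t).2 θ).hasGradientAt.hasFDerivAt
  norm_score_le θ τ := by
    refine (norm_sum_le _ _).trans ?_
    refine (Finset.sum_le_sum fun t _ => h.norm_score_le (τ t).1 (τ t).2 θ).trans_eq ?_
    simp
  norm_score_sub_le θ θ' τ := by
    rw [trajScore, trajScore, ← Finset.sum_sub_distrib]
    refine (norm_sum_le _ _).trans ?_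
    refine (Finset.sum_le_sum fun t _ => h.norm_score_sub_le (τ t).1 (τ t).2 θ θ').trans_eq ?_
    simp [mul_assoc]
  C_nonneg := mul_nonneg (Nat.cast_nonneg _) h.G_nonneg
  K_nonneg := mul_nonneg (Nat.cast_nonneg _) h.M_nonneg

lemma SmoothPolicy.measurable_score (h : SmoothPolicy π G M) (θ : EuclideanSpace ℝ (Fin q)) :
    Measurable fun x : S × A => score π x.1 x.2 θ :=
  measurable_of_hasGradientAt (f := fun θ (x : S × A) => Real.log (π.dens θ x.1 x.2))
    (fun θ' => (π.measurable_dens θ').log)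
    fun x => (h.differentiable_log x.1 x.2 θ).hasGradientAt

/-- A function of one step with vanishing action averages has mean zero along trajectories. -/
lemma SmoothPolicy.integral_trajLaw_eq_zero [SigmaFinite lam] (h : SmoothPolicy π G M)
    (𝓜 : MDP S A) {H : ℕ} (θ : EuclideanSpace ℝ (Fin q)) (t : Fin H) {f : S × A → ℝ}
    (hf : Measurable f) {c : ℝ} (hc : ∀ x, |f x| ≤ c)
    (h0 : ∀ s, ∫ a, π.dens θ s a * f (s, a) ∂lam = 0) :
    ∫ τ, f (τ t) ∂(trajLaw 𝓜 π H θ) = 0 := by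
  have := 𝓜.isMarkov
  have hfam := h.trajFamily 𝓜 H
  have hft : Measurable fun τ : Traj S A H => f (τ t) := hf.comp (measurable_pi_apply t)
  -- The product formulas concern nonnegative functions, so the positive parts of `f` and `-f` are
  -- compared: `ENNReal.ofReal` truncates, and the remaining factors are nonnegative, so truncation
  -- affects only the factor at `t`.
  have key : ∀ (f' : S × A → ℝ)
      (τ : Traj S A H), ENNReal.ofReal (trajDens π θ τ * f' (τ t)) =
        ∏ i, (if i = t then fun x => ENNReal.ofReal (π.dens θ x.1 x.2 * f' x)
          else fun x => ENNReal.ofReal (π.dens θ x.1 x.2)) (τ i) := by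
    intro f' τ
    rw [← Finset.mul_prod_erase _ _ (Finset.mem_univ t), if_pos rfl, trajDens,
      ← Finset.mul_prod_erase _ _ (Finset.mem_univ t), mul_right_comm,
      ENNReal.ofReal_mul' (Finset.prod_nonneg fun _ _ => (π.dens_pos _ _ _).le),
      ENNReal.ofReal_prod_of_nonneg fun _ _ => (π.dens_pos _ _ _).le]
    congr 1
    refine Finset.prod_congr rfl fun i hi => ?_
    rw [if_neg (Finset.ne_of_mem_erase hi)]
  have hmeas : ∀ f' : S × A → ℝ, Measurable f' → ∀ i : Fin H,
      Measurable (if i = t then fun x => ENNReal.ofReal (π.dens θ x.1 x.2 * f' x)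
          else fun x => ENNReal.ofReal (π.dens θ x.1 x.2)) := by
    intro f' hf' i
    split_ifs
    · exact ((π.measurable_dens θ).mul hf').ennreal_ofReal
    · exact (π.measurable_dens θ).ennreal_ofReal
  have hsingle : ∀ s, ∫⁻ a, ENNReal.ofReal (π.dens θ s a * f (s, a)) ∂lam =
      ∫⁻ a, ENNReal.ofReal (π.dens θ s a * -f (s, a)) ∂lam := by
    intro s
    have hi : Integrable (fun a => π.dens θ s a * f (s, a)) lam :=
      ((h.actionFamily s).integrable θ).mul_bdd (c := c)
        (hf.comp measurable_prodMk_left).aestronglyMeasurable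
        (Filter.Eventually.of_forall fun a => hc _)
    have h1 := integral_eq_lintegral_pos_part_sub_lintegral_neg_part hi
    rw [h0 s] at h1
    simp_rw [mul_neg]
    refine (ENNReal.toReal_eq_toReal_iff' ?_ ?_).1 (by linarith)
    · exact ((lintegral_ofReal_le_lintegral_enorm _).trans_lt hi.2).ne
    · exact ((lintegral_ofReal_le_lintegral_enorm _).trans_lt hi.neg.2).ne
  have hi : Integrable (fun τ => trajDens π θ τ * f (τ t)) (𝓜.refMeasure lam H) :=
    (hfam.integrable θ).mul_bdd (c := c) hft.aestronglyMeasurable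
      (Filter.Eventually.of_forall fun τ => hc _)
  have heq : ∫⁻ τ, ENNReal.ofReal (trajDens π θ τ * f (τ t)) ∂(𝓜.refMeasure lam H) =
      ∫⁻ τ, ENNReal.ofReal (trajDens π θ τ * -f (τ t)) ∂(𝓜.refMeasure lam H) := by
    rw [lintegral_refMeasure 𝓜 lam H
        (f := fun τ => ENNReal.ofReal (trajDens π θ τ * f (τ t)))
        ((measurable_trajDens π θ).mul hft).ennreal_ofReal,
      lintegral_refMeasure 𝓜 lam H (f := fun τ => ENNReal.ofReal (trajDens π θ τ * -f (τ t)))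
        ((measurable_trajDens π θ).mul hft.neg).ennreal_ofReal]
    refine lintegral_congr fun s => ?_
    simp_rw [key f, key (fun x => -f x)]
    refine lintegral_trajRef_prod_congr 𝓜.transition lam (hmeas f hf) (hmeas _ hf.neg) t
      (fun i hi => by rw [if_neg hi, if_neg hi]) (fun i hi s => ?_) (fun s => ?_) s
    · rw [if_neg hi.ne']; exact π.lintegral_dens θ s
    · rw [if_pos rfl, if_pos rfl]; exact hsingle s
  change ∫ τ, f (τ t) ∂(densityLaw (𝓜.refMeasure lam H) (trajDens π) θ) = 0
  rw [hfam.integral_law]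
  simp_rw [smul_eq_mul]
  rw [integral_eq_lintegral_pos_part_sub_lintegral_neg_part hi]
  simp_rw [mul_neg] at heq
  rw [heq, sub_self]

end TrajectoryLaw

/-! ### The gradient estimator and its importance-weighted correction -/

section Estimators

variable {S A : Type*} [MeasurableSpace S] [MeasurableSpace A] {q H : ℕ} {lam : Measure A}

/-- The boundedness assumptions on rewards, baselines and scores. -/
structure BoundedSetting (𝓜 : MDP S A) (π : Policy q S lam) (b : Fin H → S → ℝ)
    (R G M bbar : ℝ) : Prop where
  smooth : SmoothPolicy π G M
  R_nonneg : 0 ≤ R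
  bbar_nonneg : 0 ≤ bbar
  abs_reward_le : ∀ s a, |𝓜.reward s a| ≤ R
  measurable_baseline : ∀ t, Measurable (b t)
  abs_baseline_le : ∀ t s, |b t s| ≤ bbar

lemma measurable_totalReward (𝓜 : MDP S A) : Measurable (totalReward 𝓜 (H := H)) :=
  Finset.measurable_sum _ fun t _ =>
    (𝓜.measurable_reward.comp (measurable_pi_apply t)).const_mul _

/-- The importance-weighted difference of the estimators at two parameters. -/
def gradCorrection (𝓜 : MDP S A) (π : Policy q S lam) (b : Fin H → S → ℝ)
    (θ θ' : EuclideanSpace ℝ (Fin q)) (τ : Traj S A H) : EuclideanSpace ℝ (Fin q) :=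
  gradEst 𝓜 π b θ' τ - impWeight π θ' θ τ • gradEst 𝓜 π b θ τ

lemma measurable_impWeight (π : Policy q S lam) (θ θ' : EuclideanSpace ℝ (Fin q)) :
    Measurable (impWeight π (H := H) θ θ') :=
  (measurable_trajDens π θ').div (measurable_trajDens π θ)

namespace BoundedSetting

variable {𝓜 : MDP S A} {π : Policy q S lam} {b : Fin H → S → ℝ} {R G M bbar : ℝ}

lemma abs_totalReward_le (h : BoundedSetting 𝓜 π b R G M bbar) (τ : Traj S A H) :
    |totalReward 𝓜 τ| ≤ R / (1 - 𝓜.discount) := by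
  have hγ0 := 𝓜.discount_nonneg
  have hγ1 : 0 < 1 - 𝓜.discount := sub_pos.2 𝓜.discount_lt_one
  calc |totalReward 𝓜 τ| ≤ ∑ t : Fin H, 𝓜.discount ^ (t : ℕ) * R := by
        refine (Finset.abs_sum_le_sum_abs _ _).trans (Finset.sum_le_sum fun t _ => ?_)
        rw [abs_mul, abs_of_nonneg (pow_nonneg hγ0 _)]
        exact mul_le_mul_of_nonneg_left (h.abs_reward_le _ _) (pow_nonneg hγ0 _)
    _ = (∑ t ∈ Finset.range H, 𝓜.discount ^ t) * R := by
        rw [← Finset.sum_mul, Fin.sum_univ_eq_sum_range (fun t => 𝓜.discount ^ t)]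
    _ ≤ (1 - 𝓜.discount)⁻¹ * R := by
        refine mul_le_mul_of_nonneg_right ?_ h.R_nonneg
        rw [← one_div, le_div_iff₀ hγ1, geom_sum_mul_neg]
        linarith [pow_nonneg hγ0 H]
    _ = R / (1 - 𝓜.discount) := by ring

lemma abs_weight_le (h : BoundedSetting 𝓜 π b R G M bbar) (τ : Traj S A H) (t : Fin H) :
    |totalReward 𝓜 τ - b t (τ t).1| ≤ (R + bbar) / (1 - 𝓜.discount) := by
  have hγ1 : 0 < 1 - 𝓜.discount := sub_pos.2 𝓜.discount_lt_one
  have h1 : bbar ≤ bbar / (1 - 𝓜.discount) :=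
    le_div_self h.bbar_nonneg hγ1 (by linarith [𝓜.discount_nonneg])
  rw [add_div]
  exact (abs_sub _ _).trans
    (add_le_add (h.abs_totalReward_le τ) ((h.abs_baseline_le _ _).trans h1))

lemma weight_nonneg (h : BoundedSetting 𝓜 π b R G M bbar) :
    0 ≤ (R + bbar) / (1 - 𝓜.discount) :=
  div_nonneg (add_nonneg h.R_nonneg h.bbar_nonneg) (sub_pos.2 𝓜.discount_lt_one).le

lemma constCg_nonneg (h : BoundedSetting 𝓜 π b R G M bbar) :
    0 ≤ constCg R G bbar 𝓜.discount H := by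
  rw [constCg, mul_div_assoc]
  exact mul_nonneg (mul_nonneg (Nat.cast_nonneg _) h.smooth.G_nonneg) h.weight_nonneg

lemma norm_gradEst_le (h : BoundedSetting 𝓜 π b R G M bbar) (θ : EuclideanSpace ℝ (Fin q))
    (τ : Traj S A H) : ‖gradEst 𝓜 π b θ τ‖ ≤ constCg R G bbar 𝓜.discount H := by
  calc ‖gradEst 𝓜 π b θ τ‖ ≤ ∑ _t : Fin H, (R + bbar) / (1 - 𝓜.discount) * G := by
        refine (norm_sum_le _ _).trans (Finset.sum_le_sum fun t _ => ?_)
        rw [norm_smul]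
        exact mul_le_mul (h.abs_weight_le τ t) (h.smooth.norm_score_le _ _ _) (norm_nonneg _)
          h.weight_nonneg
    _ = _ := by simp [constCg]; ring

lemma norm_gradEst_sub_le (h : BoundedSetting 𝓜 π b R G M bbar)
    (θ θ' : EuclideanSpace ℝ (Fin q)) (τ : Traj S A H) :
    ‖gradEst 𝓜 π b θ τ - gradEst 𝓜 π b θ' τ‖ ≤
      constLg R M bbar 𝓜.discount H * ‖θ - θ'‖ := by
  calc ‖gradEst 𝓜 π b θ τ - gradEst 𝓜 π b θ' τ‖
      ≤ ∑ _t : Fin H, (R + bbar) / (1 - 𝓜.discount) * (M * ‖θ - θ'‖) := by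
        rw [gradEst, gradEst, ← Finset.sum_sub_distrib]
        refine (norm_sum_le _ _).trans (Finset.sum_le_sum fun t _ => ?_)
        rw [← smul_sub, norm_smul]
        exact mul_le_mul (h.abs_weight_le τ t) (h.smooth.norm_score_sub_le _ _ _ _)
          (norm_nonneg _) h.weight_nonneg
    _ = _ := by simp [constLg]; ring

lemma continuous_gradEst (h : BoundedSetting 𝓜 π b R G M bbar) (τ : Traj S A H) :
    Continuous fun θ => gradEst 𝓜 π b θ τ :=
  continuous_finsetSum _ fun t _ =>
    (h.smooth.differentiable_score (τ t).1 (τ t).2).continuous.const_smul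
      (totalReward 𝓜 τ - b t (τ t).1)

lemma measurable_score_apply (h : BoundedSetting 𝓜 π b R G M bbar)
    (θ : EuclideanSpace ℝ (Fin q)) (t : Fin H) :
    Measurable fun τ : Traj S A H => score π (τ t).1 (τ t).2 θ :=
  (h.smooth.measurable_score θ).comp (measurable_pi_apply t)

lemma measurable_gradEst (h : BoundedSetting 𝓜 π b R G M bbar)
    (θ : EuclideanSpace ℝ (Fin q)) : Measurable (gradEst 𝓜 π b θ) :=
  Finset.measurable_sum _ fun t _ =>
    ((measurable_totalReward 𝓜).sub ((h.measurable_baseline t).comp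
      (measurable_fst.comp (measurable_pi_apply t)))).smul (h.measurable_score_apply θ t)

lemma measurable_uncurry_gradEst (h : BoundedSetting 𝓜 π b R G M bbar) :
    Measurable (Function.uncurry (gradEst 𝓜 π b)) :=
  measurable_uncurry_of_continuous_of_measurable h.continuous_gradEst h.measurable_gradEst

lemma measurable_gradCorrection (h : BoundedSetting 𝓜 π b R G M bbar)
    (θ θ' : EuclideanSpace ℝ (Fin q)) : Measurable (gradCorrection 𝓜 π b θ θ') :=
  (h.measurable_gradEst θ').sub ((measurable_impWeight π θ' θ).smul (h.measurable_gradEst θ))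

lemma constCbar_pos (h : BoundedSetting 𝓜 π b R G M bbar) (hH : 1 ≤ H) (hR : 0 < R) (hM : 0 < M)
    {W : ℝ} (hW : 0 ≤ W) : 0 < constCbar R G M W bbar 𝓜.discount H := by
  have hH' : (0 : ℝ) < H := by exact_mod_cast hH
  have h1 : 0 < constLg R M bbar 𝓜.discount H := by
    rw [constLg]
    have := h.bbar_nonneg
    have := sub_pos.2 𝓜.discount_lt_one
    positivity
  have h2 : 0 ≤ constCω G M W H := by
    rw [constCω]; positivity
  rw [constCbar]
  positivity

variable [SigmaFinite lam]

lemma isProbabilityMeasure_trajLaw (h : BoundedSetting 𝓜 π b R G M bbar)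
    (θ : EuclideanSpace ℝ (Fin q)) : IsProbabilityMeasure (trajLaw 𝓜 π H θ) :=
  (h.smooth.trajFamily 𝓜 H).isProbabilityMeasure θ

/-- Given the state, the baseline is a constant and the score has mean zero over the action. Pairing
with a fixed vector reduces this to the scalar statement. -/
lemma integral_baseline_score (h : BoundedSetting 𝓜 π b R G M bbar)
    (θ : EuclideanSpace ℝ (Fin q)) (t : Fin H) :
    ∫ τ, b t (τ t).1 • score π (τ t).1 (τ t).2 θ ∂(trajLaw 𝓜 π H θ) = 0 := by
  have := h.isProbabilityMeasure_trajLaw θ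
  have hm := ((h.measurable_baseline t).comp measurable_fst).smul (h.smooth.measurable_score θ)
  have hbd : ∀ x : S × A, ‖b t x.1 • score π x.1 x.2 θ‖ ≤ bbar * G := fun x => by
    rw [norm_smul]
    exact mul_le_mul (h.abs_baseline_le _ _) (h.smooth.norm_score_le _ _ _) (norm_nonneg _)
      h.bbar_nonneg
  have hint : Integrable (fun τ : Traj S A H => b t (τ t).1 • score π (τ t).1 (τ t).2 θ)
      (trajLaw 𝓜 π H θ) :=
    Integrable.of_bound (hm.comp (measurable_pi_apply t)).aestronglyMeasurable (bbar * G)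
      (Filter.Eventually.of_forall fun τ => hbd (τ t))
  refine ext_inner_left ℝ fun v => ?_
  rw [inner_zero_right, ← integral_inner hint]
  refine h.smooth.integral_trajLaw_eq_zero 𝓜 θ t
    (f := fun x => ⟪v, b t x.1 • score π x.1 x.2 θ⟫) (hm.const_inner)
    (c := ‖v‖ * (bbar * G)) (fun x => ?_) fun s => ?_
  · exact (abs_real_inner_le_norm _ _).trans
      (mul_le_mul_of_nonneg_left (hbd x) (norm_nonneg v))
  · have hfam := h.smooth.actionFamily s
    have := hfam.isProbabilityMeasure θ
    have h0 := hfam.integral_score_eq_zero θ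
    have hi : Integrable (fun a => score π s a θ)
        (densityLaw lam (fun θ a => π.dens θ s a) θ) :=
      Integrable.of_bound (hfam.measurable_score θ).aestronglyMeasurable G
        (Filter.Eventually.of_forall fun a => hfam.norm_score_le θ a)
    have h1 := integral_inner (𝕜 := ℝ) hi v
    rw [h0, inner_zero_right, hfam.integral_law] at h1
    simp_rw [inner_smul_right]
    have h2 : ∀ a, π.dens θ s a * (b t s * ⟪v, score π s a θ⟫) =
        b t s * (π.dens θ s a • ⟪v, score π s a θ⟫) := fun a => by rw [smul_eq_mul]; ring
    simp_rw [h2]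
    rw [integral_const_mul, h1, mul_zero]

/-- The policy gradient theorem: the estimator with baseline is unbiased. -/
lemma integral_gradEst (h : BoundedSetting 𝓜 π b R G M bbar) (θ : EuclideanSpace ℝ (Fin q)) :
    ∫ τ, gradEst 𝓜 π b θ τ ∂(trajLaw 𝓜 π H θ) = gradient (expReward 𝓜 π H) θ := by
  have := h.isProbabilityMeasure_trajLaw θ
  have hR0 : 0 ≤ R / (1 - 𝓜.discount) :=
    div_nonneg h.R_nonneg (sub_pos.2 𝓜.discount_lt_one).le
  have hgrad := (h.smooth.trajFamily 𝓜 H).gradient_integral (measurable_totalReward 𝓜)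
    h.abs_totalReward_le θ
  have hi1 : ∀ t : Fin H, Integrable (fun τ : Traj S A H =>
      totalReward 𝓜 τ • score π (τ t).1 (τ t).2 θ) (trajLaw 𝓜 π H θ) := fun t =>
    Integrable.of_bound ((measurable_totalReward 𝓜).smul
      (h.measurable_score_apply θ t)).aestronglyMeasurable (R / (1 - 𝓜.discount) * G)
      (Filter.Eventually.of_forall fun τ => by
        rw [norm_smul]
        exact mul_le_mul (h.abs_totalReward_le τ) (h.smooth.norm_score_le _ _ _) (norm_nonneg _)
          hR0)
  have hi2 : ∀ t : Fin H, Integrable (fun τ : Traj S A H =>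
      b t (τ t).1 • score π (τ t).1 (τ t).2 θ) (trajLaw 𝓜 π H θ) := fun t =>
    Integrable.of_bound (((h.measurable_baseline t).comp
      (measurable_fst.comp (measurable_pi_apply t))).smul
      (h.measurable_score_apply θ t)).aestronglyMeasurable (bbar * G)
      (Filter.Eventually.of_forall fun τ => by
        rw [norm_smul]
        exact mul_le_mul (h.abs_baseline_le _ _) (h.smooth.norm_score_le _ _ _) (norm_nonneg _)
          h.bbar_nonneg)
  change _ = gradient (fun θ' => ∫ τ, totalReward 𝓜 τ ∂(trajLaw 𝓜 π H θ')) θ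
  refine Eq.trans ?_ hgrad.symm
  simp_rw [gradEst, trajScore, sub_smul, Finset.smul_sum]
  refine (integral_finsetSum _ fun t _ => (hi1 t).sub (hi2 t)).trans
    (Eq.trans ?_ (integral_finsetSum _ fun t _ => hi1 t).symm)
  refine Finset.sum_congr rfl fun t _ => ?_
  change ∫ τ, (totalReward 𝓜 τ • score π (τ t).1 (τ t).2 θ -
    b t (τ t).1 • score π (τ t).1 (τ t).2 θ) ∂(trajLaw 𝓜 π H θ) = _
  rw [integral_sub (hi1 t) (hi2 t), h.integral_baseline_score θ t, sub_zero]

lemma norm_gradient_le (h : BoundedSetting 𝓜 π b R G M bbar) (θ : EuclideanSpace ℝ (Fin q)) :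
    ‖gradient (expReward 𝓜 π H) θ‖ ≤ R / (1 - 𝓜.discount) * (H * G) :=
  (h.smooth.trajFamily 𝓜 H).norm_gradient_integral_le (measurable_totalReward 𝓜)
    h.abs_totalReward_le θ

lemma continuous_gradient (h : BoundedSetting 𝓜 π b R G M bbar) :
    Continuous (gradient (expReward 𝓜 π H)) := by
  have hR0 : 0 ≤ R / (1 - 𝓜.discount) :=
    div_nonneg h.R_nonneg (sub_pos.2 𝓜.discount_lt_one).le
  have hfam := h.smooth.trajFamily 𝓜 H
  refine (LipschitzWith.of_dist_le_mul (K := ⟨R / (1 - 𝓜.discount) * (H * M + (H * G) ^ 2),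
    mul_nonneg hR0 (add_nonneg hfam.K_nonneg (sq_nonneg _))⟩) fun θ θ' => ?_).continuous
  rw [dist_eq_norm, dist_eq_norm]
  exact hfam.norm_gradient_integral_sub_le (measurable_totalReward 𝓜) hR0
    h.abs_totalReward_le θ' θ

lemma expReward_lower_bound (h : BoundedSetting 𝓜 π b R G M bbar) {L : ℝ}
    (hL : constL R G M 𝓜.discount H ≤ L) (θ θ' : EuclideanSpace ℝ (Fin q)) :
    expReward 𝓜 π H θ + ⟪gradient (expReward 𝓜 π H) θ, θ' - θ⟫ - L / 2 * ‖θ' - θ‖ ^ 2 ≤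
      expReward 𝓜 π H θ' := by
  have hR0 : 0 ≤ R / (1 - 𝓜.discount) :=
    div_nonneg h.R_nonneg (sub_pos.2 𝓜.discount_lt_one).le
  have h1 := (h.smooth.trajFamily 𝓜 H).quadratic_lower_bound (measurable_totalReward 𝓜) hR0
    h.abs_totalReward_le θ θ'
  have h2 : R / (1 - 𝓜.discount) * (H * M + (H * G) ^ 2) = constL R G M 𝓜.discount H := by
    rw [constL]; ring
  rw [h2] at h1
  have h3 : constL R G M 𝓜.discount H / 2 * ‖θ' - θ‖ ^ 2 ≤ L / 2 * ‖θ' - θ‖ ^ 2 := by gcongr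
  exact le_trans (sub_le_sub_left h3 _) h1

/-- The weight turns sampling under `θ'` into sampling under `θ`, where the estimator is unbiased
too. -/
lemma integral_gradCorrection (h : BoundedSetting 𝓜 π b R G M bbar)
    (θ θ' : EuclideanSpace ℝ (Fin q)) :
    ∫ τ, gradCorrection 𝓜 π b θ θ' τ ∂(trajLaw 𝓜 π H θ') =
      gradient (expReward 𝓜 π H) θ' - gradient (expReward 𝓜 π H) θ := by
  have hfam := h.smooth.trajFamily 𝓜 H
  have := h.isProbabilityMeasure_trajLaw θ
  have := h.isProbabilityMeasure_trajLaw θ'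
  have hi1 : Integrable (gradEst 𝓜 π b θ') (trajLaw 𝓜 π H θ') :=
    Integrable.of_bound (h.measurable_gradEst θ').aestronglyMeasurable _
      (Filter.Eventually.of_forall (h.norm_gradEst_le θ'))
  have hω : Integrable (impWeight π θ' θ) (trajLaw 𝓜 π H θ') := by
    have h1 : ∫ τ, impWeight π θ' θ τ ∂(trajLaw 𝓜 π H θ') = 1 := by
      have h2 := hfam.integral_ratio_smul θ' θ (fun _ => (1 : ℝ))
      have : ∫ _τ, (1 : ℝ) ∂(trajLaw 𝓜 π H θ) = 1 := by simp
      simp only [smul_eq_mul, mul_one] at h2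
      exact h2.trans this
    -- The Bochner integral of a non-integrable function is `0`, so the value `1` forces
    -- integrability.
    by_contra hne
    rw [integral_undef hne] at h1
    exact zero_ne_one h1
  have hi2 : Integrable (fun τ => impWeight π θ' θ τ • gradEst 𝓜 π b θ τ) (trajLaw 𝓜 π H θ') :=
    hω.smul_bdd _ (h.measurable_gradEst θ).aestronglyMeasurable
      (Filter.Eventually.of_forall (h.norm_gradEst_le θ))
  simp_rw [gradCorrection]
  rw [integral_sub hi1 hi2, h.integral_gradEst]
  congr 1
  rw [← h.integral_gradEst]
  exact hfam.integral_ratio_smul θ' θ (gradEst 𝓜 π b θ)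

/-- The second moment of the correction is quadratic in the distance of the parameters. -/
lemma lintegral_gradCorrection_le (h : BoundedSetting 𝓜 π b R G M bbar)
    {Q : EuclideanSpace ℝ (Fin q) → EReal} (hQ : ProperClosedConvex Q) {W : ℝ} (hW0 : 0 ≤ W)
    (hW : ∀ θ₁ θ₂, Q θ₁ ≠ ⊤ → Q θ₂ ≠ ⊤ →
      evariance (impWeight π (H := H) θ₁ θ₂) (trajLaw 𝓜 π H θ₁) ≤ ENNReal.ofReal W)
    {θ θ' : EuclideanSpace ℝ (Fin q)} (hθ : Q θ ≠ ⊤) (hθ' : Q θ' ≠ ⊤) :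
    ∫⁻ τ, ENNReal.ofReal (‖gradCorrection 𝓜 π b θ θ' τ‖ ^ 2) ∂(trajLaw 𝓜 π H θ') ≤
      ENNReal.ofReal (2 * constCbar R G M W bbar 𝓜.discount H * ‖θ' - θ‖ ^ 2) := by
  have hfam := h.smooth.trajFamily 𝓜 H
  have := h.isProbabilityMeasure_trajLaw θ'
  set Cg := constCg R G bbar 𝓜.discount H
  set Lg := constLg R M bbar 𝓜.discount H
  -- The variance bound holds only on the domain of `Q`; convexity keeps the segment inside it.
  have hratio := hfam.lintegral_ratio_sub_one_sq_le (θ₁ := θ') (θ₂ := θ) hW0 fun u hu => by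
    refine hW θ' _ hθ' ?_
    rw [AffineMap.lineMap_apply_module]
    exact (hQ.convex_combination hθ' hθ (sub_nonneg.2 hu.2) hu.1 (by ring)).1
  have hCg := h.constCg_nonneg
  have hpt : ∀ τ : Traj S A H, ‖gradCorrection 𝓜 π b θ θ' τ‖ ^ 2 ≤
      2 * Lg ^ 2 * ‖θ' - θ‖ ^ 2 + 2 * Cg ^ 2 * (trajDens π θ τ / trajDens π θ' τ - 1) ^ 2 := by
    intro τ
    set w := trajDens π θ τ / trajDens π θ' τ with hw
    -- The first difference is controlled by `Lg`, the second by `Cg` and the deviation of the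
    -- weight from `1`; squaring the sum costs the factor `2`.
    have h1 : gradCorrection 𝓜 π b θ θ' τ =
        (gradEst 𝓜 π b θ' τ - gradEst 𝓜 π b θ τ) - (w - 1) • gradEst 𝓜 π b θ τ := by
      rw [gradCorrection, impWeight, ← hw]; module
    have h2 : ‖gradCorrection 𝓜 π b θ θ' τ‖ ≤ Lg * ‖θ' - θ‖ + |w - 1| * Cg := by
      rw [h1]
      refine (norm_sub_le _ _).trans (add_le_add (h.norm_gradEst_sub_le _ _ _) ?_)
      rw [norm_smul, Real.norm_eq_abs]
      exact mul_le_mul_of_nonneg_left (h.norm_gradEst_le θ τ) (abs_nonneg _)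
    have h3 := pow_le_pow_left₀ (norm_nonneg _) h2 2
    have h4 := sq_nonneg (Lg * ‖θ' - θ‖ - |w - 1| * Cg)
    have h5 : |w - 1| ^ 2 = (w - 1) ^ 2 := sq_abs _
    have h6 : (|w - 1| * Cg) ^ 2 = Cg ^ 2 * (w - 1) ^ 2 := by rw [mul_pow, h5]; ring
    have h7 : (Lg * ‖θ' - θ‖) ^ 2 = Lg ^ 2 * ‖θ' - θ‖ ^ 2 := mul_pow _ _ _
    linarith [add_sq (Lg * ‖θ' - θ‖) (|w - 1| * Cg), sub_sq (Lg * ‖θ' - θ‖) (|w - 1| * Cg)]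
  have hG := h.smooth.G_nonneg
  have hM := h.smooth.M_nonneg
  calc ∫⁻ τ, ENNReal.ofReal (‖gradCorrection 𝓜 π b θ θ' τ‖ ^ 2) ∂(trajLaw 𝓜 π H θ')
      ≤ ∫⁻ τ, (ENNReal.ofReal (2 * Lg ^ 2 * ‖θ' - θ‖ ^ 2) + ENNReal.ofReal (2 * Cg ^ 2) *
          ENNReal.ofReal ((trajDens π θ τ / trajDens π θ' τ - 1) ^ 2)) ∂(trajLaw 𝓜 π H θ') := by
        refine lintegral_mono fun τ => ?_
        rw [← ENNReal.ofReal_mul (by positivity), ← ENNReal.ofReal_add (by positivity)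
          (by positivity)]
        exact ENNReal.ofReal_le_ofReal (hpt τ)
    _ = ENNReal.ofReal (2 * Lg ^ 2 * ‖θ' - θ‖ ^ 2) + ENNReal.ofReal (2 * Cg ^ 2) *
          ∫⁻ τ, ENNReal.ofReal ((trajDens π θ τ / trajDens π θ' τ - 1) ^ 2)
            ∂(trajLaw 𝓜 π H θ') := by
        rw [lintegral_add_left measurable_const, lintegral_const, measure_univ, mul_one,
          lintegral_const_mul]
        exact ((((measurable_trajDens π θ).div (measurable_trajDens π θ')).sub_const 1).pow_const
          2).ennreal_ofReal
    _ ≤ ENNReal.ofReal (2 * Lg ^ 2 * ‖θ' - θ‖ ^ 2) + ENNReal.ofReal (2 * Cg ^ 2) *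
          ENNReal.ofReal ((H * G) ^ 2 * (W + 1) * ‖θ - θ'‖ ^ 2) := by
        gcongr
        exact hratio
    _ ≤ _ := by
        rw [← ENNReal.ofReal_mul (by positivity), ← ENNReal.ofReal_add (by positivity)
          (by positivity), norm_sub_rev θ θ']
        refine ENNReal.ofReal_le_ofReal ?_
        -- The `L²` argument needs only `(HG)² (W + 1)`; the other terms of `C_ω` are slack.
        have hω : (H * G) ^ 2 * (W + 1) ≤ constCω G M W H := by
          rw [constCω]
          have h1 : 0 ≤ ((H : ℝ) * G) ^ 2 * (W + 1) := by positivity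
          have h2 : 0 ≤ (H : ℝ) * M * (W + 1) := by positivity
          linarith
        calc 2 * Lg ^ 2 * ‖θ' - θ‖ ^ 2
              + 2 * Cg ^ 2 * ((H * G) ^ 2 * (W + 1) * ‖θ' - θ‖ ^ 2)
            = 2 * (Cg ^ 2 * ((H * G) ^ 2 * (W + 1)) + Lg ^ 2) * ‖θ' - θ‖ ^ 2 := by ring
          _ ≤ 2 * (Cg ^ 2 * constCω G M W H + Lg ^ 2) * ‖θ' - θ‖ ^ 2 := by gcongr
          _ = _ := by rw [constCbar]

end BoundedSetting

end Estimators

/-! ### Second moments of sums of independent centred vectors -/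

section Moments

variable {q : ℕ} {X : Type*} [MeasurableSpace X]

lemma integrable_sq_norm_of_lintegral_le {P : Measure X} {f : X → EuclideanSpace ℝ (Fin q)}
    (hf : Measurable f) {V : ℝ} (hV : ∫⁻ x, ENNReal.ofReal (‖f x‖ ^ 2) ∂P ≤ ENNReal.ofReal V) :
    Integrable (fun x => ‖f x‖ ^ 2) P := by
  refine ⟨(hf.norm.pow_const 2).aestronglyMeasurable, ?_⟩
  rw [hasFiniteIntegral_iff_ofReal (Filter.Eventually.of_forall fun x => sq_nonneg _)]
  exact hV.trans_lt ENNReal.ofReal_lt_top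

/-- Adding a multiple of a centred vector to a constant adds at most its second moment. -/
lemma lintegral_add_centered_le {P : Measure X} [IsProbabilityMeasure P]
    {f : X → EuclideanSpace ℝ (Fin q)} (hf : Measurable f) {V : ℝ} (hV0 : 0 ≤ V)
    (hV : ∫⁻ x, ENNReal.ofReal (‖f x‖ ^ 2) ∂P ≤ ENNReal.ofReal V)
    (a : ℝ) (c : EuclideanSpace ℝ (Fin q)) :
    ∫⁻ x, ENNReal.ofReal (‖c + a • (f x - ∫ y, f y ∂P)‖ ^ 2) ∂P ≤
      ENNReal.ofReal (‖c‖ ^ 2 + a ^ 2 * V) := by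
  have hsq := integrable_sq_norm_of_lintegral_le hf hV
  have hint : Integrable f P :=
    ((memLp_two_iff_integrable_sq_norm hf.aestronglyMeasurable).2 hsq).integrable one_le_two
  set m := ∫ y, f y ∂P with hm
  -- Expanded about `c - a m`, the integral equals `‖c‖² + a² (∫ ‖f‖² - ‖m‖²)`; the last term is
  -- dropped.
  have hexp : ∀ x, ‖c + a • (f x - m)‖ ^ 2 =
      ‖c - a • m‖ ^ 2 + (2 * a * ⟪c - a • m, f x⟫ + a ^ 2 * ‖f x‖ ^ 2) := by
    intro x
    have h1 : c + a • (f x - m) = (c - a • m) + a • f x := by module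
    rw [h1, norm_add_sq_real, inner_smul_right, norm_smul, mul_pow, Real.norm_eq_abs, sq_abs]
    ring
  have hin : Integrable (fun x => ⟪c - a • m, f x⟫) P := hint.const_inner _
  have hi1 : Integrable (fun x => 2 * a * ⟪c - a • m, f x⟫ + a ^ 2 * ‖f x‖ ^ 2) P :=
    (hin.const_mul _).add (hsq.const_mul _)
  have hi : Integrable (fun x => ‖c + a • (f x - m)‖ ^ 2) P := by
    simp_rw [hexp]
    exact (integrable_const _).add hi1
  rw [← ofReal_integral_eq_lintegral_ofReal hi (Filter.Eventually.of_forall fun x => sq_nonneg _)]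
  refine ENNReal.ofReal_le_ofReal ?_
  simp_rw [hexp]
  rw [integral_add (integrable_const _) hi1, integral_add (hin.const_mul _) (hsq.const_mul _),
    integral_const_mul, integral_const_mul, integral_inner hint, ← hm]
  have hV' : ∫ x, ‖f x‖ ^ 2 ∂P ≤ V := by
    rw [← ofReal_integral_eq_lintegral_ofReal hsq
      (Filter.Eventually.of_forall fun x => sq_nonneg _)] at hV
    exact (ENNReal.ofReal_le_ofReal_iff hV0).1 hV
  have h2 : ‖c - a • m‖ ^ 2 = ‖c‖ ^ 2 - 2 * (a * ⟪c, m⟫) + a ^ 2 * ‖m‖ ^ 2 := by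
    rw [norm_sub_sq_real, inner_smul_right, norm_smul, mul_pow, Real.norm_eq_abs, sq_abs]
  have h3 : ⟪c - a • m, m⟫ = ⟪c, m⟫ - a * ‖m‖ ^ 2 := by
    rw [inner_sub_left, inner_smul_left, real_inner_self_eq_norm_sq]; simp
  rw [h2, h3]
  simp only [integral_const, probReal_univ, smul_eq_mul, one_mul]
  nlinarith [mul_le_mul_of_nonneg_left hV' (sq_nonneg a), mul_nonneg (sq_nonneg a) (sq_nonneg ‖m‖)]

/-- The hypothesis, quantified over all shifts `c`, expresses "centred with variance at most `v`" in
a form that iterates: integrate the coordinates after the first, with the first one absorbed in the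
shift. No cross terms appear. -/
lemma lintegral_pi_add_sum_le {P : Measure X} [IsProbabilityMeasure P]
    {f : X → EuclideanSpace ℝ (Fin q)} (hf : Measurable f) {v : ℝ} (hv : 0 ≤ v)
    (h : ∀ c, ∫⁻ x, ENNReal.ofReal (‖c + f x‖ ^ 2) ∂P ≤ ENNReal.ofReal (‖c‖ ^ 2 + v))
    (n : ℕ) (c : EuclideanSpace ℝ (Fin q)) :
    ∫⁻ τ : Fin n → X, ENNReal.ofReal (‖c + ∑ i, f (τ i)‖ ^ 2) ∂(Measure.pi fun _ => P) ≤
      ENNReal.ofReal (‖c‖ ^ 2 + n * v) := by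
  induction n generalizing c with
  | zero => simp
  | succ n ih =>
    have hmp := measurePreserving_piFinSuccAbove (fun _ : Fin (n + 1) => P) 0
    have hmeas : Measurable fun z : X × (Fin n → X) =>
        ENNReal.ofReal (‖c + (f z.1 + ∑ i, f (z.2 i))‖ ^ 2) := by fun_prop
    have h1 : ∫⁻ τ : Fin (n + 1) → X, ENNReal.ofReal (‖c + ∑ i, f (τ i)‖ ^ 2)
        ∂(Measure.pi fun _ => P) =
        ∫⁻ z, ENNReal.ofReal (‖c + (f z.1 + ∑ i, f (z.2 i))‖ ^ 2)
          ∂(P.prod (Measure.pi fun _ : Fin n => P)) := by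
      rw [← hmp.lintegral_comp hmeas]
      refine lintegral_congr fun τ => ?_
      rw [Fin.sum_univ_succ]
      rfl
    rw [h1, lintegral_prod _ hmeas.aemeasurable]
    calc ∫⁻ x, ∫⁻ τ : Fin n → X, ENNReal.ofReal (‖c + (f x + ∑ i, f (τ i))‖ ^ 2)
          ∂(Measure.pi fun _ => P) ∂P
        ≤ ∫⁻ x, (ENNReal.ofReal (‖c + f x‖ ^ 2) + ENNReal.ofReal (n * v)) ∂P := by
          refine lintegral_mono fun x => ?_
          simp_rw [← add_assoc]
          rw [← ENNReal.ofReal_add (by positivity) (by positivity)]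
          exact ih (c + f x)
      _ ≤ ENNReal.ofReal (‖c‖ ^ 2 + v) + ENNReal.ofReal (n * v) := by
          rw [lintegral_add_right _ measurable_const, lintegral_const, measure_univ, mul_one]
          gcongr
          exact h c
      _ = _ := by
          rw [← ENNReal.ofReal_add (by positivity) (by positivity)]
          push_cast; ring_nf

/-- Fubini: for a fixed first batch, its contribution is just another shift for the second. -/
lemma lintegral_pi_prod_add_sum_le {P : Measure X} [IsProbabilityMeasure P]
    {f g : X → EuclideanSpace ℝ (Fin q)} (hf : Measurable f) (hg : Measurable g) {v w : ℝ}
    (hv : 0 ≤ v) (hw : 0 ≤ w)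
    (h : ∀ c, ∫⁻ x, ENNReal.ofReal (‖c + f x‖ ^ 2) ∂P ≤ ENNReal.ofReal (‖c‖ ^ 2 + v))
    (h' : ∀ c, ∫⁻ x, ENNReal.ofReal (‖c + g x‖ ^ 2) ∂P ≤ ENNReal.ofReal (‖c‖ ^ 2 + w))
    (n : ℕ) (c : EuclideanSpace ℝ (Fin q)) :
    ∫⁻ z : (Fin n → X) × (Fin n → X), ENNReal.ofReal (‖c + ∑ i, f (z.1 i) + ∑ i, g (z.2 i)‖ ^ 2)
        ∂((Measure.pi fun _ => P).prod (Measure.pi fun _ => P)) ≤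
      ENNReal.ofReal (‖c‖ ^ 2 + n * v + n * w) := by
  have hmeas : Measurable fun z : (Fin n → X) × (Fin n → X) =>
      ENNReal.ofReal (‖c + ∑ i, f (z.1 i) + ∑ i, g (z.2 i)‖ ^ 2) := by fun_prop
  rw [lintegral_prod _ hmeas.aemeasurable]
  calc ∫⁻ τ : Fin n → X, ∫⁻ τ' : Fin n → X,
        ENNReal.ofReal (‖c + ∑ i, f (τ i) + ∑ i, g (τ' i)‖ ^ 2)
        ∂(Measure.pi fun _ => P) ∂(Measure.pi fun _ => P)
      ≤ ∫⁻ τ : Fin n → X, (ENNReal.ofReal (‖c + ∑ i, f (τ i)‖ ^ 2) + ENNReal.ofReal (n * w))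
        ∂(Measure.pi fun _ => P) := by
        refine lintegral_mono fun τ => ?_
        rw [← ENNReal.ofReal_add (by positivity) (by positivity)]
        exact lintegral_pi_add_sum_le hg hw h' n _
    _ ≤ ENNReal.ofReal (‖c‖ ^ 2 + n * v) + ENNReal.ofReal (n * w) := by
        rw [lintegral_add_right _ measurable_const, lintegral_const, measure_univ, mul_one]
        gcongr
        exact lintegral_pi_add_sum_le hf hv h n c
    _ = _ := by rw [← ENNReal.ofReal_add (by positivity) (by positivity)]

end Moments

/-! ### Disintegration along the history -/

section ConditionalLaws

lemma measurable_pi_measure {Z X : Type*} [MeasurableSpace Z] [MeasurableSpace X]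
    {κ : Z → Measure X} (hκ : Measurable κ) [∀ z, IsProbabilityMeasure (κ z)] (n : ℕ) :
    Measurable fun z => Measure.pi fun _ : Fin n => κ z := by
  refine Measurable.measure_of_isPiSystem_of_isProbabilityMeasure
    (S := Set.pi Set.univ '' Set.pi Set.univ fun _ : Fin n => {s : Set X | MeasurableSet s})
    generateFrom_pi.symm isPiSystem_pi ?_
  rintro _ ⟨s, hs, rfl⟩
  simp_rw [Measure.pi_pi]
  exact Finset.measurable_prod _ fun i _ => (Measure.measurable_coe (hs i trivial)).comp hκ

/-- Integration against a conditional law given a `σ`-field. -/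
lemma lintegral_of_conditional_law {Ω Z X : Type*} {m mΩ : MeasurableSpace Ω} [MeasurableSpace Z]
    [MeasurableSpace X] {μ : Measure Ω} [IsProbabilityMeasure μ] (hm : m ≤ mΩ) {Y : Ω → Z}
    (hY : Measurable[m] Y) {D : Ω → X} (hD : Measurable D) (κ : Kernel Z X) [IsMarkovKernel κ]
    (h : ∀ C, MeasurableSet[m] C → ∀ E, MeasurableSet E →
      μ (C ∩ {ω | D ω ∈ E}) = ∫⁻ ω in C, κ (Y ω) E ∂μ)
    {Φ : Z × X → ℝ≥0∞} (hΦ : Measurable Φ) :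
    ∫⁻ ω, Φ (Y ω, D ω) ∂μ = ∫⁻ ω, ∫⁻ x, Φ (Y ω, x) ∂(κ (Y ω)) ∂μ := by
  have hY' : Measurable Y := hY.mono hm le_rfl
  have hYD : Measurable fun ω => (Y ω, D ω) := hY'.prodMk hD
  have hprob := Measure.isProbabilityMeasure_map (μ := μ) hYD.aemeasurable
  have hlaw : μ.map (fun ω => (Y ω, D ω)) = (μ.map Y) ⊗ₘ κ := by
    -- On rectangles the two joint laws agree by the conditional law applied to the `m`-measurable
    -- event `Y ∈ s`.
    refine Measure.ext_prod fun {s t} hs ht => ?_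
    rw [Measure.map_apply hYD (hs.prod ht), Measure.compProd_apply_prod hs ht,
      setLIntegral_map hs (κ.measurable_coe ht) hY', ← h _ (hY hs) t ht]
    rfl
  have h1 : ∫⁻ z, Φ z ∂(μ.map fun ω => (Y ω, D ω)) = ∫⁻ z, Φ z ∂((μ.map Y) ⊗ₘ κ) := by rw [hlaw]
  rw [lintegral_map hΦ hYD, Measure.lintegral_compProd hΦ,
    lintegral_map hΦ.lintegral_kernel_prod_right' hY'] at h1
  exact h1

end ConditionalLaws

/-! ### One step of the algorithm from a fixed state -/

section Steps

variable {S A : Type*} [MeasurableSpace S] [MeasurableSpace A] {q H B : ℕ} {lam : Measure A}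

/-- The update of the parameter. -/
def nextPoint (Q : EuclideanSpace ℝ (Fin q) → EReal) (α η : ℝ)
    (z : EuclideanSpace ℝ (Fin q) × EuclideanSpace ℝ (Fin q)) : EuclideanSpace ℝ (Fin q) :=
  (1 - α) • z.1 + α • prox η Q (z.1 + η • z.2)

/-- The update of the search direction at the new parameter `θ'`. -/
def nextDirection (𝓜 : MDP S A) (π : Policy q S lam) (b : Fin H → S → ℝ) (β : ℝ)
    (z : EuclideanSpace ℝ (Fin q) × EuclideanSpace ℝ (Fin q)) (θ' : EuclideanSpace ℝ (Fin q))
    (d : (Fin B → Traj S A H) × (Fin B → Traj S A H)) : EuclideanSpace ℝ (Fin q) :=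
  β • z.2 + (β / (B : ℝ)) • ∑ i, gradCorrection 𝓜 π b z.1 θ' (d.1 i)
    + ((1 - β) / (B : ℝ)) • ∑ i, gradEst 𝓜 π b θ' (d.2 i)

variable {𝓜 : MDP S A} {π : Policy q S lam} {b : Fin H → S → ℝ} {R G M bbar : ℝ}
  {Q : EuclideanSpace ℝ (Fin q) → EReal} {α β η : ℝ}

lemma measurable_nextPoint (hQ : ProperClosedConvex Q) (hη : 0 < η) :
    Measurable (nextPoint Q α η) := by
  have := continuous_prox hQ hη
  exact Continuous.measurable (by unfold nextPoint; fun_prop)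

lemma BoundedSetting.measurable_gradEst_comp (h : BoundedSetting 𝓜 π b R G M bbar)
    {Y : Type*} {mY : MeasurableSpace Y} {θ : Y → EuclideanSpace ℝ (Fin q)} {τ : Y → Traj S A H}
    (hθ : Measurable θ) (hτ : Measurable τ) : Measurable fun y => gradEst 𝓜 π b (θ y) (τ y) := by
  have hg := h.measurable_uncurry_gradEst.comp (hθ.prodMk hτ)
  exact hg

variable [SigmaFinite lam]

lemma BoundedSetting.measurable_trajDens_comp (h : BoundedSetting 𝓜 π b R G M bbar)
    {Y : Type*} {mY : MeasurableSpace Y} {θ : Y → EuclideanSpace ℝ (Fin q)} {τ : Y → Traj S A H}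
    (hθ : Measurable θ) (hτ : Measurable τ) : Measurable fun y => trajDens π (θ y) (τ y) := by
  have hfam := h.smooth.trajFamily 𝓜 H
  have hd : Measurable (Function.uncurry (trajDens π (H := H))) :=
    measurable_uncurry_of_continuous_of_measurable hfam.continuous_density hfam.measurable
  exact hd.comp (hθ.prodMk hτ)

lemma BoundedSetting.measurable_nextDirection (h : BoundedSetting 𝓜 π b R G M bbar)
    {Y : Type*} {mY : MeasurableSpace Y}
    {z : Y → EuclideanSpace ℝ (Fin q) × EuclideanSpace ℝ (Fin q)}
    {θ' : Y → EuclideanSpace ℝ (Fin q)} {d d' : Y → Fin B → Traj S A H}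
    (hz : Measurable z) (hθ' : Measurable θ') (hd : Measurable d) (hd' : Measurable d') :
    Measurable fun y => nextDirection 𝓜 π b β (z y) (θ' y) (d y, d' y) := by
  have hi : ∀ i, Measurable fun y => d y i := fun i => (measurable_pi_apply i).comp hd
  have hi' : ∀ i, Measurable fun y => d' y i := fun i => (measurable_pi_apply i).comp hd'
  have h1 : ∀ i, Measurable fun y => gradCorrection 𝓜 π b (z y).1 (θ' y) (d y i) := fun i =>
    (h.measurable_gradEst_comp hθ' (hi i)).sub
      (((h.measurable_trajDens_comp hz.fst (hi i)).div
        (h.measurable_trajDens_comp hθ' (hi i))).smul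
        (h.measurable_gradEst_comp hz.fst (hi i)))
  have h2 : ∀ i, Measurable fun y => gradEst 𝓜 π b (θ' y) (d' y i) := fun i =>
    h.measurable_gradEst_comp hθ' (hi' i)
  have h3 : Measurable fun y => ∑ i, gradCorrection 𝓜 π b (z y).1 (θ' y) (d y i) :=
    Finset.measurable_sum _ fun i _ => h1 i
  have h4 : Measurable fun y => ∑ i, gradEst 𝓜 π b (θ' y) (d' y i) :=
    Finset.measurable_sum _ fun i _ => h2 i
  exact ((hz.snd.const_smul β).add (h3.const_smul (β / (B : ℝ)))).add
    (h4.const_smul ((1 - β) / (B : ℝ)))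

/-- The mean squared error of the search direction after a step from a fixed state. -/
lemma BoundedSetting.lintegral_nextDirection_error_le (h : BoundedSetting 𝓜 π b R G M bbar)
    (hQ : ProperClosedConvex Q) {W : ℝ} (hW0 : 0 ≤ W)
    (hW : ∀ θ₁ θ₂, Q θ₁ ≠ ⊤ → Q θ₂ ≠ ⊤ →
      evariance (impWeight π (H := H) θ₁ θ₂) (trajLaw 𝓜 π H θ₁) ≤ ENNReal.ofReal W)
    (hB : 1 ≤ B) {σ : ℝ} (hσ : constCg R G bbar 𝓜.discount H ≤ σ)
    (hC : 0 ≤ constCbar R G M W bbar 𝓜.discount H)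
    {z : EuclideanSpace ℝ (Fin q) × EuclideanSpace ℝ (Fin q)} {θ' : EuclideanSpace ℝ (Fin q)}
    (hz : Q z.1 ≠ ⊤) (hθ' : Q θ' ≠ ⊤) :
    ∫⁻ d : (Fin B → Traj S A H) × (Fin B → Traj S A H),
        ENNReal.ofReal (‖nextDirection 𝓜 π b β z θ' d - gradient (expReward 𝓜 π H) θ'‖ ^ 2)
        ∂((Measure.pi fun _ => trajLaw 𝓜 π H θ').prod (Measure.pi fun _ => trajLaw 𝓜 π H θ')) ≤
      ENNReal.ofReal (β ^ 2 * ‖z.2 - gradient (expReward 𝓜 π H) z.1‖ ^ 2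
        + 2 * β ^ 2 * constCbar R G M W bbar 𝓜.discount H / B * ‖θ' - z.1‖ ^ 2
        + (1 - β) ^ 2 * σ ^ 2 / B) := by
  have := h.isProbabilityMeasure_trajLaw θ'
  set P := trajLaw 𝓜 π H θ'
  set J := expReward 𝓜 π H
  set C := constCbar R G M W bbar 𝓜.discount H
  have hB0 : (0 : ℝ) < B := by exact_mod_cast hB
  have hX := h.measurable_gradCorrection z.1 θ'
  have hg := h.measurable_gradEst θ'
  have hXm := h.lintegral_gradCorrection_le hQ hW0 hW hz hθ'
  have hgm : ∫⁻ τ, ENNReal.ofReal (‖gradEst 𝓜 π b θ' τ‖ ^ 2) ∂P ≤ ENNReal.ofReal (σ ^ 2) := by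
    calc ∫⁻ τ, ENNReal.ofReal (‖gradEst 𝓜 π b θ' τ‖ ^ 2) ∂P
        ≤ ∫⁻ _τ, ENNReal.ofReal (σ ^ 2) ∂P := by
          refine lintegral_mono fun τ => ENNReal.ofReal_le_ofReal ?_
          have := (h.norm_gradEst_le θ' τ).trans hσ
          gcongr
      _ = _ := by simp
  -- The new error is `β` times the old one plus the two centred batch averages: the means combine
  -- as `β (∇J(θ') - ∇J(θ)) + (1 - β) ∇J(θ') = ∇J(θ') - β ∇J(θ)`.
  have key := lintegral_pi_prod_add_sum_le (P := P)
    (f := fun τ => (β / (B : ℝ)) • (gradCorrection 𝓜 π b z.1 θ' τ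
      - ∫ y, gradCorrection 𝓜 π b z.1 θ' y ∂P))
    (g := fun τ => ((1 - β) / (B : ℝ)) • (gradEst 𝓜 π b θ' τ - ∫ y, gradEst 𝓜 π b θ' y ∂P))
    ((hX.sub_const _).const_smul (β / (B : ℝ))) ((hg.sub_const _).const_smul ((1 - β) / (B : ℝ)))
    (v := (β / (B : ℝ)) ^ 2 * (2 * C * ‖θ' - z.1‖ ^ 2)) (w := ((1 - β) / (B : ℝ)) ^ 2 * σ ^ 2)
    (by positivity) (by positivity)
    (fun c => lintegral_add_centered_le hX (by positivity) hXm _ c)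
    (fun c => lintegral_add_centered_le hg (by positivity) hgm _ c) B
    (β • (z.2 - gradient J z.1))
  rw [h.integral_gradCorrection, h.integral_gradEst] at key
  have hcalc : ‖β • (z.2 - gradient J z.1)‖ ^ 2
      + B * ((β / (B : ℝ)) ^ 2 * (2 * C * ‖θ' - z.1‖ ^ 2)) + B * (((1 - β) / (B : ℝ)) ^ 2 * σ ^ 2) =
      β ^ 2 * ‖z.2 - gradient J z.1‖ ^ 2 + 2 * β ^ 2 * C / B * ‖θ' - z.1‖ ^ 2
        + (1 - β) ^ 2 * σ ^ 2 / B := by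
    rw [norm_smul, mul_pow, Real.norm_eq_abs, sq_abs]
    field_simp
  rw [hcalc] at key
  refine le_trans (le_of_eq ?_) key
  refine lintegral_congr fun d => ?_
  congr 3
  have hsum : ∀ (r : ℝ) (f : Traj S A H → EuclideanSpace ℝ (Fin q))
      (x : EuclideanSpace ℝ (Fin q)) (τ : Fin B → Traj S A H),
      ∑ i, (r / (B : ℝ)) • (f (τ i) - x) = (r / (B : ℝ)) • ∑ i, f (τ i) - r • x := by
    intro r f x τ
    rw [← Finset.smul_sum, Finset.sum_sub_distrib, smul_sub, Finset.sum_const, Finset.card_univ,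
      Fintype.card_fin, ← Nat.cast_smul_eq_nsmul ℝ, smul_smul, div_mul_cancel₀ _ hB0.ne']
  rw [hsum, hsum, nextDirection]
  module

end Steps

/-! ### Runs as adapted processes and the error recursion -/

section Runs

variable {S A : Type*} [MeasurableSpace S] [MeasurableSpace A] {q H N B m : ℕ} {lam : Measure A}
  {Ω : Type*}

/-- The pair `(θ_t, v_t)` of a run as a random variable. -/
def runState (𝓜 : MDP S A) (π : Policy q S lam) (b : Fin H → S → ℝ)
    (Q : EuclideanSpace ℝ (Fin q) → EReal) (α β η : ℝ) (θ₀ : EuclideanSpace ℝ (Fin q))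
    (D₀ : Ω → Fin N → Traj S A H) (D D' : ℕ → Ω → Fin B → Traj S A H) (t : ℕ) (ω : Ω) :
    EuclideanSpace ℝ (Fin q) × EuclideanSpace ℝ (Fin q) :=
  iter 𝓜 π b Q α β η θ₀ (D₀ ω) (fun s => D s ω) (fun s => D' s ω) t

lemma history_mono (D₀ : Ω → Fin N → Traj S A H) (D D' : ℕ → Ω → Fin B → Traj S A H)
    {s t : ℕ} (hst : s ≤ t) : history D₀ D D' s ≤ history D₀ D D' t :=
  sup_le_sup_left (biSup_mono fun _ hi => ⟨hi.1, hi.2.trans_le hst⟩) _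

lemma comap_batch_le_history (D₀ : Ω → Fin N → Traj S A H) (D D' : ℕ → Ω → Fin B → Traj S A H)
    {s t : ℕ} (hs : 1 ≤ s) (hst : s < t) :
    MeasurableSpace.comap (D s) inferInstance ⊔ MeasurableSpace.comap (D' s) inferInstance ≤
      history D₀ D D' t :=
  (le_biSup (fun s => MeasurableSpace.comap (D s) inferInstance ⊔
    MeasurableSpace.comap (D' s) inferInstance) (show s ∈ Set.Ico 1 t from ⟨hs, hst⟩)).trans
    le_sup_right

variable {𝓜 : MDP S A} {π : Policy q S lam} {b : Fin H → S → ℝ} {R G M bbar : ℝ}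
  {Q : EuclideanSpace ℝ (Fin q) → EReal} {α β η : ℝ} {θ₀ : EuclideanSpace ℝ (Fin q)}
  {D₀ : Ω → Fin N → Traj S A H} {D D' : ℕ → Ω → Fin B → Traj S A H} {T : Ω → Fin (m + 1)}

local notation "𝒵" => runState 𝓜 π b Q α β η θ₀ D₀ D D'

lemma runState_succ_fst (t : ℕ) (ω : Ω) : (𝒵 (t + 1) ω).1 = nextPoint Q α η (𝒵 t ω) := rfl

lemma IsRun.history_le [MeasurableSpace Ω] {μ : Measure Ω}
    (hrun : IsRun 𝓜 π b Q α β η θ₀ m N B μ D₀ D D' T) {t : ℕ}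
    (ht : t ≤ m + 1) : history D₀ D D' t ≤ (inferInstance : MeasurableSpace Ω) := by
  refine sup_le hrun.measurable_init.comap_le (iSup₂_le fun s hs => ?_)
  have h := hrun.measurable_batch s ⟨hs.1, by have := hs.2; omega⟩
  exact sup_le h.1.comap_le h.2.comap_le

lemma runState_mem_domain (hQ : ProperClosedConvex Q) (hη : 0 < η) (hα0 : 0 ≤ α) (hα1 : α ≤ 1)
    (hθ₀ : Q θ₀ ≠ ⊤) (t : ℕ) (ω : Ω) : Q (𝒵 t ω).1 ≠ ⊤ := by
  induction t with
  | zero => exact hθ₀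
  | succ t ih =>
    rw [runState_succ_fst]
    exact (hQ.convex_combination ih (prox_ne_top hQ hη _) (sub_nonneg.2 hα1) hα0 (by ring)).1

variable [SigmaFinite lam]

/-- The index shift matters: state `t` uses the batches up to `t`, which is what `history (t + 1)`
contains. The next parameter is a function of state `t`, so it is known before batch `t + 1` is
drawn. -/
lemma BoundedSetting.measurable_runState (h : BoundedSetting 𝓜 π b R G M bbar)
    (hQ : ProperClosedConvex Q) (hη : 0 < η) (t : ℕ) :
    Measurable[history D₀ D D' (t + 1)] (𝒵 t) := by
  induction t with
  | zero =>
    have hD₀ : Measurable[history D₀ D D' 1] D₀ := by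
      refine Measurable.of_comap_le ?_
      exact le_sup_left
    have h1 : Measurable fun d : Fin N → Traj S A H =>
        (θ₀, (1 / (N : ℝ)) • ∑ i, gradEst 𝓜 π b θ₀ (d i)) :=
      measurable_const.prodMk ((Finset.measurable_sum _ fun i _ =>
        (h.measurable_gradEst θ₀).comp (measurable_pi_apply i)).const_smul (1 / (N : ℝ)))
    exact h1.comp hD₀
  | succ t ih =>
    have hle := comap_batch_le_history D₀ D D' (s := t + 1) (t := t + 2) (by omega) (by omega)
    have hD : Measurable[history D₀ D D' (t + 2)] (D (t + 1)) :=
      Measurable.of_comap_le (le_sup_left.trans hle)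
    have hD' : Measurable[history D₀ D D' (t + 2)] (D' (t + 1)) :=
      Measurable.of_comap_le (le_sup_right.trans hle)
    have hZ : Measurable[history D₀ D D' (t + 2)] (𝒵 t) :=
      ih.mono (history_mono D₀ D D' (by omega)) le_rfl
    have hp := (measurable_nextPoint (α := α) hQ hη).comp hZ
    exact hp.prodMk (h.measurable_nextDirection hZ hp hD hD')

variable [MeasurableSpace Ω] {μ : Measure Ω}

lemma IsRun.measurable_runState (hrun : IsRun 𝓜 π b Q α β η θ₀ m N B μ D₀ D D' T)
    (h : BoundedSetting 𝓜 π b R G M bbar) (hQ : ProperClosedConvex Q) (hη : 0 < η) {t : ℕ}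
    (ht : t ≤ m) : Measurable (𝒵 t) :=
  (h.measurable_runState hQ hη t).mono (hrun.history_le (by omega)) le_rfl

/-- A batch drawn from the law of the trajectories under a parameter. -/
def batchKernel (h : BoundedSetting 𝓜 π b R G M bbar) (B : ℕ) :
    Kernel (EuclideanSpace ℝ (Fin q)) (Fin B → Traj S A H) where
  toFun θ := Measure.pi fun _ => trajLaw 𝓜 π H θ
  measurable' :=
    have : ∀ θ, IsProbabilityMeasure (trajLaw 𝓜 π H θ) := h.isProbabilityMeasure_trajLaw
    measurable_pi_measure (κ := trajLaw 𝓜 π H) (h.smooth.trajFamily 𝓜 H).measurable_law B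

instance isMarkovKernel_batchKernel (h : BoundedSetting 𝓜 π b R G M bbar) (B : ℕ) :
    IsMarkovKernel (batchKernel h B) :=
  ⟨fun θ => by
    have := h.isProbabilityMeasure_trajLaw θ
    change IsProbabilityMeasure (Measure.pi fun _ => trajLaw 𝓜 π H θ)
    infer_instance⟩

lemma batchKernel_prod_apply (h : BoundedSetting 𝓜 π b R G M bbar) (B : ℕ)
    (θ : EuclideanSpace ℝ (Fin q)) :
    (batchKernel h B ×ₖ batchKernel h B) θ = (Measure.pi fun _ => trajLaw 𝓜 π H θ).prod
      (Measure.pi fun _ => trajLaw 𝓜 π H θ) :=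
  Kernel.prod_apply _ _ θ

/-- The error of the search direction. -/
def searchError (𝓜 : MDP S A) (π : Policy q S lam) (H : ℕ)
    (z : EuclideanSpace ℝ (Fin q) × EuclideanSpace ℝ (Fin q)) : EuclideanSpace ℝ (Fin q) :=
  z.2 - gradient (expReward 𝓜 π H) z.1

/-- The displacement of the inexact proximal step. -/
def proxStep (Q : EuclideanSpace ℝ (Fin q) → EReal) (η : ℝ)
    (z : EuclideanSpace ℝ (Fin q) × EuclideanSpace ℝ (Fin q)) : EuclideanSpace ℝ (Fin q) :=
  prox η Q (z.1 + η • z.2) - z.1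

/-- The displacement of the exact proximal step. -/
def exactStep (J : EuclideanSpace ℝ (Fin q) → ℝ) (Q : EuclideanSpace ℝ (Fin q) → EReal) (η : ℝ)
    (z : EuclideanSpace ℝ (Fin q) × EuclideanSpace ℝ (Fin q)) : EuclideanSpace ℝ (Fin q) :=
  prox η Q (z.1 + η • gradient J z.1) - z.1

lemma nextPoint_sub (z : EuclideanSpace ℝ (Fin q) × EuclideanSpace ℝ (Fin q)) :
    nextPoint Q α η z - z.1 = α • proxStep Q η z := by
  rw [nextPoint, proxStep]; module

lemma BoundedSetting.continuous_searchError (h : BoundedSetting 𝓜 π b R G M bbar) :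
    Continuous (searchError 𝓜 π H) :=
  continuous_snd.sub (h.continuous_gradient.comp continuous_fst)

lemma BoundedSetting.continuous_exactStep (h : BoundedSetting 𝓜 π b R G M bbar)
    (hQ : ProperClosedConvex Q) (hη : 0 < η) :
    Continuous (exactStep (expReward 𝓜 π H) Q η) := by
  have := continuous_prox hQ hη
  have := h.continuous_gradient
  unfold exactStep
  fun_prop

lemma IsRun.lintegral_searchError_zero_le
    (hrun : IsRun 𝓜 π b Q α β η θ₀ m N B μ D₀ D D' T) (h : BoundedSetting 𝓜 π b R G M bbar)
    (hN : 1 ≤ N) {σ : ℝ} (hσ : constCg R G bbar 𝓜.discount H ≤ σ) :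
    ∫⁻ ω, ENNReal.ofReal (‖searchError 𝓜 π H (𝒵 0 ω)‖ ^ 2) ∂μ ≤ ENNReal.ofReal (σ ^ 2 / N) := by
  have := h.isProbabilityMeasure_trajLaw θ₀
  have hN0 : (0 : ℝ) < N := by exact_mod_cast hN
  have hg := h.measurable_gradEst θ₀
  set P := trajLaw 𝓜 π H θ₀
  have hgm : ∫⁻ τ, ENNReal.ofReal (‖gradEst 𝓜 π b θ₀ τ‖ ^ 2) ∂P ≤ ENNReal.ofReal (σ ^ 2) := by
    calc ∫⁻ τ, ENNReal.ofReal (‖gradEst 𝓜 π b θ₀ τ‖ ^ 2) ∂P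
        ≤ ∫⁻ _τ, ENNReal.ofReal (σ ^ 2) ∂P := by
          refine lintegral_mono fun τ => ENNReal.ofReal_le_ofReal ?_
          have := (h.norm_gradEst_le θ₀ τ).trans hσ
          gcongr
      _ = _ := by simp
  have key := lintegral_pi_add_sum_le (P := P)
    (f := fun τ => (1 / (N : ℝ)) • (gradEst 𝓜 π b θ₀ τ - ∫ y, gradEst 𝓜 π b θ₀ y ∂P))
    ((hg.sub_const _).const_smul (1 / (N : ℝ))) (v := (1 / (N : ℝ)) ^ 2 * σ ^ 2) (by positivity)
    (fun c => lintegral_add_centered_le hg (by positivity) hgm _ c) N 0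
  rw [h.integral_gradEst, ← hrun.law_init] at key
  have hmeas : Measurable fun d : Fin N → Traj S A H => ENNReal.ofReal
      (‖(0 : EuclideanSpace ℝ (Fin q)) + ∑ i, (1 / (N : ℝ)) •
        (gradEst 𝓜 π b θ₀ (d i) - gradient (expReward 𝓜 π H) θ₀)‖ ^ 2) := by fun_prop
  rw [lintegral_map hmeas hrun.measurable_init] at key
  have hcalc : ‖(0 : EuclideanSpace ℝ (Fin q))‖ ^ 2 + N * ((1 / (N : ℝ)) ^ 2 * σ ^ 2) =
      σ ^ 2 / N := by
    rw [norm_zero]; field_simp; ring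
  rw [hcalc] at key
  refine le_trans (le_of_eq ?_) key
  refine lintegral_congr fun ω => ?_
  congr 3
  rw [zero_add, ← Finset.smul_sum, Finset.sum_sub_distrib, Finset.sum_const, Finset.card_univ,
    Fintype.card_fin, ← Nat.cast_smul_eq_nsmul ℝ, smul_sub, smul_smul,
    one_div_mul_cancel hN0.ne', one_smul]
  rfl

/-- Condition on the history and apply the fixed-state bound. Lower integrals avoid any prior
integrability, which is in turn deduced from this inequality. -/
lemma IsRun.lintegral_searchError_succ_le [IsProbabilityMeasure μ]
    (hrun : IsRun 𝓜 π b Q α β η θ₀ m N B μ D₀ D D' T) (h : BoundedSetting 𝓜 π b R G M bbar)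
    (hQ : ProperClosedConvex Q) (hη : 0 < η) (hα0 : 0 ≤ α) (hα1 : α ≤ 1) (hθ₀ : Q θ₀ ≠ ⊤)
    {W : ℝ} (hW0 : 0 ≤ W)
    (hW : ∀ θ₁ θ₂, Q θ₁ ≠ ⊤ → Q θ₂ ≠ ⊤ →
      evariance (impWeight π (H := H) θ₁ θ₂) (trajLaw 𝓜 π H θ₁) ≤ ENNReal.ofReal W)
    (hB : 1 ≤ B) {σ : ℝ} (hσ : constCg R G bbar 𝓜.discount H ≤ σ)
    (hC : 0 ≤ constCbar R G M W bbar 𝓜.discount H) {t : ℕ} (ht : t < m) :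
    ∫⁻ ω, ENNReal.ofReal (‖searchError 𝓜 π H (𝒵 (t + 1) ω)‖ ^ 2) ∂μ ≤
      ∫⁻ ω, ENNReal.ofReal (β ^ 2 * ‖searchError 𝓜 π H (𝒵 t ω)‖ ^ 2
        + 2 * β ^ 2 * constCbar R G M W bbar 𝓜.discount H / B *
          (α ^ 2 * ‖proxStep Q η (𝒵 t ω)‖ ^ 2)
        + (1 - β) ^ 2 * σ ^ 2 / B) ∂μ := by
  have hnext := measurable_nextPoint (α := α) hQ hη
  have hbatch := hrun.measurable_batch (t + 1) ⟨by omega, by omega⟩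
  have hgc := h.continuous_gradient.measurable
  have hΦ : Measurable fun x : (EuclideanSpace ℝ (Fin q) × EuclideanSpace ℝ (Fin q)) ×
      ((Fin B → Traj S A H) × (Fin B → Traj S A H)) => ENNReal.ofReal
      (‖nextDirection 𝓜 π b β x.1 (nextPoint Q α η x.1) x.2 -
        gradient (expReward 𝓜 π H) (nextPoint Q α η x.1)‖ ^ 2) := by
    have hp : Measurable fun x : (EuclideanSpace ℝ (Fin q) × EuclideanSpace ℝ (Fin q)) ×
      ((Fin B → Traj S A H) × (Fin B → Traj S A H)) => nextPoint Q α η x.1 :=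
      hnext.comp measurable_fst
    exact ((((h.measurable_nextDirection measurable_fst hp (measurable_fst.comp measurable_snd)
      (measurable_snd.comp measurable_snd)).sub
      (hgc.comp hp)).norm).pow_const 2).ennreal_ofReal
  have key := lintegral_of_conditional_law (μ := μ) (hrun.history_le (t := t + 1) (by omega))
    (h.measurable_runState hQ hη t) (hbatch.1.prodMk hbatch.2)
    -- Given the history, the law of the batches depends on the state only through the new
    -- parameter.
    ((batchKernel h B ×ₖ batchKernel h B).comap (nextPoint Q α η) hnext)
    (fun C hC E hE => by
      rw [hrun.cond_law_batch (t + 1) ⟨by omega, by omega⟩ C hC E hE]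
      refine lintegral_congr fun ω => ?_
      rw [Kernel.comap_apply, batchKernel_prod_apply]
      rfl) hΦ
  refine (le_of_eq key).trans (lintegral_mono fun ω => ?_)
  have hdom := runState_mem_domain (𝓜 := 𝓜) (π := π) (b := b) (β := β) (D₀ := D₀) (D := D)
    (D' := D') hQ hη hα0 hα1 hθ₀
  simp only [Kernel.comap_apply, batchKernel_prod_apply]
  refine (h.lintegral_nextDirection_error_le hQ hW0 hW hB hσ hC (hdom t ω)
    (hdom (t + 1) ω)).trans_eq ?_
  rw [runState_succ_fst, nextPoint_sub, norm_smul, mul_pow, Real.norm_eq_abs, sq_abs]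
  rfl

end Runs

/-! ### The randomly chosen iterate -/

section UniformIndex

/-- The expectation of a family of random variables at a uniform index that is independent of it. -/
lemma integral_uniform_index {Ω : Type*} {𝓕 mΩ : MeasurableSpace Ω} {μ : Measure Ω}
    [IsProbabilityMeasure μ] {m : ℕ} {T : Ω → Fin (m + 1)}
    (hT : Measurable T) (hunif : ∀ k, μ {ω | T ω = k} = ((m : ℝ≥0∞) + 1)⁻¹)
    (hind : Indep (MeasurableSpace.comap T inferInstance) 𝓕 μ) {f : ℕ → Ω → ℝ}
    (hf : ∀ t ≤ m, Measurable[𝓕] (f t)) (hint : ∀ t ≤ m, Integrable (f t) μ) :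
    Integrable (fun ω => f (T ω) ω) μ ∧
      ∫ ω, f (T ω) ω ∂μ = ((m : ℝ) + 1)⁻¹ * ∑ t ∈ Finset.range (m + 1), ∫ ω, f t ω ∂μ := by
  have hset : ∀ k : Fin (m + 1), MeasurableSet {ω | T ω = k} := fun k =>
    hT (measurableSet_singleton k)
  -- Each term is an indicator of the index times an `𝓕`-measurable variable, so independence
  -- factors its expectation.
  have hdecomp : (fun ω => f (T ω) ω) =
      fun ω => ∑ k : Fin (m + 1), ({ω | T ω = k}.indicator (fun _ => (1 : ℝ)) ω) * f k ω := by
    ext ω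
    rw [Finset.sum_eq_single (T ω)]
    · simp
    · intro k _ hk
      rw [Set.indicator_of_notMem (by simpa using hk.symm), zero_mul]
    · simp
  have hterm : ∀ k : Fin (m + 1), Integrable
      (fun ω => ({ω | T ω = k}.indicator (fun _ => (1 : ℝ)) ω) * f k ω) μ := by
    intro k
    refine (hint k (by omega)).bdd_mul (c := 1)
      (measurable_const.indicator (hset k)).aestronglyMeasurable
      (Filter.Eventually.of_forall fun ω => ?_)
    exact (norm_indicator_le_norm_self _ _).trans (by simp)
  have hval : ∀ k : Fin (m + 1),
      ∫ ω, ({ω | T ω = k}.indicator (fun _ => (1 : ℝ)) ω) * f k ω ∂μ =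
        ((m : ℝ) + 1)⁻¹ * ∫ ω, f k ω ∂μ := by
    intro k
    have hindep : IndepFun ({ω | T ω = k}.indicator (fun _ => (1 : ℝ))) (f k) μ := by
      rw [IndepFun_iff_Indep]
      refine indep_of_indep_of_le_left (indep_of_indep_of_le_right hind
        (hf k (by omega)).comap_le) ?_
      refine Measurable.comap_le ?_
      exact Measurable.indicator measurable_const ⟨{k}, measurableSet_singleton k, rfl⟩
    rw [hindep.integral_fun_mul_eq_mul_integral
      (measurable_const.indicator (hset k)).aestronglyMeasurable
      (hint k (by omega)).aestronglyMeasurable, integral_indicator_const _ (hset k), measureReal_def,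
      hunif]
    congr 1
    rw [smul_eq_mul, mul_one, ENNReal.toReal_inv, ENNReal.toReal_add (by simp) (by simp)]
    simp
  rw [hdecomp]
  refine ⟨integrable_finsetSum _ fun k _ => hterm k, ?_⟩
  rw [integral_finsetSum _ fun k _ => hterm k]
  simp_rw [hval]
  rw [← Finset.mul_sum, Fin.sum_univ_eq_sum_range (fun t => ∫ ω, f t ω ∂μ)]

end UniformIndex

/-! ### Pathwise ascent, square integrability and bounds in expectation -/

section Runs

variable {S A : Type*} [MeasurableSpace S] [MeasurableSpace A] {q H N B m : ℕ} {lam : Measure A}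
  {Ω : Type*} {𝓜 : MDP S A} {π : Policy q S lam} {b : Fin H → S → ℝ} {R G M bbar : ℝ}
  {Q : EuclideanSpace ℝ (Fin q) → EReal} {α β η : ℝ} {θ₀ : EuclideanSpace ℝ (Fin q)}
  {D₀ : Ω → Fin N → Traj S A H} {D D' : ℕ → Ω → Fin B → Traj S A H} {T : Ω → Fin (m + 1)}

local notation "𝒵" => runState 𝓜 π b Q α β η θ₀ D₀ D D'

lemma objective_eq_coe (hQ : ProperClosedConvex Q) (J : EuclideanSpace ℝ (Fin q) → ℝ)
    {θ : EuclideanSpace ℝ (Fin q)} (hθ : Q θ ≠ ⊤) :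
    objective J Q θ = ((J θ - (Q θ).toReal : ℝ) : EReal) := by
  rw [objective, EReal.coe_sub, hQ.coe_toReal hθ]

variable [SigmaFinite lam]

/-- The ascent of the objective along a run bounds the exact proximal steps pathwise. -/
lemma sum_exactStep_le (h : BoundedSetting 𝓜 π b R G M bbar) (hQ : ProperClosedConvex Q)
    {Fstar : ℝ} (hF : ∀ θ, objective (expReward 𝓜 π H) Q θ ≤ (Fstar : EReal))
    {L : ℝ} (hL : constL R G M 𝓜.discount H ≤ L) (hα0 : 0 < α) (hα1 : α ≤ 1) (hη0 : 0 < η)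
    (hη1 : η ≤ 1 / 2) (hηα : η⁻¹ = 2 + L * α / 2) (hθ₀ : Q θ₀ ≠ ⊤) (m : ℕ) (ω : Ω) :
    α * ∑ t ∈ Finset.range (m + 1), ‖exactStep (expReward 𝓜 π H) Q η (𝒵 t ω)‖ ^ 2 ≤
      (Fstar - (objective (expReward 𝓜 π H) Q θ₀).toReal) +
      α * ((∑ t ∈ Finset.range (m + 1), ‖searchError 𝓜 π H (𝒵 t ω)‖ ^ 2) / 2 -
        (∑ t ∈ Finset.range (m + 1), ‖proxStep Q η (𝒵 t ω)‖ ^ 2) / 3) := by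
  set J := expReward 𝓜 π H
  set F : EuclideanSpace ℝ (Fin q) → ℝ := fun θ => J θ - (Q θ).toReal
  have hdom : ∀ t, Q (𝒵 t ω).1 ≠ ⊤ := fun t =>
    runState_mem_domain hQ hη0 hα0.le hα1 hθ₀ t ω
  have hFle : ∀ t, F (𝒵 t ω).1 ≤ Fstar := by
    intro t
    have h1 := hF (𝒵 t ω).1
    rw [objective_eq_coe hQ _ (hdom t)] at h1
    exact_mod_cast h1
  have hF0 : (objective J Q θ₀).toReal = F (𝒵 0 ω).1 := by
    rw [objective_eq_coe hQ _ hθ₀, EReal.toReal_coe]; rfl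
  -- The terms `2‖d‖² - ⟪e, d⟫` of the ascent inequality and of the exact-step bound coincide and
  -- cancel.
  have hstep : ∀ t, α * ‖exactStep J Q η (𝒵 t ω)‖ ^ 2 ≤
      (F (𝒵 (t + 1) ω).1 - F (𝒵 t ω).1) + α * (‖searchError 𝓜 π H (𝒵 t ω)‖ ^ 2 / 2 -
        ‖proxStep Q η (𝒵 t ω)‖ ^ 2 / 3) := by
    intro t
    have h1 := (averaged_prox_step_ascent hQ (h.expReward_lower_bound hL) hα0 hα1 hη0 hηα
      (𝒵 t ω).1 (𝒵 t ω).2 (hdom t)).2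
    have h2 := mul_le_mul_of_nonneg_left (norm_exact_step_sq_le hQ hη0 hη1 (𝒵 t ω).1 (𝒵 t ω).2
      (gradient J (𝒵 t ω).1)) hα0.le
    change F (𝒵 t ω).1 + α * (2 * ‖proxStep Q η (𝒵 t ω)‖ ^ 2 -
      ⟪searchError 𝓜 π H (𝒵 t ω), proxStep Q η (𝒵 t ω)⟫) ≤ F (𝒵 (t + 1) ω).1 at h1
    change α * ‖exactStep J Q η (𝒵 t ω)‖ ^ 2 ≤ α * (2 * ‖proxStep Q η (𝒵 t ω)‖ ^ 2 -
      ⟪searchError 𝓜 π H (𝒵 t ω), proxStep Q η (𝒵 t ω)⟫ + ‖searchError 𝓜 π H (𝒵 t ω)‖ ^ 2 / 2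
      - ‖proxStep Q η (𝒵 t ω)‖ ^ 2 / 3) at h2
    linarith
  have hsum := Finset.sum_le_sum fun t (_ : t ∈ Finset.range (m + 1)) => hstep t
  rw [← Finset.mul_sum, Finset.sum_add_distrib,
    Finset.sum_range_sub (fun t => F (𝒵 t ω).1), ← Finset.mul_sum, Finset.sum_sub_distrib,
    ← Finset.sum_div, ← Finset.sum_div] at hsum
  rw [hF0]
  linarith [hFle (m + 1)]

variable [MeasurableSpace Ω] {μ : Measure Ω}

lemma memLp_prox [IsFiniteMeasure μ] (hQ : ProperClosedConvex Q) (hη : 0 < η)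
    {f : Ω → EuclideanSpace ℝ (Fin q)} (hf : MemLp f 2 μ) :
    MemLp (fun ω => prox η Q (f ω)) 2 μ := by
  have h1 : MemLp (fun ω => prox η Q (f ω) - prox η Q 0) 2 μ := by
    refine hf.of_le (((continuous_prox hQ hη).comp_aestronglyMeasurable
      hf.aestronglyMeasurable).sub aestronglyMeasurable_const)
      (Filter.Eventually.of_forall fun ω => ?_)
    simpa using norm_prox_sub_le hQ hη (f ω) 0
  have h2 := h1.add (memLp_const (prox η Q 0))
  exact h2.ae_eq (Filter.Eventually.of_forall fun ω => by simp)

/-- The gradient of `J` is bounded, so `v = e + ∇J(θ)` is square integrable, and the 1-Lipschitz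
prox preserves `L²`. -/
lemma BoundedSetting.memLp_steps [IsProbabilityMeasure μ] (h : BoundedSetting 𝓜 π b R G M bbar)
    (hQ : ProperClosedConvex Q) (hη : 0 < η)
    {z : Ω → EuclideanSpace ℝ (Fin q) × EuclideanSpace ℝ (Fin q)}
    (he : MemLp (fun ω => searchError 𝓜 π H (z ω)) 2 μ) (hθ : MemLp (fun ω => (z ω).1) 2 μ) :
    MemLp (fun ω => proxStep Q η (z ω)) 2 μ ∧
      MemLp (fun ω => exactStep (expReward 𝓜 π H) Q η (z ω)) 2 μ := by
  have hg : MemLp (fun ω => gradient (expReward 𝓜 π H) (z ω).1) 2 μ :=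
    MemLp.of_bound (h.continuous_gradient.comp_aestronglyMeasurable hθ.aestronglyMeasurable) _
      (Filter.Eventually.of_forall fun ω => h.norm_gradient_le _)
  have hv : MemLp (fun ω => (z ω).2) 2 μ :=
    (he.add hg).ae_eq (Filter.Eventually.of_forall fun ω => by simp [searchError])
  exact ⟨(memLp_prox hQ hη (hθ.add (hv.const_smul η))).sub hθ,
    (memLp_prox hQ hη (hθ.add (hg.const_smul η))).sub hθ⟩

lemma IsRun.integral_searchError_zero_le
    (hrun : IsRun 𝓜 π b Q α β η θ₀ m N B μ D₀ D D' T) (h : BoundedSetting 𝓜 π b R G M bbar)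
    (hQ : ProperClosedConvex Q) (hη : 0 < η)
    (hN : 1 ≤ N) {σ : ℝ} (hσ : constCg R G bbar 𝓜.discount H ≤ σ) :
    ∫ ω, ‖searchError 𝓜 π H (𝒵 0 ω)‖ ^ 2 ∂μ ≤ σ ^ 2 / N := by
  have hm : Measurable fun ω => searchError 𝓜 π H (𝒵 0 ω) :=
    h.continuous_searchError.measurable.comp (hrun.measurable_runState h hQ hη (Nat.zero_le m))
  have h1 := hrun.lintegral_searchError_zero_le h hN hσ
  rw [← ofReal_integral_eq_lintegral_ofReal (integrable_sq_norm_of_lintegral_le hm h1)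
    (Filter.Eventually.of_forall fun x => sq_nonneg _)] at h1
  exact (ENNReal.ofReal_le_ofReal_iff (by positivity)).1 h1

variable [IsProbabilityMeasure μ]

/-- Error and parameter go through the induction together: the error bound at the next step involves
the displacement, whose square integrability needs both. -/
lemma IsRun.memLp_state
    (hrun : IsRun 𝓜 π b Q α β η θ₀ m N B μ D₀ D D' T) (h : BoundedSetting 𝓜 π b R G M bbar)
    (hQ : ProperClosedConvex Q) (hη : 0 < η) (hα0 : 0 ≤ α) (hα1 : α ≤ 1) (hθ₀ : Q θ₀ ≠ ⊤)
    {W : ℝ} (hW0 : 0 ≤ W)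
    (hW : ∀ θ₁ θ₂, Q θ₁ ≠ ⊤ → Q θ₂ ≠ ⊤ →
      evariance (impWeight π (H := H) θ₁ θ₂) (trajLaw 𝓜 π H θ₁) ≤ ENNReal.ofReal W)
    (hN : 1 ≤ N) (hB : 1 ≤ B) (hC : 0 ≤ constCbar R G M W bbar 𝓜.discount H) {t : ℕ}
    (ht : t ≤ m) :
    MemLp (fun ω => searchError 𝓜 π H (𝒵 t ω)) 2 μ ∧ MemLp (fun ω => (𝒵 t ω).1) 2 μ := by
  have hmeas : ∀ t ≤ m, Measurable fun ω => searchError 𝓜 π H (𝒵 t ω) := fun t ht =>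
    h.continuous_searchError.measurable.comp (hrun.measurable_runState h hQ hη ht)
  induction t with
  | zero =>
    refine ⟨(memLp_two_iff_integrable_sq_norm (hmeas 0 ht).aestronglyMeasurable).2 ?_, ?_⟩
    · exact integrable_sq_norm_of_lintegral_le (hmeas 0 ht)
        (hrun.lintegral_searchError_zero_le h hN le_rfl)
    · exact memLp_const θ₀
  | succ t ih =>
    obtain ⟨he, hθ⟩ := ih (by omega)
    obtain ⟨hd, -⟩ := h.memLp_steps hQ hη he hθ
    refine ⟨(memLp_two_iff_integrable_sq_norm (hmeas _ ht).aestronglyMeasurable).2 ?_, ?_⟩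
    · have hint : Integrable (fun ω => β ^ 2 * ‖searchError 𝓜 π H (𝒵 t ω)‖ ^ 2
          + 2 * β ^ 2 * constCbar R G M W bbar 𝓜.discount H / B *
            (α ^ 2 * ‖proxStep Q η (𝒵 t ω)‖ ^ 2)
          + (1 - β) ^ 2 * constCg R G bbar 𝓜.discount H ^ 2 / B) μ :=
        ((he.integrable_norm_pow two_ne_zero).const_mul _).add
          (((hd.integrable_norm_pow two_ne_zero).const_mul _).const_mul _) |>.add
          (integrable_const _)
      refine ⟨((hmeas _ ht).norm.pow_const 2).aestronglyMeasurable, ?_⟩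
      rw [hasFiniteIntegral_iff_ofReal (Filter.Eventually.of_forall fun x => sq_nonneg _)]
      refine (hrun.lintegral_searchError_succ_le h hQ hη hα0 hα1 hθ₀ hW0 hW hB le_rfl hC
        (by omega)).trans_lt ?_
      exact (lintegral_ofReal_le_lintegral_enorm _).trans_lt hint.2
    · refine (hθ.add (hd.const_smul α)).ae_eq (Filter.Eventually.of_forall fun ω => ?_)
      change (𝒵 t ω).1 + α • proxStep Q η (𝒵 t ω) = nextPoint Q α η (𝒵 t ω)
      rw [← nextPoint_sub]; abel

lemma IsRun.integral_searchError_succ_le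
    (hrun : IsRun 𝓜 π b Q α β η θ₀ m N B μ D₀ D D' T) (h : BoundedSetting 𝓜 π b R G M bbar)
    (hQ : ProperClosedConvex Q) (hη : 0 < η) (hα0 : 0 ≤ α) (hα1 : α ≤ 1) (hθ₀ : Q θ₀ ≠ ⊤)
    {W : ℝ} (hW0 : 0 ≤ W)
    (hW : ∀ θ₁ θ₂, Q θ₁ ≠ ⊤ → Q θ₂ ≠ ⊤ →
      evariance (impWeight π (H := H) θ₁ θ₂) (trajLaw 𝓜 π H θ₁) ≤ ENNReal.ofReal W)
    (hN : 1 ≤ N) (hB : 1 ≤ B) {σ : ℝ} (hσ : constCg R G bbar 𝓜.discount H ≤ σ)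
    (hC : 0 ≤ constCbar R G M W bbar 𝓜.discount H) {t : ℕ} (ht : t < m) :
    ∫ ω, ‖searchError 𝓜 π H (𝒵 (t + 1) ω)‖ ^ 2 ∂μ ≤
      β ^ 2 * ∫ ω, ‖searchError 𝓜 π H (𝒵 t ω)‖ ^ 2 ∂μ
        + 2 * β ^ 2 * constCbar R G M W bbar 𝓜.discount H / B *
          (α ^ 2 * ∫ ω, ‖proxStep Q η (𝒵 t ω)‖ ^ 2 ∂μ)
        + (1 - β) ^ 2 * σ ^ 2 / B := by
  obtain ⟨he', -⟩ := hrun.memLp_state h hQ hη hα0 hα1 hθ₀ hW0 hW hN hB hC (t := t + 1) ht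
  obtain ⟨he, hθ⟩ := hrun.memLp_state h hQ hη hα0 hα1 hθ₀ hW0 hW hN hB hC (t := t) ht.le
  obtain ⟨hd, -⟩ := h.memLp_steps hQ hη he hθ
  have hi1 := (he.integrable_norm_pow two_ne_zero).const_mul (β ^ 2)
  have hi2 := ((hd.integrable_norm_pow two_ne_zero).const_mul (α ^ 2)).const_mul
    (2 * β ^ 2 * constCbar R G M W bbar 𝓜.discount H / B)
  have h1 := hrun.lintegral_searchError_succ_le h hQ hη hα0 hα1 hθ₀ hW0 hW hB hσ hC ht
  have hi12 : Integrable (fun ω => β ^ 2 * ‖searchError 𝓜 π H (𝒵 t ω)‖ ^ 2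
      + 2 * β ^ 2 * constCbar R G M W bbar 𝓜.discount H / B *
        (α ^ 2 * ‖proxStep Q η (𝒵 t ω)‖ ^ 2)) μ := hi1.add hi2
  have hi : Integrable (fun ω => β ^ 2 * ‖searchError 𝓜 π H (𝒵 t ω)‖ ^ 2
      + 2 * β ^ 2 * constCbar R G M W bbar 𝓜.discount H / B *
        (α ^ 2 * ‖proxStep Q η (𝒵 t ω)‖ ^ 2)
      + (1 - β) ^ 2 * σ ^ 2 / B) μ := hi12.add (integrable_const _)
  rw [← ofReal_integral_eq_lintegral_ofReal (he'.integrable_norm_pow two_ne_zero)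
      (Filter.Eventually.of_forall fun x => sq_nonneg _),
    ← ofReal_integral_eq_lintegral_ofReal hi
      (Filter.Eventually.of_forall fun x => by simp only [Pi.zero_apply]; positivity)] at h1
  refine ((ENNReal.ofReal_le_ofReal_iff (integral_nonneg fun x => by
    simp only [Pi.zero_apply]; positivity)).1 h1).trans_eq ?_
  rw [integral_add hi12 (integrable_const _), integral_add hi1 hi2, integral_const_mul,
    integral_const_mul, integral_const_mul]
  simp

end Runs

end HSPG

end

/-! ### The convergence rate -/

theorem theorem1 {S A : Type*} [MeasurableSpace S] [MeasurableSpace A]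
    (lam : Measure A) [SigmaFinite lam] {q : ℕ}
    (𝓜 : HSPG.MDP S A) (π : HSPG.Policy q S lam) (H : ℕ) (hH : 1 ≤ H)
    -- the baseline and its bound
    (b : Fin H → S → ℝ) (hb_meas : ∀ t, Measurable (b t))
    (bbar : ℝ) (hb : ∀ t s, |b t s| ≤ bbar)
    -- the regularizer and the optimal value
    (Q : EuclideanSpace ℝ (Fin q) → EReal) (hQ : HSPG.ProperClosedConvex Q)
    (Fstar : ℝ)
    (hFstar : IsLUB (Set.range (HSPG.objective (HSPG.expReward 𝓜 π H) Q)) (Fstar : EReal))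
    -- bounded rewards
    (R : ℝ) (hR_pos : 0 < R) (hR : ∀ s a, |𝓜.reward s a| ≤ R)
    -- bounded first and second derivatives of the log-policy
    (G M : ℝ) (hG_pos : 0 < G) (hM_pos : 0 < M)
    (hdiff : ∀ s a, Differentiable ℝ (fun θ => Real.log (π.dens θ s a)))
    (hdiff2 : ∀ s a, Differentiable ℝ (HSPG.score π s a))
    (hG : ∀ s a θ, ‖HSPG.score π s a θ‖ ≤ G)
    (hM : ∀ s a θ, ‖fderiv ℝ (HSPG.score π s a) θ‖ ≤ M)
    -- bounded variance of the importance weights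
    (W : ℝ) (hW_pos : 0 < W)
    (hW : ∀ θ₁ θ₂, Q θ₁ ≠ ⊤ → Q θ₂ ≠ ⊤ →
      evariance (HSPG.impWeight π (H := H) θ₁ θ₂) (HSPG.trajLaw 𝓜 π H θ₁) ≤ ENNReal.ofReal W)
    -- the constants `L`, `σ`, `C̄`
    (L σ Cbar : ℝ) (hL : HSPG.constL R G M 𝓜.discount H ≤ L)
    (hσ : HSPG.constCg R G bbar 𝓜.discount H ≤ σ)
    (hCbar : Cbar = HSPG.constCbar R G M W bbar 𝓜.discount H)
    -- the parameters of the algorithm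
    (m N B : ℕ) (hB : 1 ≤ B) (hBN : B ≤ N * (m + 1))
    (c α β η : ℝ) (hc_pos : 0 < c) (hc : c ≤ 1)
    (hβ : β = 1 - √(B : ℝ) / √((N : ℝ) * (m + 1)))
    (hα : α = c * √2 * (B : ℝ) ^ (3 / 4 : ℝ) /
      (√(3 * Cbar) * (N : ℝ) ^ (1 / 4 : ℝ) * ((m : ℝ) + 1) ^ (1 / 4 : ℝ)))
    (hα_le : α ≤ 1)
    (hη : η = 2 / (4 + L * α))
    (θ₀ : EuclideanSpace ℝ (Fin q)) (hθ₀ : Q θ₀ ≠ ⊤)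
    -- a run of the algorithm
    {Ω : Type*} [MeasurableSpace Ω] (μ : Measure Ω) [IsProbabilityMeasure μ]
    (D₀ : Ω → Fin N → HSPG.Traj S A H) (D D' : ℕ → Ω → Fin B → HSPG.Traj S A H)
    (T : Ω → Fin (m + 1))
    (hrun : HSPG.IsRun 𝓜 π b Q α β η θ₀ m N B μ D₀ D D' T)
    -- the returned iterate
    (θT : Ω → EuclideanSpace ℝ (Fin q))
    (hθT : ∀ ω, θT ω = (HSPG.iter 𝓜 π b Q α β η θ₀ (D₀ ω) (fun s => D s ω) (fun s => D' s ω)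
      (T ω : ℕ)).1) :
    Integrable (fun ω => ‖HSPG.gradMap (HSPG.expReward 𝓜 π H) Q η (θT ω)‖ ^ 2) μ ∧
    ∫ ω, ‖HSPG.gradMap (HSPG.expReward 𝓜 π H) Q η (θT ω)‖ ^ 2 ∂μ ≤
      3 * (4 + L) ^ 2 * σ ^ 2 / (4 * √((B : ℝ) * N * (m + 1)))
      + (4 + L) ^ 2 * √(3 * Cbar) * (N : ℝ) ^ (1 / 4 : ℝ)
          / (4 * c * √2 * ((B : ℝ) * (m + 1)) ^ (3 / 4 : ℝ))
        * (Fstar - (HSPG.objective (HSPG.expReward 𝓜 π H) Q θ₀).toReal) := by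
  -- A state and a time are needed to read `0 ≤ bbar` off the baseline bound.
  have hS : Nonempty S := by
    have := 𝓜.isProb
    exact 𝓜.init.nonempty_of_neZero
  have hbbar : 0 ≤ bbar := (abs_nonneg _).trans (hb ⟨0, hH⟩ hS.some)
  have h : HSPG.BoundedSetting 𝓜 π b R G M bbar :=
    { smooth := ⟨hG_pos.le, hM_pos.le, hdiff, hdiff2, hG, hM⟩
      R_nonneg := hR_pos.le
      bbar_nonneg := hbbar
      abs_reward_le := hR
      measurable_baseline := hb_meas
      abs_baseline_le := hb }
  have hC : 0 < Cbar := hCbar ▸ h.constCbar_pos hH hR_pos hM_pos hW_pos.le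
  have hN : 1 ≤ N := by
    rcases Nat.eq_zero_or_pos N with h0 | h0
    · subst h0; omega
    · exact h0
  have hL0 : 0 ≤ L := by
    refine le_trans ?_ hL
    have := sub_pos.2 𝓜.discount_lt_one
    rw [HSPG.constL]; positivity
  have hα0 : 0 < α := by
    have hB0 : (0 : ℝ) < B := by exact_mod_cast hB
    have hN0 : (0 : ℝ) < N := by exact_mod_cast hN
    rw [hα]; positivity
  have hden : 0 < 4 + L * α := by positivity
  have hη0 : 0 < η := by rw [hη]; positivity
  have hη1 : η ≤ 1 / 2 := by
    rw [hη, div_le_div_iff₀ hden two_pos]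
    linarith [mul_nonneg hL0 hα0.le]
  have hηα : η⁻¹ = 2 + L * α / 2 := by rw [hη, inv_div]; ring
  have hF : ∀ θ, HSPG.objective (HSPG.expReward 𝓜 π H) Q θ ≤ (Fstar : EReal) := fun θ =>
    hFstar.1 ⟨θ, rfl⟩
  have hΔ : 0 ≤ Fstar - (HSPG.objective (HSPG.expReward 𝓜 π H) Q θ₀).toReal := by
    have h1 := hF θ₀
    rw [HSPG.objective_eq_coe hQ _ hθ₀] at h1 ⊢
    rw [EReal.toReal_coe]
    exact sub_nonneg.2 (by exact_mod_cast h1)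
  set Z := HSPG.runState 𝓜 π b Q α β η θ₀ D₀ D D' with hZ
  have hC' := hCbar ▸ hC.le
  have hmem : ∀ t ≤ m, _ := fun t ht =>
    hrun.memLp_state h hQ hη0 hα0.le hα_le hθ₀ hW_pos.le hW hN hB hC' (t := t) ht
  have hsteps : ∀ t ≤ m, _ := fun t ht =>
    h.memLp_steps (z := Z t) hQ hη0 (hmem t ht).1 (hmem t ht).2
  have hX : ∀ t ≤ m, MeasureTheory.Integrable
      (fun ω => ‖HSPG.exactStep (HSPG.expReward 𝓜 π H) Q η (Z t ω)‖ ^ 2) μ := fun t ht =>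
    (hsteps t ht).2.integrable_norm_pow two_ne_zero
  have hE : ∀ t ≤ m, MeasureTheory.Integrable
      (fun ω => ‖HSPG.searchError 𝓜 π H (Z t ω)‖ ^ 2) μ := fun t ht =>
    (hmem t ht).1.integrable_norm_pow two_ne_zero
  have hD : ∀ t ≤ m, MeasureTheory.Integrable
      (fun ω => ‖HSPG.proxStep Q η (Z t ω)‖ ^ 2) μ := fun t ht =>
    (hsteps t ht).1.integrable_norm_pow two_ne_zero
  have hle : ∀ {t}, t ∈ Finset.range (m + 1) → t ≤ m := fun ht => by
    have := Finset.mem_range.1 ht; omega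
  have hsum : α * ∑ t ∈ Finset.range (m + 1),
      ∫ ω, ‖HSPG.exactStep (HSPG.expReward 𝓜 π H) Q η (Z t ω)‖ ^ 2 ∂μ ≤
      (Fstar - (HSPG.objective (HSPG.expReward 𝓜 π H) Q θ₀).toReal) +
      α * ((∑ t ∈ Finset.range (m + 1), ∫ ω, ‖HSPG.searchError 𝓜 π H (Z t ω)‖ ^ 2 ∂μ) / 2 -
        (∑ t ∈ Finset.range (m + 1), ∫ ω, ‖HSPG.proxStep Q η (Z t ω)‖ ^ 2 ∂μ) / 3) := by
    have hi1 := MeasureTheory.integrable_finsetSum (Finset.range (m + 1))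
      fun t ht => hX t (hle ht)
    have hi2 := MeasureTheory.integrable_finsetSum (Finset.range (m + 1))
      fun t ht => hE t (hle ht)
    have hi3 := MeasureTheory.integrable_finsetSum (Finset.range (m + 1))
      fun t ht => hD t (hle ht)
    have hi4 : MeasureTheory.Integrable (fun ω => α *
        ((∑ t ∈ Finset.range (m + 1), ‖HSPG.searchError 𝓜 π H (Z t ω)‖ ^ 2) / 2 -
          (∑ t ∈ Finset.range (m + 1), ‖HSPG.proxStep Q η (Z t ω)‖ ^ 2) / 3)) μ :=
      ((hi2.div_const 2).sub (hi3.div_const 3)).const_mul α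
    have hmono := MeasureTheory.integral_mono (hi1.const_mul α)
      ((MeasureTheory.integrable_const
        (Fstar - (HSPG.objective (HSPG.expReward 𝓜 π H) Q θ₀).toReal)).add hi4)
      (fun ω => HSPG.sum_exactStep_le (D₀ := D₀) (D := D) (D' := D') (β := β) h hQ hF hL hα0
        hα_le hη0 hη1 hηα hθ₀ m ω)
    simp only [Pi.add_apply] at hmono
    rw [MeasureTheory.integral_const_mul, MeasureTheory.integral_finsetSum _
        fun t ht => hX t (hle ht), MeasureTheory.integral_add (MeasureTheory.integrable_const _) hi4,
      MeasureTheory.integral_const_mul,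
      MeasureTheory.integral_sub (hi2.div_const 2) (hi3.div_const 3),
      MeasureTheory.integral_div, MeasureTheory.integral_div,
      MeasureTheory.integral_finsetSum _ fun t ht => hE t (hle ht),
      MeasureTheory.integral_finsetSum _ fun t ht => hD t (hle ht)] at hmono
    simpa using hmono
  -- The scalar lemma is applied to the expectations of `‖e_t‖²`, `‖d_t‖²` and `‖x_t‖²`.
  have hrate := HSPG.rate_of_error_recursion hB hBN hC hL0 hc_pos hc hβ hα hα_le hη hΔ
    (a := fun t => ∫ ω, ‖HSPG.searchError 𝓜 π H (Z t ω)‖ ^ 2 ∂μ)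
    (D := fun t => ∫ ω, ‖HSPG.proxStep Q η (Z t ω)‖ ^ 2 ∂μ)
    (X := fun t => ∫ ω, ‖HSPG.exactStep (HSPG.expReward 𝓜 π H) Q η (Z t ω)‖ ^ 2 ∂μ)
    (σ := σ) (fun t => MeasureTheory.integral_nonneg fun ω => sq_nonneg _)
    (fun t => MeasureTheory.integral_nonneg fun ω => sq_nonneg _)
    (hrun.integral_searchError_zero_le h hQ hη0 hN hσ)
    (fun t ht => hCbar ▸ hrun.integral_searchError_succ_le h hQ hη0 hα0.le hα_le hθ₀ hW_pos.le hW
      hN hB hσ hC' ht) hsum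
  have hgm : ∀ ω, ‖HSPG.gradMap (HSPG.expReward 𝓜 π H) Q η (θT ω)‖ ^ 2 =
      (η⁻¹) ^ 2 * ‖HSPG.exactStep (HSPG.expReward 𝓜 π H) Q η (Z (T ω) ω)‖ ^ 2 := by
    intro ω
    rw [hθT, HSPG.gradMap, norm_smul, mul_pow, Real.norm_eq_abs, sq_abs]
    rfl
  obtain ⟨hint, hval⟩ := HSPG.integral_uniform_index (μ := μ) hrun.measurable_index
    hrun.uniform_index hrun.indep_index
    (f := fun t ω => (η⁻¹) ^ 2 * ‖HSPG.exactStep (HSPG.expReward 𝓜 π H) Q η (Z t ω)‖ ^ 2)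
    (fun t ht => by
      -- All states with `t ≤ m` are measurable for `history (m + 1)`, the `σ`-field from which the
      -- index is independent.
      have h1 := (h.measurable_runState (D₀ := D₀) (D := D) (D' := D') (θ₀ := θ₀) (α := α) (β := β)
        hQ hη0 t).mono (HSPG.history_mono D₀ D D' (Nat.succ_le_succ ht)) le_rfl
      have h2 : Measurable fun z => (η⁻¹) ^ 2 *
          ‖HSPG.exactStep (HSPG.expReward 𝓜 π H) Q η z‖ ^ 2 :=
        (((h.continuous_exactStep hQ hη0).norm.pow 2).const_mul _).measurable
      exact h2.comp h1)
    (fun t ht => (hX t ht).const_mul _)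
  simp_rw [hgm]
  refine ⟨hint, ?_⟩
  rw [hval]
  simp_rw [MeasureTheory.integral_const_mul]
  rw [← Finset.mul_sum]
  exact hrate
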